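/- Let $\Omega\subset\mathbb R^2$ be a polygonal domain partitioned into finitely many convex polygonal coarse elements $K$, with vertices (coarse nodes) $x_j$, coarse neighbourhoods $\omega_j=\bigcup\{K: x_j\in K\}$ (interior taken), and a Lipschitz partition of unity $\{\chi_j\}$, $0\le\chi_j\le1$, with $\chi_j$ supported in $\omega_j$. Let $D_{f,l}$ be finitely many straight fracture segments, and $\nabla_f$ the derivative along them. For $N$ continua let $$c(u,v)=\sum_i\Big(\int_\Omega c_iu_iv_i\,dx+\sum_l\int_{D_{f,l}\cap\Omega}c_{l,i}u_iv_i\Big),\qquad a(u,v)=\sum_i\Big(\int_\Omega\kappa_i\nabla u_i\cdot\nabla v_i\,dx+\sum_l\int_{D_{f,l}\cap\Omega}\kappa_{l,i}\nabla_fu_i\cdot\nabla_fv_i\Big),$$ $$q(u,v)=\sum_j\sum_{i\ne j}\int_\Omega Q_{ij}(u_i-u_j)v_j\,dx,\qquad a_Q=a-q,$$ with bounded measurable coefficients, $c_i,c_{l,i}\ge0$, $\kappa_i,\kappa_{l,i}$ bounded below by a positive constant, and $Q_{ij}=Q_{ji}\ge0$. Let $a_Q^{(j)}$ be the same form with all integrals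 over $\omega_j$, and $$s^{(j)}(u,v)=\sum_i\Big(\int_{\omega_j}\kappa_i|\nabla\chi_j|^2u_iv_i\,dx+\sum_l\int_{D_{f,l}\cap\omega_j}\kappa_{l,i}|\nabla_f\chi_j|^2u_iv_i\Big).$$ Write $\|v\|_c^2=c(v,v)$, $\|v\|_{a_Q}^2=a_Q(v,v)$. Here $H^1$ and $H^1_0$ of a region denote the energy spaces: the closures, in the $L^2$ norm of the function and its gradient in the region and of its values and tangential derivatives on the fractures there, of the locally Lipschitz functions of finite norm, respectively of the Lipschitz functions with compact support in the region. Let $\Gamma\subseteq\partial\Omega$ be closed and let $J$ be a nonempty set of coarse nodes such that $\chi_j=0$ on $\partial\Omega\setminus\Gamma$ for $j\in J$ (for example all nodes and $\Gamma=\partial\Omega$, or only interior nodes and $\Gamma=\emptyset$, when their $\chi_j$ vanish on $\partial\Omega$). Let $u\in H^1(0,T;[H^1(\Omega)]^N)$ vanish on $\Gamma$ and satisfy, for a.e. $t\in(0,T)$, $$c(\partial_tu,v)=-a(u,v)+q(u,v)+(f,v)\qquad\forall v\in[H^1_0(\Omega)]^N .$$ For $j\in J$ let $V_{snap}(\omega_j)$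 be the space of all $\psi\in[H^1(\omega_j)]^N$ that vanish on $\Gamma$ and satisfy $a_Q^{(j)}(\psi,v)=0$ for all $v\in[H^1_0(\omega_j)]^N$. Let $\phi^{(j)}_1,\phi^{(j)}_2,\dots\in V_{snap}(\omega_j)$ be a complete $s^{(j)}$-orthonormal system of eigenfunctions of $$a_Q^{(j)}(\phi,v)=\lambda\,s^{(j)}(\phi,v)\qquad\forall v\in V_{snap}(\omega_j)$$ with eigenvalues $\lambda^{(j)}_1\le\lambda^{(j)}_2\le\cdots$, and let $L_j\ge0$. Let $u^{(j)}_{snap}(t)\in V_{snap}(\omega_j)$ have the same boundary values as $u(t)$ on $\partial\omega_j$, write $u^{(j)}_{snap}(t)=\sum_kc^{(j)}_k(t)\phi^{(j)}_k$ (convergent in the energy space), and let $$u_{snap}=\sum_{j\in J}\chi_ju^{(j)}_{snap},\qquad w=\sum_{j\in J}\sum_{k\le L_j}c^{(j)}_k(t)\,\chi_j\phi^{(j)}_k .$$ Suppose that $\Lambda_2=\min_{j\in J}\lambda^{(j)}_{L_j+1}>0$. Let $D$ bound the number of coarse neighbourhoods that intersect any one coarse element, and let $E$ be such that $c_i\chi_j^2\le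 E\kappa_i|\nabla\chi_j|^2$ a.e. in $\omega_j$ and $c_{l,i}\chi_j^2\le E\kappa_{l,i}|\nabla_f\chi_j|^2$ a.e. on $D_{f,l}\cap\omega_j$, for all $i,l$ and $j\in J$. Then $w-u_{snap}$ belongs to $H^1(0,T)$ with values in the energy space, and $$\int_0^T\Big\|\frac{\partial(w-u_{snap})}{\partial t}\Big\|_c^2dt+\int_0^T\|w-u_{snap}\|_{a_Q}^2dt+\|w(0)-u_{snap}(0)\|_c^2\le\frac{C^2}{\Lambda_2}\Big(\int_0^T\Big\|\frac{\partial u}{\partial t}\Big\|_{a_Q}^2dt+\int_0^T\|u\|_{a_Q}^2dt+\|u(0)\|_{a_Q}^2\Big),$$ where $C$ depends only on $D$ and $E$. -/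

import Mathlib

open MeasureTheory Set Topology
open scoped NNReal ENNReal

noncomputable section

namespace GMsFEM

/-- The plane with its Euclidean norm. -/
abbrev Plane : Type := EuclideanSpace ℝ (Fin 2)

/-! ### Resolved fractures -/

/-- A network of `m` resolved fractures: straight segments, parametrised by arc length. They may
cross or share end points, so polygonal fractures are included (as several segments). -/
structure Fractures (m : ℕ) where
  base : Fin m → Plane
  dir : Fin m → Plane
  len : Fin m → ℝ
  norm_dir : ∀ l, ‖dir l‖ = 1
  len_pos : ∀ l, 0 < len l

namespace Fractures

variable {m : ℕ}

/-- Arc length parametrisation of the line that carries the `l`-th fracture. -/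
def line (F : Fractures m) (l : Fin m) (s : ℝ) : Plane := F.base l + s • F.dir l

/-- The parameters of the points of the part of the `l`-th fracture that lies in `ω`. -/
def part (F : Fractures m) (l : Fin m) (ω : Set Plane) : Set ℝ :=
  Icc 0 (F.len l) ∩ F.line l ⁻¹' ω

theorem lipschitz_line (F : Fractures m) (l : Fin m) : LipschitzWith 1 (F.line l) := by
  refine LipschitzWith.of_dist_le_mul fun s t => ?_
  simp [line, dist_eq_norm, ← sub_smul, norm_smul, F.norm_dir l]

theorem measurableSet_part (F : Fractures m) (l : Fin m) {ω : Set Plane} (hω : IsOpen ω) :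
    MeasurableSet (F.part l ω) :=
  measurableSet_Icc.inter (hω.preimage (F.lipschitz_line l).continuous).measurableSet

end Fractures

/-! ### The energy space -/

/-- Square integrable data `(u, ∇u, (u on the fractures), (∇_f u on the fractures))`.
A function on a region `ω` is represented by data that are zero off `ω`. -/
abbrev Tuple (m : ℕ) : Type :=
  Lp ℝ 2 (volume : Measure Plane) × Lp Plane 2 (volume : Measure Plane) ×
    (Fin m → Lp ℝ 2 (volume : Measure ℝ)) × (Fin m → Lp ℝ 2 (volume : Measure ℝ))

section Tuple

variable {m : ℕ}

/-- The function itself. -/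
def val (u : Tuple m) : Plane → ℝ := u.1

/-- Its gradient. -/
def grad (u : Tuple m) : Plane → Plane := u.2.1

/-- Its values on the `l`-th fracture, as a function of arc length. -/
def tr (u : Tuple m) (l : Fin m) : ℝ → ℝ := u.2.2.1 l

/-- Its derivative along the `l`-th fracture, as a function of arc length. -/
def dtr (u : Tuple m) (l : Fin m) : ℝ → ℝ := u.2.2.2 l

/-- `u` is the tuple of data on `ω` of the locally Lipschitz function `f`. -/
def Represents (F : Fractures m) (ω : Set Plane) (f : Plane → ℝ) (u : Tuple m) : Prop :=
  val u =ᵐ[volume] ω.indicator f ∧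
  grad u =ᵐ[volume] ω.indicator (fun x => gradient f x) ∧
  (∀ l, tr u l =ᵐ[volume] (F.part l ω).indicator (fun s => f (F.line l s))) ∧
  (∀ l, dtr u l =ᵐ[volume] (F.part l ω).indicator (deriv fun s => f (F.line l s)))

/-- The functions in `H¹(ω)` with `H¹` values along the fractures in `ω` that vanish on the
closed set `Γ`: the closure, in the norm of `L²` of the function and its gradient in `ω` and on the
fractures, of the locally Lipschitz functions on `ω` of finite norm that vanish near `Γ`. -/
def H1 (F : Fractures m) (Γ ω : Set Plane) : Set (Tuple m) :=
  closure {u | ∃ f : Plane → ℝ, LocallyLipschitzOn ω f ∧ (∀ᶠ x in 𝓝ˢ Γ, x ∈ ω → f x = 0) ∧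
    Represents F ω f u}

/-- The functions in `H¹(ω)` as above with zero trace on the whole boundary of `ω`: the closure
of the Lipschitz functions with compact support in `ω`. -/
def H10 (F : Fractures m) (ω : Set Plane) : Set (Tuple m) :=
  closure {u | ∃ f : Plane → ℝ, (∃ K : ℝ≥0, LipschitzWith K f) ∧ HasCompactSupport f ∧
    tsupport f ⊆ ω ∧ Represents F ω f u}

/-- Restriction to the open set `ω`. -/
def restr (F : Fractures m) (ω : TopologicalSpace.Opens Plane) (u : Tuple m) : Tuple m :=
  (((Lp.memLp u.1).indicator ω.isOpen.measurableSet).toLp,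
   ((Lp.memLp u.2.1).indicator ω.isOpen.measurableSet).toLp,
   fun l => ((Lp.memLp (u.2.2.1 l)).indicator (F.measurableSet_part l ω.isOpen)).toLp,
   fun l => ((Lp.memLp (u.2.2.2 l)).indicator (F.measurableSet_part l ω.isOpen)).toLp)

end Tuple

/-! ### Multiplication by a Lipschitz function -/

/-- A Lipschitz function with values in `[0, 1]`. -/
structure Cutoff where
  toFun : Plane → ℝ
  exists_lipschitz : ∃ K : ℝ≥0, LipschitzWith K toFun
  nonneg : ∀ x, 0 ≤ toFun x
  le_one : ∀ x, toFun x ≤ 1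

namespace Cutoff

variable {m : ℕ}

instance : CoeFun Cutoff fun _ => Plane → ℝ := ⟨Cutoff.toFun⟩

/-- The function along the line of the `l`-th fracture. -/
def onLine (χ : Cutoff) (F : Fractures m) (l : Fin m) (s : ℝ) : ℝ := χ (F.line l s)

theorem exists_lipschitz_onLine (χ : Cutoff) (F : Fractures m) (l : Fin m) :
    ∃ K : ℝ≥0, LipschitzWith K (χ.onLine F l) := by
  obtain ⟨K, hK⟩ := χ.exists_lipschitz
  exact ⟨K * 1, hK.comp (F.lipschitz_line l)⟩

theorem continuous (χ : Cutoff) : Continuous χ :=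
  χ.exists_lipschitz.elim fun _ h => h.continuous

theorem continuous_onLine (χ : Cutoff) (F : Fractures m) (l : Fin m) :
    Continuous (χ.onLine F l) :=
  (χ.exists_lipschitz_onLine F l).elim fun _ h => h.continuous

theorem norm_le_one (χ : Cutoff) (x : Plane) : ‖χ x‖ ≤ 1 := by
  rw [Real.norm_of_nonneg (χ.nonneg x)]
  exact χ.le_one x

theorem measurable_gradient (χ : Cutoff) : Measurable fun x => gradient χ x :=
  ((InnerProductSpace.toDual ℝ Plane).symm.continuous.measurable).comp (measurable_fderiv ℝ χ)

theorem exists_norm_gradient_le (χ : Cutoff) : ∃ K : ℝ, ∀ x, ‖gradient χ x‖ ≤ K := by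
  obtain ⟨K, hK⟩ := χ.exists_lipschitz
  refine ⟨K, fun x => ?_⟩
  rw [gradient, LinearIsometryEquiv.norm_map]
  exact norm_fderiv_le_of_lipschitz ℝ hK

theorem exists_norm_deriv_le (χ : Cutoff) (F : Fractures m) (l : Fin m) :
    ∃ K : ℝ, ∀ s, ‖deriv (χ.onLine F l) s‖ ≤ K := by
  obtain ⟨K, hK⟩ := χ.exists_lipschitz_onLine F l
  exact ⟨K, fun s => norm_deriv_le_of_lipschitz hK⟩

end Cutoff

theorem memLp_smul_of_bound {α V : Type*} [MeasurableSpace α] {μ : Measure α}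
    [NormedAddCommGroup V] [NormedSpace ℝ V] {g : α → ℝ} {f : α → V} {K : ℝ}
    (hg : AEStronglyMeasurable g μ) (hK : ∀ x, ‖g x‖ ≤ K) (hf : MemLp f 2 μ) :
    MemLp (fun x => g x • f x) 2 μ := by
  refine MemLp.of_le_mul (c := K) hf (hg.smul hf.1) (.of_forall fun x => ?_)
  rw [norm_smul]
  exact mul_le_mul_of_nonneg_right (hK x) (norm_nonneg _)

theorem memLp_smul_of_bound' {α V : Type*} [MeasurableSpace α] {μ : Measure α}
    [NormedAddCommGroup V] [NormedSpace ℝ V] {g : α → V} {f : α → ℝ} {K : ℝ}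
    (hg : AEStronglyMeasurable g μ) (hK : ∀ x, ‖g x‖ ≤ K) (hf : MemLp f 2 μ) :
    MemLp (fun x => f x • g x) 2 μ := by
  refine MemLp.of_le_mul (c := K) hf (hf.1.smul hg) (.of_forall fun x => ?_)
  rw [norm_smul, mul_comm]
  exact mul_le_mul_of_nonneg_right (hK x) (norm_nonneg _)

section Mul

variable {m : ℕ}

theorem memLp_mul_val (χ : Cutoff) (u : Tuple m) :
    MemLp (fun x => χ x • val u x) 2 volume :=
  memLp_smul_of_bound χ.continuous.aestronglyMeasurable χ.norm_le_one (Lp.memLp u.1)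

theorem memLp_mul_grad (χ : Cutoff) (u : Tuple m) :
    MemLp (fun x => χ x • grad u x + val u x • gradient χ x) 2 volume := by
  obtain ⟨K, hK⟩ := χ.exists_norm_gradient_le
  exact (memLp_smul_of_bound χ.continuous.aestronglyMeasurable χ.norm_le_one (Lp.memLp u.2.1)).add
    (memLp_smul_of_bound' χ.measurable_gradient.aestronglyMeasurable hK (Lp.memLp u.1))

theorem memLp_mul_tr (F : Fractures m) (χ : Cutoff) (u : Tuple m) (l : Fin m) :
    MemLp (fun s => χ.onLine F l s • tr u l s) 2 volume :=
  memLp_smul_of_bound (χ.continuous_onLine F l).aestronglyMeasurable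
    (fun _ => χ.norm_le_one _) (Lp.memLp (u.2.2.1 l))

theorem memLp_mul_dtr (F : Fractures m) (χ : Cutoff) (u : Tuple m) (l : Fin m) :
    MemLp (fun s => χ.onLine F l s • dtr u l s + tr u l s • deriv (χ.onLine F l) s) 2 volume := by
  obtain ⟨K, hK⟩ := χ.exists_norm_deriv_le F l
  exact (memLp_smul_of_bound (χ.continuous_onLine F l).aestronglyMeasurable
      (fun _ => χ.norm_le_one _) (Lp.memLp (u.2.2.2 l))).add
    (memLp_smul_of_bound' (measurable_deriv _).aestronglyMeasurable hK (Lp.memLp (u.2.2.1 l)))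

/-- The product `χ u`, with its gradients given by the product rule. -/
def mul (F : Fractures m) (χ : Cutoff) (u : Tuple m) : Tuple m :=
  ((memLp_mul_val χ u).toLp, (memLp_mul_grad χ u).toLp,
    fun l => (memLp_mul_tr F χ u l).toLp, fun l => (memLp_mul_dtr F χ u l).toLp)

end Mul

/-! ### Coefficients and bilinear forms -/

/-- Functions with `N` components, one for each continuum. -/
abbrev Vec (N m : ℕ) : Type := Fin N → Tuple m

/-- The product `χ u` of a scalar function and a function with `N` components. -/
def vmul {N m : ℕ} (F : Fractures m) (χ : Cutoff) (u : Vec N m) : Vec N m :=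
  fun i => mul F χ (u i)

/-- Coefficients of the `N`-continuum model with `m` resolved fractures: porosities `c`,
permeabilities `κ`, exchange coefficients `Q`; `cf` and `κf` are the porosities and permeabilities
on the fractures, as functions of arc length. -/
structure Coeffs (N m : ℕ) where
  c : Fin N → Plane → ℝ
  κ : Fin N → Plane → ℝ
  Q : Fin N → Fin N → Plane → ℝ
  cf : Fin m → Fin N → ℝ → ℝ
  κf : Fin m → Fin N → ℝ → ℝ
  measurable_c : ∀ i, Measurable (c i)
  measurable_κ : ∀ i, Measurable (κ i)
  measurable_Q : ∀ i j, Measurable (Q i j)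
  measurable_cf : ∀ l i, Measurable (cf l i)
  measurable_κf : ∀ l i, Measurable (κf l i)
  bounded : ∃ B : ℝ, (∀ i x, c i x ≤ B ∧ κ i x ≤ B) ∧ (∀ i j x, Q i j x ≤ B) ∧
    ∀ l i s, cf l i s ≤ B ∧ κf l i s ≤ B
  elliptic : ∃ b : ℝ, 0 < b ∧ (∀ i x, b ≤ κ i x) ∧ ∀ l i s, b ≤ κf l i s
  c_nonneg : ∀ i x, 0 ≤ c i x
  cf_nonneg : ∀ l i s, 0 ≤ cf l i s
  Q_nonneg : ∀ i j x, 0 ≤ Q i j x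
  Q_symm : ∀ i j x, Q i j x = Q j i x

section Forms

variable {N m : ℕ} (F : Fractures m) (A : Coeffs N m) (ω : Set Plane)

/-- The form `c(u, v)`, on the region `ω`. -/
def cForm (u v : Vec N m) : ℝ :=
  ∑ i, ((∫ x in ω, A.c i x * val (u i) x * val (v i) x) +
    ∑ l, ∫ s in F.part l ω, A.cf l i s * tr (u i) l s * tr (v i) l s)

/-- The form `a(u, v)`, on the region `ω`. -/
def aForm (u v : Vec N m) : ℝ :=
  ∑ i, ((∫ x in ω, A.κ i x * inner ℝ (grad (u i) x) (grad (v i) x)) +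
    ∑ l, ∫ s in F.part l ω, A.κf l i s * dtr (u i) l s * dtr (v i) l s)

/-- The exchange form `q(u, v)`, on the region `ω`. -/
def qForm (u v : Vec N m) : ℝ :=
  ∑ j, ∑ i ∈ Finset.univ.erase j,
    ∫ x in ω, A.Q i j x * (val (u i) x - val (u j) x) * val (v j) x

/-- The form `a_Q(u, v) = a(u, v) - q(u, v)`, on the region `ω`. -/
def aQForm (u v : Vec N m) : ℝ := aForm F A ω u v - qForm A ω u v

/-- The form `s(u, v)` of the spectral problem, on the region `ω`, with the cutoff `χ`. -/
def sForm (χ : Cutoff) (u v : Vec N m) : ℝ :=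
  ∑ i, ((∫ x in ω, A.κ i x * ‖gradient χ x‖ ^ 2 * val (u i) x * val (v i) x) +
    ∑ l, ∫ s in F.part l ω,
      A.κf l i s * deriv (χ.onLine F l) s ^ 2 * tr (u i) l s * tr (v i) l s)

end Forms

/-! ### The coarse grid -/

/-- A partition of a polygonal domain into finitely many convex polygons. -/
structure CoarseGrid where
  card : ℕ
  verts : Fin card → Finset Plane
  extreme : ∀ k, (verts k : Set Plane) = (convexHull ℝ (verts k : Set Plane)).extremePoints ℝ
  nondegenerate : ∀ k, (interior (convexHull ℝ (verts k : Set Plane))).Nonempty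
  disjoint : ∀ k k', k ≠ k' → Disjoint (interior (convexHull ℝ (verts k : Set Plane)))
    (interior (convexHull ℝ (verts k' : Set Plane)))

namespace CoarseGrid

/-- The (closed) coarse elements. -/
def elem (G : CoarseGrid) (k : Fin G.card) : Set Plane := convexHull ℝ (G.verts k : Set Plane)

/-- The domain that the grid partitions. -/
def dom (G : CoarseGrid) : Set Plane := interior (⋃ k, G.elem k)

open Classical in
/-- The coarse nodes: all vertices of the coarse elements. -/
def nodes (G : CoarseGrid) : Finset Plane := Finset.univ.biUnion G.verts

/-- The coarse neighbourhood of a node `x`: the union of the coarse elements that contain `x`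
(its interior, as an open set). -/
def nbhd (G : CoarseGrid) (x : Plane) : TopologicalSpace.Opens Plane :=
  ⟨interior (⋃ k ∈ {k | x ∈ G.elem k}, G.elem k), isOpen_interior⟩

open Classical in
/-- The number of coarse neighbourhoods that intersect the coarse element `k`. -/
def overlap (G : CoarseGrid) (k : Fin G.card) : ℕ :=
  (G.nodes.filter fun x => ((G.nbhd x : Set Plane) ∩ G.elem k).Nonempty).card

end CoarseGrid

/-- A Lipschitz partition of unity for the coarse grid: one function for each coarse node,
supported in the coarse neighbourhood of the node. -/
structure IsPartitionOfUnity (G : CoarseGrid) (χ : Plane → Cutoff) : Prop where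
  sum_eq_one : ∀ y ∈ G.dom, ∑ x ∈ G.nodes, χ x y = 1
  support : ∀ x ∈ G.nodes, ∀ y ∈ G.dom, y ∉ G.nbhd x → χ x y = 0

/-! ### Time dependent functions and the reference solution -/

/-- `u` belongs to `H¹(0, T; V)` and `u'` is its time derivative. -/
structure IsTimeDeriv {V : Type*} [NormedAddCommGroup V] [NormedSpace ℝ V]
    (T : ℝ) (u u' : ℝ → V) : Prop where
  memLp : MemLp u' 2 (volume.restrict (Ioc 0 T))
  eq_integral : ∀ t ∈ Icc 0 T, u t = u 0 + ∫ s in (0 : ℝ)..t, u' s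

/-- `u`, with time derivative `u'`, solves the `N`-continuum problem with source `f` in the domain
`Ω`, and vanishes on `Γ`. -/
structure IsReferenceSolution {N m : ℕ} (F : Fractures m) (A : Coeffs N m) (Ω Γ : Set Plane)
    (T : ℝ) (f : ℝ → Fin N → Lp ℝ 2 (volume : Measure Plane)) (u u' : ℝ → Vec N m) : Prop where
  timeDeriv : IsTimeDeriv T u u'
  mem : ∀ t ∈ Icc 0 T, ∀ i, u t i ∈ H1 F Γ Ω
  eq : ∀ᵐ t ∂volume.restrict (Ioc 0 T), ∀ v : Vec N m, (∀ i, v i ∈ H10 F Ω) →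
    cForm F A Ω (u' t) v = -aForm F A Ω (u t) v + qForm A Ω (u t) v +
      ∑ i, ∫ x in Ω, f t i x * val (v i) x

/-! ### Snapshots and the local spectral problem -/

/-- The coupled local snapshot space: all solutions of the coupled local problem
`a_Q(ψ, v) = 0` for every `v` with zero trace on the boundary of `ω`, with arbitrary boundary
values on the boundary of `ω` (that are zero on `Γ`). -/
def snapshotSpace {N m : ℕ} (F : Fractures m) (A : Coeffs N m) (Γ ω : Set Plane) :
    Set (Vec N m) :=
  {ψ | (∀ i, ψ i ∈ H1 F Γ ω) ∧
    ∀ v : Vec N m, (∀ i, v i ∈ H10 F ω) → aQForm F A ω ψ v = 0}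

/-- `φ 0, φ 1, …` is a complete `s`-orthonormal system of eigenfunctions of the local spectral
problem in the coupled snapshot space, with the eigenvalues `lam 0 ≤ lam 1 ≤ …`. -/
structure IsEigenSystem {N m : ℕ} (F : Fractures m) (A : Coeffs N m) (Γ ω : Set Plane)
    (χ : Cutoff) (φ : ℕ → Vec N m) (lam : ℕ → ℝ) : Prop where
  mem : ∀ k, φ k ∈ snapshotSpace F A Γ ω
  eigen : ∀ k, ∀ v ∈ snapshotSpace F A Γ ω,
    aQForm F A ω (φ k) v = lam k * sForm F A ω χ (φ k) v
  mono : Monotone lam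
  orthonormal : ∀ k k', sForm F A ω χ (φ k) (φ k') = if k = k' then 1 else 0
  complete : snapshotSpace F A Γ ω ⊆ closure (Submodule.span ℝ (range φ) : Set (Vec N m))

/-- `ψ` is the local snapshot projection of `u`: the function in the snapshot space of `ω` with
the same boundary values as `u` on the boundary of `ω`. -/
def IsLocalProjection {N m : ℕ} (F : Fractures m) (A : Coeffs N m) (Γ : Set Plane)
    (ω : TopologicalSpace.Opens Plane) (u ψ : Vec N m) : Prop :=
  ψ ∈ snapshotSpace F A Γ ω ∧ ∀ i, restr F ω (u i) - ψ i ∈ H10 F ω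

end GMsFEM

end

open GMsFEM

/-! The error `w - u_snap` is the image of `u` under one bounded linear operator `M = ∑ j, Z j ∘ P
j` on the energy space. Here `P j` sends a function to the snapshot on `ω_j` with the same boundary
values, and `Z j` sends a snapshot `ψ` to `χ_j e`, where `e` is the partial sum of the eigenfunction
expansion minus `ψ`. Since `M` commutes with the time integral, the time derivative of the error is
`M u'`. The theorem then reduces to two estimates at a fixed time, `c(Mv, Mv) ≤ K a_Q(v, v)` and
`a_Q(Mv, Mv) ≤ K a_Q(v, v)`: the first is used for `v = u'` and `v = u(0)`, the second for `v = u`.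

These estimates combine four facts.

Energy minimality: symmetrising the exchange term makes `a_Q` a symmetric nonnegative form, and
Poincaré and trace inequalities make it coercive on functions with zero boundary values. A snapshot
is `a_Q`-orthogonal to those functions, so its energy is at most that of `v` on `ω_j`
(`exists_snapshot_projection`).

Spectral gap: both local forms are diagonal in the eigenfunctions, so the tail satisfies `λ_{L+1}
s(e, e) ≤ a_Q(ψ, ψ)` (`spectral_truncation_le`).

Caccioppoli identity: `a_Q(χe, χe) = a_Q(e, χ²e) + s(e, e)` (`aQForm_vmul_self`). The first term on
the right vanishes because `χ²e` has zero boundary values (`mul_mul_mem_h10`) and `e` is a limit of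
combinations of snapshots. The bound `cχ² ≤ Eκ|∇χ|²` likewise controls `c(χe, χe)` by `s(e, e)`.

Finite overlap: one factor `D` is lost when the local errors are summed, and another when the local
energies of `v` are summed.

Completeness of the eigenfunctions places the snapshots of `u(t)` in their closed span. For `u'(t)`
the same holds at almost every `t`, by Lebesgue differentiation (`ae_mem_of_integral_mem`). -/

noncomputable section

namespace GMsFEM

/-! ### Weighted inner products on `L²` -/

section Weighted

variable {α : Type*} [MeasurableSpace α] {μ : Measure α}
  {V : Type*} [NormedAddCommGroup V] [InnerProductSpace ℝ V]
  {V' : Type*} [NormedAddCommGroup V'] [NormedSpace ℝ V']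

/-- Bounded measurable weights. -/
def IsWeight (g : α → ℝ) : Prop := Measurable g ∧ ∃ K : ℝ, ∀ x, ‖g x‖ ≤ K

/-- A map between `L²` spaces that acts by bounded linear maps on the values is linear and
continuous. -/
theorem exists_clm_of_pointwise {W : Type*} [NormedAddCommGroup W] [NormedSpace ℝ W]
    (S : Lp V' 2 μ → Lp W 2 μ) (a : α → V' →ₗ[ℝ] W) (K : ℝ) (ha : ∀ x v, ‖a x v‖ ≤ K * ‖v‖)
    (hS : ∀ u, S u =ᵐ[μ] fun x => a x (u x)) :
    ∃ B : Lp V' 2 μ →L[ℝ] Lp W 2 μ, ∀ u, B u = S u := by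
  refine ⟨LinearMap.mkContinuous ⟨⟨S, fun u v => ?_⟩, fun r u => ?_⟩ K fun u => ?_, fun u => rfl⟩
  · apply Lp.ext
    filter_upwards [hS u, hS v, hS (u + v), Lp.coeFn_add u v, Lp.coeFn_add (S u) (S v)]
      with x h1 h2 h3 h4 h5
    rw [h3, h5, Pi.add_apply, h1, h2, h4, Pi.add_apply, map_add]
  · apply Lp.ext
    filter_upwards [hS u, hS (r • u), Lp.coeFn_smul r u, Lp.coeFn_smul r (S u)] with x h1 h3 h4 h5
    rw [h3, RingHom.id_apply, h5, Pi.smul_apply, h1, h4, Pi.smul_apply, map_smul]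
  · refine Lp.norm_le_mul_norm_of_ae_le_mul ?_
    filter_upwards [hS u] with x hx
    change ‖S u x‖ ≤ _
    rw [hx]
    exact ha x _

/-- The inner product with weight `g` over the set `W`. -/
def wInt (μ : Measure α) (W : Set α) (g : α → ℝ) (u v : Lp V 2 μ) : ℝ :=
  ∫ x in W, g x * inner ℝ (u x) (v x) ∂μ

theorem IsWeight.integrable {g : α → ℝ} (hg : IsWeight g) (u v : Lp V 2 μ) :
    Integrable (fun x => g x * inner ℝ (u x) (v x)) μ := by
  obtain ⟨hm, K, hK⟩ := hg
  exact (L2.integrable_inner u v).bdd_mul (c := K) hm.aestronglyMeasurable (.of_forall hK)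

/-- The continuous bilinear maps. -/
def IsBilin {X Y : Type*} [NormedAddCommGroup X] [NormedSpace ℝ X] [NormedAddCommGroup Y]
    [NormedSpace ℝ Y] (b : X → Y → ℝ) : Prop :=
  ∃ B : X →L[ℝ] Y →L[ℝ] ℝ, ∀ u v, B u v = b u v

namespace IsBilin

variable {X Y X' Y' : Type*} [NormedAddCommGroup X] [NormedSpace ℝ X] [NormedAddCommGroup Y]
    [NormedSpace ℝ Y] [NormedAddCommGroup X'] [NormedSpace ℝ X'] [NormedAddCommGroup Y']
    [NormedSpace ℝ Y'] {b b' : X → Y → ℝ}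

theorem add (h : IsBilin b) (h' : IsBilin b') : IsBilin fun u v => b u v + b' u v := by
  obtain ⟨B, hB⟩ := h
  obtain ⟨B', hB'⟩ := h'
  exact ⟨B + B', fun u v => by simp [hB, hB']⟩

theorem const_mul (r : ℝ) (h : IsBilin b) : IsBilin fun u v => r * b u v := by
  obtain ⟨B, hB⟩ := h
  exact ⟨r • B, fun u v => by simp [hB]⟩

theorem sum {ι : Type*} (s : Finset ι) {b : ι → X → Y → ℝ} (h : ∀ i, IsBilin (b i)) :
    IsBilin fun u v => ∑ i ∈ s, b i u v := by
  choose B hB using h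
  exact ⟨∑ i ∈ s, B i, fun u v => by simp [hB]⟩

theorem comp (h : IsBilin b) (f : X' →L[ℝ] X) (g : Y' →L[ℝ] Y) :
    IsBilin fun u v => b (f u) (g v) := by
  obtain ⟨B, hB⟩ := h
  exact ⟨B.bilinearComp f g, fun u v => by simp [hB]⟩

end IsBilin

/-- Multiplication by `1_W g` is a bounded operator on `L²`; composing it with the `L²` inner
product gives the form. Every form below is assembled from such pieces. -/
theorem isBilin_wInt {W : Set α} (hW : MeasurableSet W) {g : α → ℝ} (hg : IsWeight g) :
    IsBilin (wInt (V := V) μ W g) := by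
  obtain ⟨hm, K, hK⟩ := id hg
  have hmem (u : Lp V 2 μ) : MemLp (fun x => (W.indicator g x) • u x) 2 μ :=
    memLp_smul_of_bound (hm.indicator hW).aestronglyMeasurable
      (fun x => (norm_indicator_le_norm_self _ _).trans (hK x)) (Lp.memLp u)
  obtain ⟨S, hS⟩ := exists_clm_of_pointwise (fun u => (hmem u).toLp)
    (fun x => W.indicator g x • LinearMap.id) K
    (fun x v => by
      simp only [LinearMap.smul_apply, LinearMap.id_apply, norm_smul]
      gcongr
      exact (norm_indicator_le_norm_self _ _).trans (hK x))
    (fun u => (hmem u).coeFn_toLp)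
  refine ⟨(isBoundedBilinearMap_inner (𝕜 := ℝ) (E := Lp V 2 μ)).toContinuousLinearMap.comp S,
    fun u v => ?_⟩
  change inner ℝ (S u) v = _
  rw [hS, L2.inner_def, wInt, ← integral_indicator hW]
  refine integral_congr_ae ?_
  filter_upwards [(hmem u).coeFn_toLp] with x hx
  rw [hx, real_inner_smul_left]
  by_cases h : x ∈ W <;> simp [h]

theorem wInt_symm (W : Set α) (g : α → ℝ) (u v : Lp V 2 μ) : wInt μ W g u v = wInt μ W g v u := by
  simp only [wInt, real_inner_comm]

theorem wInt_self (W : Set α) (g : α → ℝ) (u : Lp V 2 μ) :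
    wInt μ W g u u = ∫ x in W, g x * ‖u x‖ ^ 2 ∂μ := by
  simp only [wInt, real_inner_self_eq_norm_sq]

theorem wInt_self_nonneg {W : Set α} {g : α → ℝ} (hg : ∀ x, 0 ≤ g x) (u : Lp V 2 μ) :
    0 ≤ wInt μ W g u u := by
  rw [wInt_self]
  exact integral_nonneg fun x => mul_nonneg (hg x) (sq_nonneg _)

theorem IsWeight.integrable_sq {g : α → ℝ} (hg : IsWeight g) (u : Lp V 2 μ) :
    Integrable (fun x => g x * ‖u x‖ ^ 2) μ := by
  simpa only [real_inner_self_eq_norm_sq] using hg.integrable u u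

theorem wInt_congr_of_eqOn {W : Set α} (hW : MeasurableSet W) (g : α → ℝ) {u u' v v' : Lp V 2 μ}
    (hu : ∀ᵐ x ∂μ, x ∈ W → u x = u' x) (hv : ∀ᵐ x ∂μ, x ∈ W → v x = v' x) :
    wInt μ W g u v = wInt μ W g u' v' := by
  refine setIntegral_congr_ae hW ?_
  filter_upwards [hu, hv] with x h1 h2 hx
  rw [h1 hx, h2 hx]

theorem wInt_self_mono {V'' : Type*} [NormedAddCommGroup V''] [InnerProductSpace ℝ V'']
    {W : Set α} {g h : α → ℝ} (hg : IsWeight g) (hh : IsWeight h)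
    {u : Lp V 2 μ} {v : Lp V'' 2 μ}
    (hle : ∀ᵐ x ∂μ.restrict W, g x * ‖u x‖ ^ 2 ≤ h x * ‖v x‖ ^ 2) :
    wInt μ W g u u ≤ wInt μ W h v v := by
  rw [wInt_self, wInt_self]
  exact integral_mono_ae (hg.integrable_sq u).integrableOn (hh.integrable_sq v).integrableOn hle

theorem norm_sq_eq_wInt {W : Set α} (hW : MeasurableSet W) (u : Lp V 2 μ)
    (hu : u =ᵐ[μ] W.indicator u) : ‖u‖ ^ 2 = wInt μ W (fun _ => 1) u u := by
  rw [← real_inner_self_eq_norm_sq, L2.inner_def, wInt, ← integral_indicator hW]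
  refine integral_congr_ae ?_
  filter_upwards [hu] with x hx
  by_cases h : x ∈ W
  · simp [h]
  · rw [indicator_of_notMem h] at hx
    simp [h, hx]

/-! ### Sums over sets with bounded overlap. -/

section Overlap

open Classical in
/-- A sum of functions whose supports overlap at most `D` times. -/
theorem wInt_sum_le {ι : Type*} (J : Finset ι) {W : Set α} {Wj : ι → Set α} {D : ℕ}
    (hW : MeasurableSet W) (hWj : ∀ j ∈ J, MeasurableSet (Wj j))
    (hsub : ∀ j ∈ J, Wj j ⊆ W)
    (hD : ∀ x ∈ W, (J.filter fun j => x ∈ Wj j).card ≤ D) {g : α → ℝ} (hg : IsWeight g)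
    (hg0 : ∀ x, 0 ≤ g x) (e : ι → Lp V 2 μ) (he : ∀ j ∈ J, e j =ᵐ[μ] (Wj j).indicator (e j)) :
    wInt μ W g (∑ j ∈ J, e j) (∑ j ∈ J, e j) ≤ D * ∑ j ∈ J, wInt μ (Wj j) g (e j) (e j) := by
  simp only [wInt_self]
  have h1 : ∀ j ∈ J, ∫ x in Wj j, g x * ‖e j x‖ ^ 2 ∂μ =
      ∫ x in W, (Wj j).indicator (fun x => g x * ‖e j x‖ ^ 2) x ∂μ := fun j hj => by
    rw [setIntegral_indicator (hWj j hj), inter_eq_right.2 (hsub j hj)]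
  rw [Finset.sum_congr rfl h1, ← integral_finsetSum, ← integral_const_mul]
  · refine integral_mono_ae (hg.integrable_sq _).integrableOn ?_ ?_
    · refine (integrable_finsetSum _ fun j hj => ?_).const_mul _
      exact ((hg.integrable_sq _).indicator (hWj j hj)).integrableOn
    · have hsum : ∀ᵐ x ∂μ, (∑ j ∈ J, e j : Lp V 2 μ) x = ∑ j ∈ J, e j x := by
        filter_upwards [Lp.coeFn_finsetSum J e] with x hx
        simpa using hx
      have hall : ∀ᵐ x ∂μ, ∀ j ∈ J, e j x = (Wj j).indicator (e j) x :=
        (ae_ball_iff J.countable_toSet).2 he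
      filter_upwards [ae_restrict_mem hW, ae_restrict_of_ae hsum, ae_restrict_of_ae hall]
        with x hxW hx hxj
      rw [hx]
      have h2 : ∑ j ∈ J, e j x = ∑ j ∈ J.filter fun j => x ∈ Wj j, e j x := by
        rw [Finset.sum_filter]
        refine Finset.sum_congr rfl fun j hj => ?_
        rw [hxj j hj]
        by_cases h : x ∈ Wj j <;> simp [h]
      have h3 : ∑ j ∈ J, (Wj j).indicator (fun x => g x * ‖e j x‖ ^ 2) x =
          g x * ∑ j ∈ J.filter fun j => x ∈ Wj j, ‖e j x‖ ^ 2 := by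
        rw [Finset.sum_filter, Finset.mul_sum]
        refine Finset.sum_congr rfl fun j hj => ?_
        by_cases h : x ∈ Wj j <;> simp [h]
      rw [h2, h3, mul_left_comm]
      refine mul_le_mul_of_nonneg_left ?_ (hg0 x)
      calc ‖∑ j ∈ J.filter fun j => x ∈ Wj j, e j x‖ ^ 2
          ≤ (∑ j ∈ J.filter fun j => x ∈ Wj j, ‖e j x‖) ^ 2 := by
            gcongr
            exact norm_sum_le _ _
        -- Cauchy–Schwarz at a point: only the terms with `x ∈ Wj j` survive, and there are at most
        -- `D` of them.
        _ ≤ (J.filter fun j => x ∈ Wj j).card * ∑ j ∈ J.filter fun j => x ∈ Wj j, ‖e j x‖ ^ 2 :=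
            sq_sum_le_card_mul_sum_sq
        _ ≤ _ := by
            gcongr
            exact hD x hxW
  · intro j hj
    exact ((hg.integrable_sq _).indicator (hWj j hj)).integrableOn

open Classical in
-- On the left the nonnegative integrand at `x` is counted once for each set `Wj j` that contains
-- `x`, hence at most `D` times.
theorem sum_wInt_le {ι : Type*} (J : Finset ι) {W : Set α} {Wj : ι → Set α} {D : ℕ}
    (hW : MeasurableSet W) (hWj : ∀ j ∈ J, MeasurableSet (Wj j))
    (hsub : ∀ j ∈ J, Wj j ⊆ W)
    (hD : ∀ x ∈ W, (J.filter fun j => x ∈ Wj j).card ≤ D) {g : α → ℝ} (hg : IsWeight g)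
    (hg0 : ∀ x, 0 ≤ g x) (u : Lp V 2 μ) :
    ∑ j ∈ J, wInt μ (Wj j) g u u ≤ D * wInt μ W g u u := by
  simp only [wInt_self]
  have h1 : ∀ j ∈ J, ∫ x in Wj j, g x * ‖u x‖ ^ 2 ∂μ =
      ∫ x in W, (Wj j).indicator (fun x => g x * ‖u x‖ ^ 2) x ∂μ := fun j hj => by
    rw [setIntegral_indicator (hWj j hj), inter_eq_right.2 (hsub j hj)]
  rw [Finset.sum_congr rfl h1, ← integral_finsetSum, ← integral_const_mul]
  · refine integral_mono_ae ?_ ((hg.integrable_sq _).integrableOn.const_mul _) ?_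
    · refine (integrable_finsetSum _ fun j hj => ?_)
      exact ((hg.integrable_sq _).indicator (hWj j hj)).integrableOn
    · filter_upwards [ae_restrict_mem hW] with x hxW
      have h3 : ∑ j ∈ J, (Wj j).indicator (fun x => g x * ‖u x‖ ^ 2) x =
          (J.filter fun j => x ∈ Wj j).card * (g x * ‖u x‖ ^ 2) := by
        rw [← nsmul_eq_mul, ← Finset.sum_const, Finset.sum_filter]
        refine Finset.sum_congr rfl fun j hj => ?_
        by_cases h : x ∈ Wj j <;> simp [h]
      rw [h3]
      have := hg0 x
      gcongr
      exact hD x hxW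
  · intro j hj
    exact ((hg.integrable_sq _).indicator (hWj j hj)).integrableOn

end Overlap

end Weighted

/-! ### Restriction and multiplication as continuous linear maps -/

section Operators

variable {N m : ℕ} (F : Fractures m)

theorem val_mul (χ : Cutoff) (u : Tuple m) :
    (mul F χ u).1 =ᵐ[volume] fun x => χ x * u.1 x := (memLp_mul_val χ u).coeFn_toLp

theorem grad_mul (χ : Cutoff) (u : Tuple m) :
    (mul F χ u).2.1 =ᵐ[volume] fun x => χ x • u.2.1 x + u.1 x • gradient χ x :=
  (memLp_mul_grad χ u).coeFn_toLp

theorem tr_mul (χ : Cutoff) (u : Tuple m) (l : Fin m) :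
    (mul F χ u).2.2.1 l =ᵐ[volume] fun s => χ.onLine F l s * u.2.2.1 l s :=
  (memLp_mul_tr F χ u l).coeFn_toLp

theorem dtr_mul (χ : Cutoff) (u : Tuple m) (l : Fin m) :
    (mul F χ u).2.2.2 l =ᵐ[volume]
      fun s => χ.onLine F l s * u.2.2.2 l s + u.2.2.1 l s * deriv (χ.onLine F l) s :=
  (memLp_mul_dtr F χ u l).coeFn_toLp

theorem exists_clm_smul_bounded {α V : Type*} [MeasurableSpace α] {μ : Measure α}
    [NormedAddCommGroup V] [NormedSpace ℝ V] {g : α → ℝ} (hg : AEStronglyMeasurable g μ)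
    {K : ℝ} (hK : ∀ x, ‖g x‖ ≤ K) :
    ∃ B : Lp V 2 μ →L[ℝ] Lp V 2 μ, ∀ u, B u =ᵐ[μ] fun x => g x • u x := by
  obtain ⟨B, hB⟩ := exists_clm_of_pointwise
    (fun u : Lp V 2 μ => (memLp_smul_of_bound hg hK (Lp.memLp u)).toLp)
    (fun x => g x • LinearMap.id) K
    (fun x v => by
      simp only [LinearMap.smul_apply, LinearMap.id_apply, norm_smul]
      gcongr
      exact hK x) (fun u => (memLp_smul_of_bound hg hK (Lp.memLp u)).coeFn_toLp)
  exact ⟨B, fun u => hB u ▸ (memLp_smul_of_bound hg hK (Lp.memLp u)).coeFn_toLp⟩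

theorem exists_clm_smul_bounded' {α V : Type*} [MeasurableSpace α] {μ : Measure α}
    [NormedAddCommGroup V] [NormedSpace ℝ V] {g : α → V} (hg : AEStronglyMeasurable g μ)
    {K : ℝ} (hK : ∀ x, ‖g x‖ ≤ K) :
    ∃ B : Lp ℝ 2 μ →L[ℝ] Lp V 2 μ, ∀ u, B u =ᵐ[μ] fun x => u x • g x := by
  obtain ⟨B, hB⟩ := exists_clm_of_pointwise
    (fun u : Lp ℝ 2 μ => (memLp_smul_of_bound' hg hK (Lp.memLp u)).toLp)
    (fun x => LinearMap.toSpanSingleton ℝ V (g x)) K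
    (fun x v => by
      rw [LinearMap.toSpanSingleton_apply, norm_smul, mul_comm]
      gcongr
      exact hK x) (fun u => (memLp_smul_of_bound' hg hK (Lp.memLp u)).coeFn_toLp)
  exact ⟨B, fun u => hB u ▸ (memLp_smul_of_bound' hg hK (Lp.memLp u)).coeFn_toLp⟩

theorem exists_clm_indicator {α V : Type*} [MeasurableSpace α] {μ : Measure α}
    [NormedAddCommGroup V] [NormedSpace ℝ V] {W : Set α} (hW : MeasurableSet W) :
    ∃ B : Lp V 2 μ →L[ℝ] Lp V 2 μ, ∀ u : Lp V 2 μ, B u = ((Lp.memLp u).indicator hW).toLp := by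
  obtain ⟨B, hB⟩ := exists_clm_smul_bounded (μ := μ) (V := V) (g := W.indicator fun _ => (1 : ℝ))
    (measurable_const.indicator hW).aestronglyMeasurable (K := 1)
    (fun x => (norm_indicator_le_norm_self _ _).trans (by simp))
  refine ⟨B, fun u => Lp.ext ?_⟩
  filter_upwards [hB u, ((Lp.memLp u).indicator hW).coeFn_toLp] with x h1 h2
  rw [h1, h2]
  by_cases h : x ∈ W <;> simp [h]

/-- The continuous linear map of all components. -/
def tupleMap {X : Type*} [NormedAddCommGroup X] [NormedSpace ℝ X]
    (a : X →L[ℝ] Lp ℝ 2 (volume : Measure Plane)) (b : X →L[ℝ] Lp Plane 2 (volume : Measure Plane))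
    (c d : Fin m → X →L[ℝ] Lp ℝ 2 (volume : Measure ℝ)) : X →L[ℝ] Tuple m :=
  a.prod (b.prod ((ContinuousLinearMap.pi c).prod (ContinuousLinearMap.pi d)))

variable (m) in
def valL : Tuple m →L[ℝ] Lp ℝ 2 (volume : Measure Plane) := ContinuousLinearMap.fst ℝ _ _

variable (m) in
def gradL : Tuple m →L[ℝ] Lp Plane 2 (volume : Measure Plane) :=
  (ContinuousLinearMap.fst ℝ _ _).comp (ContinuousLinearMap.snd ℝ _ _)

def trL (l : Fin m) : Tuple m →L[ℝ] Lp ℝ 2 (volume : Measure ℝ) :=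
  (ContinuousLinearMap.proj l).comp ((ContinuousLinearMap.fst ℝ _ _).comp
    ((ContinuousLinearMap.snd ℝ _ _).comp (ContinuousLinearMap.snd ℝ _ _)))

def dtrL (l : Fin m) : Tuple m →L[ℝ] Lp ℝ 2 (volume : Measure ℝ) :=
  (ContinuousLinearMap.proj l).comp ((ContinuousLinearMap.snd ℝ _ _).comp
    ((ContinuousLinearMap.snd ℝ _ _).comp (ContinuousLinearMap.snd ℝ _ _)))

variable (m) in
def compL (i : Fin N) : Vec N m →L[ℝ] Tuple m := ContinuousLinearMap.proj i

theorem exists_clm_restr (ω : TopologicalSpace.Opens Plane) :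
    ∃ R : Tuple m →L[ℝ] Tuple m, ∀ u, R u = restr F ω u := by
  obtain ⟨a, ha⟩ := exists_clm_indicator (V := ℝ) (μ := volume) ω.isOpen.measurableSet
  obtain ⟨b, hb⟩ := exists_clm_indicator (V := Plane) (μ := volume) ω.isOpen.measurableSet
  choose c hc using fun l => exists_clm_indicator (V := ℝ) (μ := volume)
    (F.measurableSet_part l ω.isOpen)
  refine ⟨tupleMap (a.comp (valL m)) (b.comp (gradL m)) (fun l => (c l).comp (trL l))
    (fun l => (c l).comp (dtrL l)), fun u => ?_⟩
  exact Prod.ext (ha _) (Prod.ext (hb _) (Prod.ext (funext fun l => hc l _)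
    (funext fun l => hc l _)))

theorem exists_clm_mul (χ : Cutoff) : ∃ M : Tuple m →L[ℝ] Tuple m, ∀ u, M u = mul F χ u := by
  obtain ⟨a, ha⟩ := exists_clm_smul_bounded (V := ℝ) (μ := (volume : Measure Plane))
    χ.continuous.aestronglyMeasurable χ.norm_le_one
  obtain ⟨b, hb⟩ := exists_clm_smul_bounded (V := Plane) (μ := (volume : Measure Plane))
    χ.continuous.aestronglyMeasurable χ.norm_le_one
  obtain ⟨b', hb'⟩ := exists_clm_smul_bounded' (V := Plane) (μ := (volume : Measure Plane))
    χ.measurable_gradient.aestronglyMeasurable χ.exists_norm_gradient_le.choose_spec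
  choose c hc using fun l => exists_clm_smul_bounded (V := ℝ) (μ := (volume : Measure ℝ))
    (χ.continuous_onLine F l).aestronglyMeasurable (fun _ => χ.norm_le_one _)
  choose d hd using fun l => exists_clm_smul_bounded' (V := ℝ) (μ := (volume : Measure ℝ))
    (measurable_deriv (χ.onLine F l)).aestronglyMeasurable
    (χ.exists_norm_deriv_le F l).choose_spec
  refine ⟨tupleMap (a.comp (valL m)) (b.comp (gradL m) + b'.comp (valL m))
    (fun l => (c l).comp (trL l)) (fun l => (c l).comp (dtrL l) + (d l).comp (trL l)),
    fun u => ?_⟩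
  refine Prod.ext (Lp.ext ?_) (Prod.ext (Lp.ext ?_) (Prod.ext (funext fun l => Lp.ext ?_)
    (funext fun l => Lp.ext ?_)))
  · exact (ha u.1).trans (val_mul F χ u).symm
  · filter_upwards [hb u.2.1, hb' u.1, grad_mul F χ u, Lp.coeFn_add (b u.2.1) (b' u.1)]
      with x h1 h2 h3 h4
    rw [h3, ← h1, ← h2]
    exact h4
  · exact (hc l (u.2.2.1 l)).trans (tr_mul F χ u l).symm
  · filter_upwards [hc l (u.2.2.2 l), hd l (u.2.2.1 l), dtr_mul F χ u l,
      Lp.coeFn_add (c l (u.2.2.2 l)) (d l (u.2.2.1 l))] with x h1 h2 h3 h4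
    rw [h3, ← smul_eq_mul, ← smul_eq_mul, ← h1, ← h2]
    exact h4

theorem exists_clm_vmul (χ : Cutoff) :
    ∃ M : Vec N m →L[ℝ] Vec N m, ∀ u, M u = vmul F χ u := by
  obtain ⟨M, hM⟩ := exists_clm_mul F χ
  exact ⟨ContinuousLinearMap.pi fun i => M.comp (ContinuousLinearMap.proj i),
    fun u => funext fun i => hM _⟩

/-- Restriction of all components. -/
def vrestr (ω : TopologicalSpace.Opens Plane) (u : Vec N m) : Vec N m := fun i => restr F ω (u i)

theorem exists_clm_vrestr (ω : TopologicalSpace.Opens Plane) :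
    ∃ M : Vec N m →L[ℝ] Vec N m, ∀ u, M u = vrestr F ω u := by
  obtain ⟨M, hM⟩ := exists_clm_restr F ω
  exact ⟨ContinuousLinearMap.pi fun i => M.comp (ContinuousLinearMap.proj i),
    fun u => funext fun i => hM _⟩

end Operators

/-! ### The forms as sums of weighted inner products -/

section Coeffs

variable {N m : ℕ} (F : Fractures m) (A : Coeffs N m)

namespace Coeffs

theorem κ_nonneg (i : Fin N) (x : Plane) : 0 ≤ A.κ i x := by
  obtain ⟨b, hb, h, -⟩ := A.elliptic
  exact hb.le.trans (h i x)

theorem κf_nonneg (l : Fin m) (i : Fin N) (s : ℝ) : 0 ≤ A.κf l i s := by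
  obtain ⟨b, hb, -, h⟩ := A.elliptic
  exact hb.le.trans (h l i s)

theorem isWeight_c (i : Fin N) : IsWeight (A.c i) := by
  obtain ⟨B, h, -, -⟩ := A.bounded
  exact ⟨A.measurable_c i, B, fun x => by
    rw [Real.norm_of_nonneg (A.c_nonneg i x)]
    exact (h i x).1⟩

theorem isWeight_κ (i : Fin N) : IsWeight (A.κ i) := by
  obtain ⟨B, h, -, -⟩ := A.bounded
  exact ⟨A.measurable_κ i, B, fun x => by
    rw [Real.norm_of_nonneg (A.κ_nonneg i x)]
    exact (h i x).2⟩

theorem isWeight_Q (i j : Fin N) : IsWeight (A.Q i j) := by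
  obtain ⟨B, -, h, -⟩ := A.bounded
  exact ⟨A.measurable_Q i j, B, fun x => by
    rw [Real.norm_of_nonneg (A.Q_nonneg i j x)]
    exact h i j x⟩

theorem isWeight_cf (l : Fin m) (i : Fin N) : IsWeight (A.cf l i) := by
  obtain ⟨B, -, -, h⟩ := A.bounded
  exact ⟨A.measurable_cf l i, B, fun x => by
    rw [Real.norm_of_nonneg (A.cf_nonneg l i x)]
    exact (h l i x).1⟩

theorem isWeight_κf (l : Fin m) (i : Fin N) : IsWeight (A.κf l i) := by
  obtain ⟨B, -, -, h⟩ := A.bounded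
  exact ⟨A.measurable_κf l i, B, fun x => by
    rw [Real.norm_of_nonneg (A.κf_nonneg l i x)]
    exact (h l i x).2⟩

end Coeffs

theorem IsWeight.mul {α : Type*} [MeasurableSpace α] {g h : α → ℝ} (hg : IsWeight g)
    (hh : IsWeight h) : IsWeight fun x => g x * h x := by
  obtain ⟨hm, K, hK⟩ := hg
  obtain ⟨hm', K', hK'⟩ := hh
  refine ⟨hm.mul hm', K * K', fun x => ?_⟩
  rw [norm_mul]
  exact mul_le_mul (hK x) (hK' x) (norm_nonneg _) ((norm_nonneg _).trans (hK x))

theorem Cutoff.isWeight_gradient (χ : Cutoff) : IsWeight fun x => ‖gradient χ x‖ ^ 2 := by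
  obtain ⟨K, hK⟩ := χ.exists_norm_gradient_le
  refine ⟨χ.measurable_gradient.norm.pow_const 2, K ^ 2, fun x => ?_⟩
  rw [norm_pow, norm_norm]
  gcongr
  exact hK x

theorem Cutoff.isWeight_deriv (χ : Cutoff) (l : Fin m) :
    IsWeight fun s => deriv (χ.onLine F l) s ^ 2 := by
  obtain ⟨K, hK⟩ := χ.exists_norm_deriv_le F l
  refine ⟨(measurable_deriv _).pow_const 2, K ^ 2, fun x => ?_⟩
  rw [norm_pow]
  gcongr
  exact hK x

variable (ω : Set Plane) (u v : Vec N m)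

theorem cForm_eq : cForm F A ω u v = ∑ i, (wInt volume ω (A.c i) (u i).1 (v i).1 +
    ∑ l, wInt volume (F.part l ω) (A.cf l i) ((u i).2.2.1 l) ((v i).2.2.1 l)) := by
  simp only [cForm, wInt, val, tr, RCLike.inner_apply, conj_trivial, mul_assoc, mul_comm]

theorem aForm_eq : aForm F A ω u v = ∑ i, (wInt volume ω (A.κ i) (u i).2.1 (v i).2.1 +
    ∑ l, wInt volume (F.part l ω) (A.κf l i) ((u i).2.2.2 l) ((v i).2.2.2 l)) := by
  simp only [aForm, wInt, grad, dtr]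
  simp only [RCLike.inner_apply, conj_trivial, mul_assoc, mul_comm]

theorem sForm_eq (χ : Cutoff) : sForm F A ω χ u v =
    ∑ i, (wInt volume ω (fun x => A.κ i x * ‖gradient χ x‖ ^ 2) (u i).1 (v i).1 +
      ∑ l, wInt volume (F.part l ω) (fun s => A.κf l i s * deriv (χ.onLine F l) s ^ 2)
        ((u i).2.2.1 l) ((v i).2.2.1 l)) := by
  simp only [sForm, wInt, val, tr, RCLike.inner_apply, conj_trivial]
  simp only [mul_comm, mul_assoc]

variable {ω} in
-- Since `Q` is symmetric, exchanging the names of `i` and `j` flips the sign of `u i - u j` and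
-- allows averaging over the two test components. In this form `-q` is visibly symmetric and
-- nonnegative on the diagonal.
theorem qForm_eq (hω : MeasurableSet ω) : qForm A ω u v =
    -(1 / 2 * ∑ j, ∑ i, wInt volume ω (A.Q i j) ((u i).1 - (u j).1) ((v i).1 - (v j).1)) := by
  have hB i j := isBilin_wInt (V := ℝ) (μ := (volume : Measure Plane)) hω (A.isWeight_Q i j)
  have h1 : qForm A ω u v = ∑ j, ∑ i, wInt volume ω (A.Q i j) ((u i).1 - (u j).1) (v j).1 := by
    refine Finset.sum_congr rfl fun j _ => ?_
    -- The term `i = j` may be restored because `u j - u j = 0`.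
    rw [← Finset.add_sum_erase _ _ (Finset.mem_univ j)]
    have h0 : wInt volume ω (A.Q j j) ((u j).1 - (u j).1) (v j).1 = 0 := by
      obtain ⟨B, hB⟩ := hB j j
      rw [← hB, sub_self, map_zero, zero_apply]
    rw [h0, zero_add]
    refine Finset.sum_congr rfl fun i _ => ?_
    refine setIntegral_congr_ae hω ?_
    filter_upwards [Lp.coeFn_sub (u i).1 (u j).1] with x hx _
    rw [hx]
    simp only [val, Pi.sub_apply, RCLike.inner_apply, conj_trivial]
    ring
  have h2 : ∑ j, ∑ i, wInt volume ω (A.Q i j) ((u i).1 - (u j).1) (v i).1 =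
      -∑ j, ∑ i, wInt volume ω (A.Q i j) ((u i).1 - (u j).1) (v j).1 := by
    rw [Finset.sum_comm, ← Finset.sum_neg_distrib]
    refine Finset.sum_congr rfl fun j _ => ?_
    rw [← Finset.sum_neg_distrib]
    refine Finset.sum_congr rfl fun i _ => ?_
    have : A.Q j i = A.Q i j := funext fun x => A.Q_symm j i x
    obtain ⟨B, hB⟩ := hB i j
    rw [this, ← hB, ← hB, ← neg_sub (u i).1, map_neg, neg_apply]
  have h3 : ∀ i j, wInt volume ω (A.Q i j) ((u i).1 - (u j).1) ((v i).1 - (v j).1) =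
      wInt volume ω (A.Q i j) ((u i).1 - (u j).1) (v i).1 -
      wInt volume ω (A.Q i j) ((u i).1 - (u j).1) (v j).1 := fun i j => by
    obtain ⟨B, hB⟩ := hB i j
    rw [← hB, ← hB, ← hB, map_sub]
  simp only [h3, Finset.sum_sub_distrib, h2, h1]
  ring

variable {ω} in
theorem aQForm_eq (hω : MeasurableSet ω) : aQForm F A ω u v =
    ∑ i, (wInt volume ω (A.κ i) (u i).2.1 (v i).2.1 +
      ∑ l, wInt volume (F.part l ω) (A.κf l i) ((u i).2.2.2 l) ((v i).2.2.2 l)) +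
    1 / 2 * ∑ j, ∑ i, wInt volume ω (A.Q i j) ((u i).1 - (u j).1) ((v i).1 - (v j).1) := by
  rw [aQForm, aForm_eq, qForm_eq A u v hω, sub_neg_eq_add]

variable {ω u v}

theorem aQForm_symm (hω : MeasurableSet ω) : aQForm F A ω u v = aQForm F A ω v u := by
  simp only [aQForm_eq F A _ _ hω, wInt_symm _ _ (u _).2.1, wInt_symm _ _ ((u _).2.2.2 _),
    wInt_symm _ _ ((u _).1 - (u _).1)]

theorem aQForm_self_nonneg (hω : MeasurableSet ω) : 0 ≤ aQForm F A ω u u := by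
  rw [aQForm_eq F A _ _ hω]
  refine add_nonneg (Finset.sum_nonneg fun i _ => add_nonneg (wInt_self_nonneg (A.κ_nonneg i) _)
    (Finset.sum_nonneg fun l _ => wInt_self_nonneg (A.κf_nonneg l i) _)) (mul_nonneg (by simp)
    (Finset.sum_nonneg fun j _ => Finset.sum_nonneg fun i _ =>
      wInt_self_nonneg (A.Q_nonneg i j) _))

theorem isBilin_cForm (hω : IsOpen ω) : IsBilin (cForm F A ω) := by
  simp only [funext₂ (cForm_eq F A ω)]
  refine .sum _ fun i => .add ?_ (.sum _ fun l => ?_)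
  · exact (isBilin_wInt hω.measurableSet (A.isWeight_c i)).comp
      ((valL m).comp (compL m i)) ((valL m).comp (compL m i))
  · exact (isBilin_wInt (F.measurableSet_part l hω) (A.isWeight_cf l i)).comp
      ((trL l).comp (compL m i)) ((trL l).comp (compL m i))

theorem isBilin_sForm (hω : IsOpen ω) (χ : Cutoff) : IsBilin (sForm F A ω χ) := by
  simp only [funext₂ fun u v => sForm_eq F A ω u v χ]
  refine .sum _ fun i => .add ?_ (.sum _ fun l => ?_)
  · exact (isBilin_wInt hω.measurableSet ((A.isWeight_κ i).mul χ.isWeight_gradient)).comp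
      ((valL m).comp (compL m i)) ((valL m).comp (compL m i))
  · exact (isBilin_wInt (F.measurableSet_part l hω)
      ((A.isWeight_κf l i).mul (χ.isWeight_deriv F l))).comp
      ((trL l).comp (compL m i)) ((trL l).comp (compL m i))

theorem isBilin_aQForm (hω : IsOpen ω) : IsBilin (aQForm F A ω) := by
  simp only [funext₂ fun u v => aQForm_eq F A u v hω.measurableSet]
  refine .add (.sum _ fun i => .add ?_ (.sum _ fun l => ?_))
    (.const_mul _ (.sum _ fun j => .sum _ fun i => ?_))
  · exact (isBilin_wInt hω.measurableSet (A.isWeight_κ i)).comp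
      ((gradL m).comp (compL m i)) ((gradL m).comp (compL m i))
  · exact (isBilin_wInt (F.measurableSet_part l hω) (A.isWeight_κf l i)).comp
      ((dtrL l).comp (compL m i)) ((dtrL l).comp (compL m i))
  · have h := (isBilin_wInt (V := ℝ) (μ := volume) hω.measurableSet (A.isWeight_Q i j)).comp
      ((valL m).comp (compL m i) - (valL m).comp (compL m j))
      ((valL m).comp (compL m i) - (valL m).comp (compL m j))
    simp only [sub_apply, ContinuousLinearMap.comp_apply] at h
    exact h

end Coeffs

section Localisation

variable {N m : ℕ} (F : Fractures m) (A : Coeffs N m)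

/-! ### Functions supported in a region -/

section Supported

variable {F} {ω : TopologicalSpace.Opens Plane} {u : Tuple m}

theorem toLp_indicator_eq_self_iff {α V : Type*} [MeasurableSpace α] {μ : Measure α}
    [NormedAddCommGroup V] {W : Set α} (hW : MeasurableSet W) (f : Lp V 2 μ) :
    ((Lp.memLp f).indicator hW).toLp = f ↔ f =ᵐ[μ] W.indicator f := by
  rw [Lp.ext_iff]
  have h := ((Lp.memLp f).indicator hW).coeFn_toLp
  exact ⟨fun h' => h'.symm.trans h, fun h' => h.trans h'.symm⟩

/-- Being fixed by restriction expresses support in `ω` as the equation of a continuous linear map,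
so it passes to closures. -/
theorem restr_eq_self_iff : restr F ω u = u ↔
    u.1 =ᵐ[volume] (ω : Set Plane).indicator u.1 ∧
    u.2.1 =ᵐ[volume] (ω : Set Plane).indicator u.2.1 ∧
    (∀ l, u.2.2.1 l =ᵐ[volume] (F.part l ω).indicator (u.2.2.1 l)) ∧
    ∀ l, u.2.2.2 l =ᵐ[volume] (F.part l ω).indicator (u.2.2.2 l) := by
  simp only [restr, Prod.ext_iff, funext_iff]
  have h := ω.isOpen.measurableSet
  have h' l := F.measurableSet_part l ω.isOpen
  exact and_congr (toLp_indicator_eq_self_iff h _) (and_congr (toLp_indicator_eq_self_iff h _)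
    (and_congr (forall_congr' fun l => toLp_indicator_eq_self_iff (h' l) _)
      (forall_congr' fun l => toLp_indicator_eq_self_iff (h' l) _)))

theorem restr_mul_of_restr (χ : Cutoff) (h : restr F ω u = u) :
    restr F ω (mul F χ u) = mul F χ u := by
  obtain ⟨h1, h2, h3, h4⟩ := restr_eq_self_iff.1 h
  refine restr_eq_self_iff.2 ⟨?_, ?_, fun l => ?_, fun l => ?_⟩
  · filter_upwards [h1, val_mul F χ u] with x h1 h
    by_cases hx : x ∈ (ω : Set Plane)
    · simp [hx]
    · simp only [hx, not_false_eq_true, indicator_of_notMem] at h1 ⊢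
      rw [h, h1, mul_zero]
  · filter_upwards [h1, h2, grad_mul F χ u] with x h1 h2 h
    by_cases hx : x ∈ (ω : Set Plane)
    · simp [hx]
    · simp only [hx, not_false_eq_true, indicator_of_notMem] at h1 h2 ⊢
      rw [h, h1, h2, smul_zero, zero_smul, add_zero]
  · filter_upwards [h3 l, tr_mul F χ u l] with x h1 h
    by_cases hx : x ∈ F.part l ω
    · simp [hx]
    · simp only [hx, not_false_eq_true, indicator_of_notMem] at h1 ⊢
      rw [h, h1, mul_zero]
  · filter_upwards [h3 l, h4 l, dtr_mul F χ u l] with x h1 h2 h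
    by_cases hx : x ∈ F.part l ω
    · simp [hx]
    · simp only [hx, not_false_eq_true, indicator_of_notMem] at h1 h2 ⊢
      rw [h, h1, h2, mul_zero, zero_mul, add_zero]

end Supported

/-- All integrals run over `ω` and its fracture parts, where restriction changes nothing. -/
theorem aQForm_vrestr_left {ω : TopologicalSpace.Opens Plane} (u v : Vec N m) :
    aQForm F A ω (vrestr F ω u) v = aQForm F A ω u v := by
  have key {α V : Type} [MeasurableSpace α] {μ : Measure α} [NormedAddCommGroup V]
      {W : Set α} (hW : MeasurableSet W) (f : Lp V 2 μ) :
      ∀ᵐ x ∂μ, x ∈ W → (((Lp.memLp f).indicator hW).toLp : Lp V 2 μ) x = f x := by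
    filter_upwards [((Lp.memLp f).indicator hW).coeFn_toLp] with x h hx
    rw [h, indicator_of_mem hx]
  have hω := ω.isOpen.measurableSet
  rw [aQForm_eq F A _ _ hω, aQForm_eq F A _ _ hω]
  congr 1
  · refine Finset.sum_congr rfl fun i _ => ?_
    congr 1
    · exact wInt_congr_of_eqOn hω _ (key hω _) (.of_forall fun _ _ => rfl)
    · exact Finset.sum_congr rfl fun l _ => wInt_congr_of_eqOn (F.measurableSet_part l ω.isOpen) _
        (key (F.measurableSet_part l ω.isOpen) _) (.of_forall fun _ _ => rfl)
  · congr 1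
    refine Finset.sum_congr rfl fun j _ => Finset.sum_congr rfl fun i _ => ?_
    refine wInt_congr_of_eqOn hω _ ?_ (.of_forall fun _ _ => rfl)
    filter_upwards [key hω (u i).1, key hω (u j).1, Lp.coeFn_sub (u i).1 (u j).1,
      Lp.coeFn_sub (vrestr F ω u i).1 (vrestr F ω u j).1] with x h1 h2 h3 h4 hx
    rw [h3, h4, Pi.sub_apply, Pi.sub_apply, ← h1 hx, ← h2 hx]
    rfl

/-! ### Overlapping regions -/

section Overlap

variable {ι : Type*} {J : Finset ι} {W : TopologicalSpace.Opens Plane}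
  {Wj : ι → TopologicalSpace.Opens Plane} {D : ℕ}

theorem sum_le_mul_sum_sum {κ : Type*} (s : Finset κ) (J : Finset ι) {a : κ → ℝ} {b : ι → κ → ℝ}
    {D : ℝ} (h : ∀ k ∈ s, a k ≤ D * ∑ j ∈ J, b j k) :
    ∑ k ∈ s, a k ≤ D * ∑ j ∈ J, ∑ k ∈ s, b j k := by
  rw [Finset.sum_comm, Finset.mul_sum]
  exact Finset.sum_le_sum h

theorem sum_sum_le_mul_sum {κ : Type*} (s : Finset κ) (J : Finset ι) {a : κ → ℝ} {b : ι → κ → ℝ}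
    {D : ℝ} (h : ∀ k ∈ s, ∑ j ∈ J, b j k ≤ D * a k) :
    ∑ j ∈ J, ∑ k ∈ s, b j k ≤ D * ∑ k ∈ s, a k := by
  rw [Finset.sum_comm, Finset.mul_sum]
  exact Finset.sum_le_sum h

open Classical in
/-- Every point of `W` lies in at most `D` of the subsets `Wj j`. -/
def OverlapLE (J : Finset ι) (W : TopologicalSpace.Opens Plane)
    (Wj : ι → TopologicalSpace.Opens Plane) (D : ℕ) : Prop :=
  (∀ j ∈ J, Wj j ≤ W) ∧ ∀ x ∈ W, (J.filter fun j => x ∈ Wj j).card ≤ D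

open Classical in
theorem OverlapLE.part {F : Fractures m} (h : OverlapLE J W Wj D) (l : Fin m) :
    (∀ j ∈ J, F.part l (Wj j) ⊆ F.part l W) ∧
      ∀ s ∈ F.part l W, (J.filter fun j => s ∈ F.part l (Wj j)).card ≤ D := by
  refine ⟨fun j hj => inter_subset_inter_right _ (preimage_mono (h.1 j hj)), fun s hs => ?_⟩
  refine (Finset.card_le_card fun j hj => ?_).trans (h.2 _ hs.2)
  simp only [Finset.mem_filter] at hj ⊢
  exact ⟨hj.1, hj.2.2⟩

variable (h : OverlapLE J W Wj D)
include h

theorem OverlapLE.aQForm_sum_le (e : ι → Vec N m) (he : ∀ j ∈ J, vrestr F (Wj j) (e j) = e j) :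
    aQForm F A W (∑ j ∈ J, e j) (∑ j ∈ J, e j) ≤ D * ∑ j ∈ J, aQForm F A (Wj j) (e j) (e j) := by
  have hs j (hj : j ∈ J) i := restr_eq_self_iff.1 (congrFun (he j hj) i)
  have e1 i : ((∑ j ∈ J, e j) i).1 = ∑ j ∈ J, (e j i).1 := by
    rw [Finset.sum_apply]; exact map_sum (valL m) _ _
  have e2 i : ((∑ j ∈ J, e j) i).2.1 = ∑ j ∈ J, (e j i).2.1 := by
    rw [Finset.sum_apply]; exact map_sum (gradL m) _ _
  have e3 i l : ((∑ j ∈ J, e j) i).2.2.2 l = ∑ j ∈ J, (e j i).2.2.2 l := by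
    rw [Finset.sum_apply]; exact map_sum (dtrL l) _ _
  have hW := W.isOpen.measurableSet
  have hWj j (_ : j ∈ J) := (Wj j).isOpen.measurableSet
  simp only [aQForm_eq F A _ _ hW, fun j => aQForm_eq F A (e j) (e j) (Wj j).isOpen.measurableSet]
  simp only [e1, e2, e3, Finset.sum_add_distrib, ← Finset.mul_sum, mul_add,
    ← Finset.sum_sub_distrib]
  refine add_le_add (add_le_add ?_ ?_) ?_
  · refine sum_le_mul_sum_sum _ _ fun i _ => ?_
    exact wInt_sum_le J hW hWj h.1 h.2 (A.isWeight_κ i) (A.κ_nonneg i) _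
      fun j hj => (hs j hj i).2.1
  · refine sum_le_mul_sum_sum _ _ fun i _ => ?_
    refine sum_le_mul_sum_sum _ _ fun l _ => ?_
    exact wInt_sum_le J (F.measurableSet_part l W.isOpen)
      (fun j _ => F.measurableSet_part l (Wj j).isOpen) (h.part l).1 (h.part l).2
      (A.isWeight_κf l i) (A.κf_nonneg l i) _ fun j hj => (hs j hj i).2.2.2 l
  -- The exchange part is again covered by `wInt_sum_le`, since the difference of two components is
  -- supported where both are.
  · rw [mul_left_comm]
    refine mul_le_mul_of_nonneg_left ?_ (by norm_num)
    refine sum_le_mul_sum_sum _ _ fun k _ => ?_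
    refine sum_le_mul_sum_sum _ _ fun i _ => ?_
    refine wInt_sum_le J hW hWj h.1 h.2 (A.isWeight_Q i k) (A.Q_nonneg i k) _ fun j hj => ?_
    filter_upwards [(hs j hj i).1, (hs j hj k).1, Lp.coeFn_sub (e j i).1 (e j k).1]
      with x h1 h2 h3
    by_cases hx : x ∈ (Wj j : Set Plane)
    · simp [hx]
    · simp only [hx, not_false_eq_true, indicator_of_notMem] at h1 h2 ⊢
      rw [h3, Pi.sub_apply, h1, h2, sub_zero]

theorem OverlapLE.cForm_sum_le (e : ι → Vec N m) (he : ∀ j ∈ J, vrestr F (Wj j) (e j) = e j) :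
    cForm F A W (∑ j ∈ J, e j) (∑ j ∈ J, e j) ≤ D * ∑ j ∈ J, cForm F A (Wj j) (e j) (e j) := by
  have hs j (hj : j ∈ J) i := restr_eq_self_iff.1 (congrFun (he j hj) i)
  have e1 i : ((∑ j ∈ J, e j) i).1 = ∑ j ∈ J, (e j i).1 := by
    rw [Finset.sum_apply]; exact map_sum (valL m) _ _
  have e3 i l : ((∑ j ∈ J, e j) i).2.2.1 l = ∑ j ∈ J, (e j i).2.2.1 l := by
    rw [Finset.sum_apply]; exact map_sum (trL l) _ _
  have hW := W.isOpen.measurableSet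
  have hWj j (_ : j ∈ J) := (Wj j).isOpen.measurableSet
  simp only [cForm_eq, e1, e3, Finset.sum_add_distrib, mul_add]
  refine add_le_add ?_ ?_
  · refine sum_le_mul_sum_sum _ _ fun i _ => ?_
    exact wInt_sum_le J hW hWj h.1 h.2 (A.isWeight_c i) (A.c_nonneg i) _
      fun j hj => (hs j hj i).1
  · refine sum_le_mul_sum_sum _ _ fun i _ => ?_
    refine sum_le_mul_sum_sum _ _ fun l _ => ?_
    exact wInt_sum_le J (F.measurableSet_part l W.isOpen)
      (fun j _ => F.measurableSet_part l (Wj j).isOpen) (h.part l).1 (h.part l).2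
      (A.isWeight_cf l i) (A.cf_nonneg l i) _ fun j hj => (hs j hj i).2.2.1 l

theorem OverlapLE.sum_aQForm_le (u : Vec N m) :
    ∑ j ∈ J, aQForm F A (Wj j) u u ≤ D * aQForm F A W u u := by
  have hW := W.isOpen.measurableSet
  have hWj j (_ : j ∈ J) := (Wj j).isOpen.measurableSet
  simp only [aQForm_eq F A _ _ hW, fun j => aQForm_eq F A u u (Wj j).isOpen.measurableSet]
  simp only [Finset.sum_add_distrib, ← Finset.mul_sum, mul_add]
  refine add_le_add (add_le_add ?_ ?_) ?_
  · refine sum_sum_le_mul_sum _ _ fun i _ => ?_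
    exact sum_wInt_le J hW hWj h.1 h.2 (A.isWeight_κ i) (A.κ_nonneg i) _
  · refine sum_sum_le_mul_sum _ _ fun i _ => ?_
    refine sum_sum_le_mul_sum _ _ fun l _ => ?_
    exact sum_wInt_le J (F.measurableSet_part l W.isOpen)
      (fun j _ => F.measurableSet_part l (Wj j).isOpen) (h.part l).1 (h.part l).2
      (A.isWeight_κf l i) (A.κf_nonneg l i) _
  · rw [mul_left_comm]
    refine mul_le_mul_of_nonneg_left ?_ (by norm_num)
    refine sum_sum_le_mul_sum _ _ fun k _ => ?_
    refine sum_sum_le_mul_sum _ _ fun i _ => ?_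
    exact sum_wInt_le J hW hWj h.1 h.2 (A.isWeight_Q i k) (A.Q_nonneg i k) _

end Overlap

/-! ### Localisation by a cutoff -/

/-- This is the pointwise product rule `|∇(χe)|² = ∇e · ∇(χ²e) + e²|∇χ|²`, in the plane and along
the fractures. The exchange term leaves no remainder because the same `χ` multiplies all components,
so `χ²` can be moved to one factor. -/
theorem aQForm_vmul_self {ω : Set Plane} (hω : IsOpen ω) (χ : Cutoff) (e : Vec N m) :
    aQForm F A ω (vmul F χ e) (vmul F χ e) =
      aQForm F A ω e (vmul F χ (vmul F χ e)) + sForm F A ω χ e e := by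
  have hm := hω.measurableSet
  rw [aQForm_eq F A _ _ hm, aQForm_eq F A _ _ hm, sForm_eq, add_right_comm, ← Finset.sum_add_distrib]
  congr 1
  · refine Finset.sum_congr rfl fun i _ => ?_
    rw [add_add_add_comm, ← Finset.sum_add_distrib]
    congr 1
    · have w1 := A.isWeight_κ i
      have w2 := (A.isWeight_κ i).mul χ.isWeight_gradient
      rw [wInt, wInt, wInt, ← integral_add (w1.integrable _ _).integrableOn
        (w2.integrable _ _).integrableOn]
      refine setIntegral_congr_ae hm ?_
      filter_upwards [grad_mul F χ (e i), grad_mul F χ (mul F χ (e i)), val_mul F χ (e i)]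
        with x h1 h2 h3 _
      simp only [vmul, h1, h2, h3, inner_add_left, inner_add_right, real_inner_smul_left,
        real_inner_smul_right, RCLike.inner_apply, conj_trivial, real_inner_self_eq_norm_sq,
        real_inner_comm, norm_smul, mul_pow, Real.norm_eq_abs, sq_abs]
      ring
    · refine Finset.sum_congr rfl fun l _ => ?_
      have w1 := A.isWeight_κf l i
      have w2 := (A.isWeight_κf l i).mul (χ.isWeight_deriv F l)
      rw [wInt, wInt, wInt, ← integral_add (w1.integrable _ _).integrableOn
        (w2.integrable _ _).integrableOn]
      refine setIntegral_congr_ae (F.measurableSet_part l hω) ?_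
      filter_upwards [dtr_mul F χ (e i) l, dtr_mul F χ (mul F χ (e i)) l, tr_mul F χ (e i) l]
        with x h1 h2 h3 _
      simp only [vmul, h1, h2, h3, RCLike.inner_apply, conj_trivial]
      ring
  · congr 1
    refine Finset.sum_congr rfl fun j _ => Finset.sum_congr rfl fun i _ => ?_
    refine setIntegral_congr_ae hm ?_
    filter_upwards [val_mul F χ (e i), val_mul F χ (mul F χ (e i)), val_mul F χ (e j),
      val_mul F χ (mul F χ (e j)), Lp.coeFn_sub (e i).1 (e j).1,
      Lp.coeFn_sub (mul F χ (e i)).1 (mul F χ (e j)).1,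
      Lp.coeFn_sub (mul F χ (mul F χ (e i))).1 (mul F χ (mul F χ (e j))).1]
      with x h1 h2 h3 h4 h5 h6 h7 _
    simp only [vmul, h5, h6, h7, Pi.sub_apply, h1, h2, h3, h4, RCLike.inner_apply, conj_trivial]
    ring

theorem cForm_vmul_self_le {ω : Set Plane} (χ : Cutoff) (e : Vec N m) {E : ℝ}
    (h1 : ∀ i, ∀ᵐ x ∂volume.restrict ω,
      A.c i x * χ x ^ 2 ≤ E * (A.κ i x * ‖gradient χ x‖ ^ 2))
    (h2 : ∀ i l, ∀ᵐ s ∂volume.restrict (F.part l ω),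
      A.cf l i s * χ.onLine F l s ^ 2 ≤ E * (A.κf l i s * deriv (χ.onLine F l) s ^ 2)) :
    cForm F A ω (vmul F χ e) (vmul F χ e) ≤ E * sForm F A ω χ e e := by
  have hE : IsWeight fun _ : Plane => E := ⟨measurable_const, _, fun _ => le_rfl⟩
  have hE' : IsWeight fun _ : ℝ => E := ⟨measurable_const, _, fun _ => le_rfl⟩
  have key {α : Type} [MeasurableSpace α] (μ : Measure α) (W : Set α) (g : α → ℝ) (u : Lp ℝ 2 μ) :
      E * wInt μ W g u u = wInt μ W (fun x => E * g x) u u := by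
    rw [wInt, ← integral_const_mul]
    simp only [wInt, mul_assoc]
  rw [cForm_eq, sForm_eq, Finset.mul_sum]
  refine Finset.sum_le_sum fun i _ => ?_
  rw [mul_add, Finset.mul_sum]
  refine add_le_add ?_ (Finset.sum_le_sum fun l _ => ?_)
  · rw [key]
    refine wInt_self_mono (A.isWeight_c i) (hE.mul ((A.isWeight_κ i).mul χ.isWeight_gradient)) ?_
    filter_upwards [h1 i, ae_restrict_of_ae (val_mul F χ (e i))] with x hx hv
    simp only [vmul, hv, norm_mul, mul_pow, Real.norm_eq_abs, sq_abs]
    rw [← mul_assoc]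
    exact mul_le_mul_of_nonneg_right hx (sq_nonneg _)
  · rw [key]
    refine wInt_self_mono (A.isWeight_cf l i)
      (hE'.mul ((A.isWeight_κf l i).mul (χ.isWeight_deriv F l))) ?_
    filter_upwards [h2 i l, ae_restrict_of_ae (tr_mul F χ (e i) l)] with x hx hv
    simp only [vmul, hv, norm_mul, mul_pow, Real.norm_eq_abs, sq_abs]
    rw [← mul_assoc]
    exact mul_le_mul_of_nonneg_right hx (sq_nonneg _)

theorem sForm_self_nonneg (ω : Set Plane) (χ : Cutoff) (e : Vec N m) :
    0 ≤ sForm F A ω χ e e := by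
  rw [sForm_eq]
  exact Finset.sum_nonneg fun i _ => add_nonneg
    (wInt_self_nonneg (fun x => mul_nonneg (A.κ_nonneg i x) (sq_nonneg _)) _)
    (Finset.sum_nonneg fun l _ => wInt_self_nonneg
      (fun x => mul_nonneg (A.κf_nonneg l i x) (sq_nonneg _)) _)

end Localisation

/-! ### Locally Lipschitz functions -/

section LocallyLipschitz

theorem LocallyLipschitzOn.mul_real {X : Type*} [PseudoMetricSpace X] {s : Set X} {f g : X → ℝ}
    (hf : LocallyLipschitzOn s f) (hg : LocallyLipschitzOn s g) :
    LocallyLipschitzOn s fun x => f x * g x := fun x hx => by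
  obtain ⟨Kf, t, ht, hKf⟩ := hf hx
  obtain ⟨Kg, t', ht', hKg⟩ := hg hx
  have hfb : ∀ᶠ y in 𝓝[s] x, |f y| ≤ |f x| + 1 :=
    (hf.continuousOn x hx).abs.eventually_le_const (lt_add_one _)
  have hgb : ∀ᶠ y in 𝓝[s] x, |g y| ≤ |g x| + 1 :=
    (hg.continuousOn x hx).abs.eventually_le_const (lt_add_one _)
  refine ⟨Real.toNNReal ((|f x| + 1) * Kg + (|g x| + 1) * Kf), _,
    Filter.inter_mem (Filter.inter_mem ht ht') (Filter.inter_mem hfb hgb), ?_⟩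
  refine LipschitzOnWith.of_dist_le_mul fun y hy z hz => ?_
  have h1 := hKf.dist_le_mul y hy.1.1 z hz.1.1
  have h2 := hKg.dist_le_mul y hy.1.2 z hz.1.2
  have h3 : |f y| ≤ |f x| + 1 := hy.2.1
  have h4 : |g z| ≤ |g x| + 1 := hz.2.2
  rw [Real.coe_toNNReal _ (by positivity)]
  rw [Real.dist_eq] at h1 h2 ⊢
  calc |f y * g y - f z * g z| = |f y * (g y - g z) + g z * (f y - f z)| := by ring_nf
    _ ≤ |f y| * |g y - g z| + |g z| * |f y - f z| := by
        rw [← abs_mul, ← abs_mul]; exact abs_add_le _ _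
    _ ≤ (|f x| + 1) * (Kg * dist y z) + (|g x| + 1) * (Kf * dist y z) := by gcongr
    _ = _ := by ring

theorem LocallyLipschitzOn.comp_continuous {X Y : Type*} [PseudoMetricSpace X]
    [PseudoMetricSpace Y] {s : Set Y} {f : Y → ℝ} (hf : LocallyLipschitzOn s f) {g : X → Y}
    {K : ℝ≥0} (hg : LipschitzWith K g) : LocallyLipschitzOn (g ⁻¹' s) fun x => f (g x) :=
  fun x hx => by
    obtain ⟨Kf, t, ht, hKf⟩ := hf hx
    refine ⟨Kf * K, g ⁻¹' t, ?_, hKf.comp hg.lipschitzOnWith (mapsTo_preimage g t)⟩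
    exact hg.continuous.continuousWithinAt.tendsto_nhdsWithin (mapsTo_preimage g s) ht

theorem locallyLipschitz_indicator {X : Type*} [PseudoMetricSpace X] {s : Set X} (hs : IsOpen s) {f : X → ℝ}
    (hf : LocallyLipschitzOn s f) (hsupp : tsupport (s.indicator f) ⊆ s) :
    LocallyLipschitz (s.indicator f) := fun x => by
  by_cases hx : x ∈ s
  · obtain ⟨K, t, ht, hK⟩ := hf hx
    rw [hs.nhdsWithin_eq hx] at ht
    refine ⟨K, t ∩ s, Filter.inter_mem ht (hs.mem_nhds hx), fun y hy z hz => ?_⟩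
    rw [indicator_of_mem hy.2, indicator_of_mem hz.2]
    exact hK hy.1 hz.1
  · refine ⟨0, (tsupport (s.indicator f))ᶜ,
      (isClosed_tsupport _).isOpen_compl.mem_nhds fun h => hx (hsupp h), fun y hy z hz => ?_⟩
    rw [image_eq_zero_of_notMem_tsupport hy, image_eq_zero_of_notMem_tsupport hz]
    simp

variable {X : Type*} [NormedAddCommGroup X] [NormedSpace ℝ X] [FiniteDimensional ℝ X]

/-- Rademacher's theorem holds near each point, and a set that is locally null is null. -/
theorem LocallyLipschitzOn.ae_differentiableAt [MeasurableSpace X] [BorelSpace X]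
    {μ : Measure X} [μ.IsAddHaarMeasure] {s : Set X} (hs : IsOpen s) {f : X → ℝ}
    (hf : LocallyLipschitzOn s f) : ∀ᵐ x ∂μ, x ∈ s → DifferentiableAt ℝ f x := by
  refine measure_null_of_locally_null _ fun x hx => ?_
  have hxs : x ∈ s := by
    by_contra h
    exact hx fun h' => (h h').elim
  obtain ⟨K, t, ht, hK⟩ := hf hxs
  rw [hs.nhdsWithin_eq hxs] at ht
  refine ⟨_, Filter.inter_mem self_mem_nhdsWithin
    (mem_nhdsWithin_of_mem_nhds (interior_mem_nhds.2 ht)), ?_⟩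
  have h := (hK.mono interior_subset).ae_differentiableWithinAt_of_mem (μ := μ)
  refine measure_mono_null (fun y hy => ?_) h
  intro hy'
  exact hy.1 fun _ => (hy' hy.2).differentiableAt (isOpen_interior.mem_nhds hy.2)

/-- On a ball that exceeds the support by a margin of 1, compactness gives a Lipschitz constant. A
point outside this ball has distance at least 1 from the smaller ball containing the support, so
there the supremum `M` of `|f|` serves as Lipschitz constant. -/
theorem exists_lipschitzWith_of_hasCompactSupport {f : X → ℝ} (hf : LocallyLipschitz f)
    (hc : HasCompactSupport f) : ∃ K : ℝ≥0, LipschitzWith K f := by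
  have : ProperSpace X := FiniteDimensional.proper_real X
  obtain ⟨R, hR⟩ := hc.isBounded.subset_closedBall 0
  obtain ⟨K, hK⟩ := LocallyLipschitzOn.exists_lipschitzOnWith_of_compact
    (isCompact_closedBall (0 : X) (R + 1)) hf.locallyLipschitzOn
  obtain ⟨M, hM⟩ := hc.exists_bound_of_continuous hf.continuous
  have hM0 : 0 ≤ M := (norm_nonneg _).trans (hM 0)
  have hz : ∀ x, x ∉ Metric.closedBall (0 : X) R → f x = 0 := fun x hx =>
    image_eq_zero_of_notMem_tsupport fun h => hx (hR h)
  have key : ∀ x y, y ∉ Metric.closedBall (0 : X) (R + 1) → |f x - f y| ≤ M * dist x y := by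
    intro x y hy
    have hy' : R + 1 < ‖y‖ := by simpa using hy
    rw [hz y (by simp; linarith), sub_zero]
    by_cases hx : x ∈ Metric.closedBall (0 : X) R
    · have hx' : ‖x‖ ≤ R := by simpa using hx
      have h1 : 1 ≤ dist x y := by
        rw [dist_comm, dist_eq_norm]
        have := norm_sub_norm_le y x
        linarith
      exact (hM x).trans (le_mul_of_one_le_right hM0 h1)
    · rw [hz x hx, abs_zero]
      positivity
  refine ⟨K + Real.toNNReal M, LipschitzWith.of_dist_le_mul fun x y => ?_⟩
  rw [NNReal.coe_add, Real.coe_toNNReal _ hM0, Real.dist_eq, add_mul]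
  have h0 : 0 ≤ K * dist x y := by positivity
  have h0' : 0 ≤ M * dist x y := by positivity
  by_cases hy : y ∈ Metric.closedBall (0 : X) (R + 1)
  · by_cases hx : x ∈ Metric.closedBall (0 : X) (R + 1)
    · exact (hK.dist_le_mul x hx y hy).trans (le_add_of_nonneg_right h0')
    · rw [abs_sub_comm]
      refine (key y x hx).trans ?_
      rw [dist_comm]
      exact le_add_of_nonneg_left h0
  · exact (key x y hy).trans (le_add_of_nonneg_left h0)

end LocallyLipschitz

/-! ### Representation of products and sums -/

section Represents

variable {m : ℕ} {F : Fractures m} {ω : Set Plane} {f g : Plane → ℝ} {u v : Tuple m}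

/-- A line is null in the plane, so almost everywhere differentiability there says nothing on a
fracture. The theorem has to be applied to the one-dimensional restriction. -/
theorem Fractures.ae_differentiableAt_line (F : Fractures m) (hω : IsOpen ω)
    (hf : LocallyLipschitzOn ω f) (l : Fin m) :
    ∀ᵐ s : ℝ, s ∈ F.part l ω → DifferentiableAt ℝ (fun s => f (F.line l s)) s := by
  filter_upwards [LocallyLipschitzOn.ae_differentiableAt (μ := volume)
    (hω.preimage (F.lipschitz_line l).continuous)
    (LocallyLipschitzOn.comp_continuous hf (F.lipschitz_line l))] with s hs h
  exact hs h.2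

theorem gradient_fun_mul {x : Plane} (hf : DifferentiableAt ℝ f x) (hg : DifferentiableAt ℝ g x) :
    gradient (fun y => f y * g y) x = f x • gradient g x + g x • gradient f x := by
  simp only [gradient, fderiv_fun_mul hf hg, map_add, map_smul]

/-- The product was defined by the product rule on the data; at almost every point both factors are
differentiable, so it agrees with the true derivatives. -/
theorem Represents.mul (hω : IsOpen ω) (hf : LocallyLipschitzOn ω f) (h : Represents F ω f u)
    (χ : Cutoff) : Represents F ω (fun x => χ x * f x) (mul F χ u) := by
  obtain ⟨h1, h2, h3, h4⟩ := h
  obtain ⟨K, hK⟩ := χ.exists_lipschitz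
  have hχ := hK.locallyLipschitz.locallyLipschitzOn (s := ω)
  refine ⟨?_, ?_, fun l => ?_, fun l => ?_⟩
  · filter_upwards [h1, val_mul F χ u] with x h1 h
    rw [val] at *
    rw [h, h1]
    by_cases hx : x ∈ ω <;> simp [hx]
  · filter_upwards [h1, h2, grad_mul F χ u, LocallyLipschitzOn.ae_differentiableAt hω hf,
      LocallyLipschitzOn.ae_differentiableAt hω hχ] with x h1 h2 h hf hχ
    rw [val] at *
    rw [grad] at *
    rw [h, h1, h2]
    by_cases hx : x ∈ ω
    · simp only [hx, indicator_of_mem]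
      rw [gradient_fun_mul (hχ hx) (hf hx)]
    · simp [hx]
  · filter_upwards [h3 l, tr_mul F χ u l] with x h1 h
    rw [tr] at *
    rw [h, h1]
    by_cases hx : x ∈ F.part l ω <;> simp [hx, Cutoff.onLine]
  · filter_upwards [h3 l, h4 l, dtr_mul F χ u l, F.ae_differentiableAt_line hω hf l,
      F.ae_differentiableAt_line hω hχ l] with x h1 h2 h hf hχ
    rw [tr] at *
    rw [dtr] at *
    rw [h, h1, h2]
    by_cases hx : x ∈ F.part l ω
    · simp only [hx, indicator_of_mem]
      rw [deriv_fun_mul (hχ hx) (hf hx)]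
      simp only [Cutoff.onLine]
      ring!
    · simp [hx]

theorem Represents.congr (hω : IsOpen ω) (h : Represents F ω f u) (hfg : EqOn f g ω) :
    Represents F ω g u := by
  obtain ⟨h1, h2, h3, h4⟩ := h
  refine ⟨h1.trans (.of_eq (indicator_congr hfg)), h2.trans (.of_eq (indicator_congr fun x hx => ?_)),
    fun l => (h3 l).trans (.of_eq (indicator_congr fun s hs => hfg hs.2)),
    fun l => (h4 l).trans (.of_eq (indicator_congr fun s hs => ?_))⟩
  · exact (hfg.eventuallyEq_of_mem (hω.mem_nhds hx)).gradient_eq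
  · refine Filter.EventuallyEq.deriv_eq ?_
    filter_upwards [(hω.preimage (F.lipschitz_line l).continuous).mem_nhds hs.2] with y hy
    exact hfg hy

theorem Represents.restr_eq {ω : TopologicalSpace.Opens Plane} (h : Represents F ω f u) :
    restr F ω u = u := by
  have key {α V : Type} [MeasurableSpace α] {μ : Measure α} [Zero V] {W : Set α} {a b : α → V}
      (h : a =ᵐ[μ] W.indicator b) : a =ᵐ[μ] W.indicator a := by
    filter_upwards [h] with x hx
    by_cases hxW : x ∈ W
    · rw [indicator_of_mem hxW]
    · rw [hx, indicator_of_notMem hxW, indicator_of_notMem hxW]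
  exact restr_eq_self_iff.2 ⟨key h.1, key h.2.1, fun l => key (h.2.2.1 l), fun l => key (h.2.2.2 l)⟩

theorem Represents.add (hω : IsOpen ω) (hf : LocallyLipschitzOn ω f)
    (hg : LocallyLipschitzOn ω g) (h : Represents F ω f u) (h' : Represents F ω g v) :
    Represents F ω (fun x => f x + g x) (u + v) := by
  refine ⟨?_, ?_, fun l => ?_, fun l => ?_⟩
  · filter_upwards [h.1, h'.1, Lp.coeFn_add u.1 v.1] with x h1 h2 h3
    rw [val] at *
    rw [Prod.fst_add, h3, Pi.add_apply, h1, h2]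
    by_cases hx : x ∈ ω <;> simp [hx]
  · filter_upwards [h.2.1, h'.2.1, Lp.coeFn_add u.2.1 v.2.1,
      LocallyLipschitzOn.ae_differentiableAt hω hf,
      LocallyLipschitzOn.ae_differentiableAt hω hg] with x h1 h2 h3 hf hg
    rw [grad] at *
    rw [Prod.snd_add, Prod.fst_add, h3, Pi.add_apply, h1, h2]
    by_cases hx : x ∈ ω
    · simp only [hx, indicator_of_mem, gradient, fderiv_fun_add (hf hx) (hg hx), map_add]
    · simp [hx]
  · filter_upwards [h.2.2.1 l, h'.2.2.1 l, Lp.coeFn_add (u.2.2.1 l) (v.2.2.1 l)] with x h1 h2 h3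
    rw [tr] at *
    rw [Prod.snd_add, Prod.snd_add, Prod.fst_add, Pi.add_apply, h3, Pi.add_apply, h1, h2]
    by_cases hx : x ∈ F.part l ω <;> simp [hx]
  · filter_upwards [h.2.2.2 l, h'.2.2.2 l, Lp.coeFn_add (u.2.2.2 l) (v.2.2.2 l),
      F.ae_differentiableAt_line hω hf l, F.ae_differentiableAt_line hω hg l]
      with x h1 h2 h3 hf hg
    rw [dtr] at *
    rw [Prod.snd_add, Prod.snd_add, Prod.snd_add, Pi.add_apply, h3, Pi.add_apply, h1, h2]
    by_cases hx : x ∈ F.part l ω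
    · simp only [hx, indicator_of_mem, deriv_fun_add (hf hx) (hg hx)]
    · simp [hx]

theorem Represents.const_smul (hω : IsOpen ω) (hf : LocallyLipschitzOn ω f)
    (h : Represents F ω f u) (r : ℝ) : Represents F ω (fun x => r * f x) (r • u) := by
  refine ⟨?_, ?_, fun l => ?_, fun l => ?_⟩
  · filter_upwards [h.1, Lp.coeFn_smul r u.1] with x h1 h3
    rw [val] at *
    rw [Prod.smul_fst, h3, Pi.smul_apply, h1]
    by_cases hx : x ∈ ω <;> simp [hx]
  · filter_upwards [h.2.1, Lp.coeFn_smul r u.2.1,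
      LocallyLipschitzOn.ae_differentiableAt hω hf] with x h1 h3 hf
    rw [grad] at *
    rw [Prod.smul_snd, Prod.smul_fst, h3, Pi.smul_apply, h1]
    by_cases hx : x ∈ ω
    · simp only [hx, indicator_of_mem, gradient, fderiv_const_mul (hf hx), map_smul]
    · simp [hx]
  · filter_upwards [h.2.2.1 l, Lp.coeFn_smul r (u.2.2.1 l)] with x h1 h3
    rw [tr] at *
    rw [Prod.smul_snd, Prod.smul_snd, Prod.smul_fst, Pi.smul_apply, h3, Pi.smul_apply, h1]
    by_cases hx : x ∈ F.part l ω <;> simp [hx]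
  · filter_upwards [h.2.2.2 l, Lp.coeFn_smul r (u.2.2.2 l),
      F.ae_differentiableAt_line hω hf l] with x h1 h3 hf
    rw [dtr] at *
    rw [Prod.smul_snd, Prod.smul_snd, Prod.smul_snd, Pi.smul_apply, h3, Pi.smul_apply, h1]
    by_cases hx : x ∈ F.part l ω
    · simp only [hx, indicator_of_mem, deriv_const_mul r (hf hx), smul_eq_mul]
    · simp [hx]

variable (F ω) in
theorem Represents.zero : Represents F ω (fun _ => 0) (0 : Tuple m) := by
  refine ⟨?_, ?_, fun l => ?_, fun l => ?_⟩
  · filter_upwards [Lp.coeFn_zero ℝ 2 (volume : Measure Plane)] with x hx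
    rw [val, Prod.fst_zero, hx]
    simp
  · filter_upwards [Lp.coeFn_zero Plane 2 (volume : Measure Plane)] with x hx
    rw [grad, Prod.snd_zero, Prod.fst_zero, hx]
    simp [gradient_fun_const]
  · filter_upwards [Lp.coeFn_zero ℝ 2 (volume : Measure ℝ)] with x hx
    rw [tr, Prod.snd_zero, Prod.snd_zero, Prod.fst_zero, Pi.zero_apply, hx]
    simp
  · filter_upwards [Lp.coeFn_zero ℝ 2 (volume : Measure ℝ)] with x hx
    rw [dtr, Prod.snd_zero, Prod.snd_zero, Prod.snd_zero, Pi.zero_apply, hx]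
    simp

end Represents

section ZeroBoundary

variable {m : ℕ} {F : Fractures m}

/-! ### The space with zero boundary values -/

/-- The data of the Lipschitz functions with compact support in `ω`. -/
def compactlySupported (F : Fractures m) (ω : TopologicalSpace.Opens Plane) :
    Submodule ℝ (Tuple m) where
  carrier := {u | ∃ f : Plane → ℝ, (∃ K : ℝ≥0, LipschitzWith K f) ∧ HasCompactSupport f ∧
    tsupport f ⊆ ω ∧ Represents F ω f u}
  add_mem' := by
    rintro u v ⟨f, ⟨K, hK⟩, hfc, hfω, hf⟩ ⟨g, ⟨K', hK'⟩, hgc, hgω, hg⟩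
    exact ⟨fun x => f x + g x, ⟨K + K', hK.add hK'⟩, hfc.add hgc,
      (tsupport_add f g).trans (union_subset hfω hgω),
      hf.add ω.isOpen hK.locallyLipschitz.locallyLipschitzOn
        hK'.locallyLipschitz.locallyLipschitzOn hg⟩
  zero_mem' := ⟨fun _ => 0, ⟨0, LipschitzWith.const 0⟩, HasCompactSupport.zero,
    by simp [tsupport], .zero F ω⟩
  smul_mem' := by
    rintro r u ⟨f, ⟨K, hK⟩, hfc, hfω, hf⟩
    have hs : tsupport (fun x => r * f x) ⊆ tsupport f :=
      tsupport_mul_subset_right (f := fun _ => r) (g := f)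
    refine ⟨fun x => r * f x, ⟨‖r‖₊ * K, ?_⟩, hfc.mul_left (f := fun _ => r), hs.trans hfω,
      hf.const_smul ω.isOpen hK.locallyLipschitz.locallyLipschitzOn r⟩
    refine LipschitzWith.of_dist_le_mul fun x y => ?_
    have := hK.dist_le_mul x y
    rw [Real.dist_eq] at this ⊢
    rw [← mul_sub, abs_mul, NNReal.coe_mul, coe_nnnorm, Real.norm_eq_abs, mul_assoc]
    gcongr

/-- `H10` as a closed subspace. -/
def h10 (F : Fractures m) (ω : TopologicalSpace.Opens Plane) : Submodule ℝ (Tuple m) :=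
  (compactlySupported F ω).topologicalClosure

theorem isClosed_h10 (ω : TopologicalSpace.Opens Plane) : IsClosed (h10 F ω : Set (Tuple m)) :=
  (compactlySupported F ω).isClosed_topologicalClosure

theorem isClosed_setOf_restr_eq (ω : TopologicalSpace.Opens Plane) :
    IsClosed {u : Tuple m | restr F ω u = u} := by
  obtain ⟨R, hR⟩ := exists_clm_restr F ω
  simp only [← hR]
  exact isClosed_eq R.continuous continuous_id

theorem restr_eq_of_mem_H1 {Γ : Set Plane} {ω : TopologicalSpace.Opens Plane} {u : Tuple m}
    (hu : u ∈ H1 F Γ ω) : restr F ω u = u := by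
  refine closure_minimal ?_ (isClosed_setOf_restr_eq ω) hu
  rintro v ⟨f, -, -, hf⟩
  exact hf.restr_eq

theorem restr_eq_of_mem_h10 {ω : TopologicalSpace.Opens Plane} {u : Tuple m}
    (hu : u ∈ h10 F ω) : restr F ω u = u := by
  refine closure_minimal ?_ (isClosed_setOf_restr_eq ω) hu
  rintro v ⟨f, -, -, -, hf⟩
  exact hf.restr_eq

/-! ### Truncated cutoffs -/

namespace Cutoff

/-- The cutoff `max (χ - ε) 0`. -/
def trunc (χ : Cutoff) (ε : ℝ) (hε : 0 ≤ ε) : Cutoff where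
  toFun x := max (χ x - ε) 0
  exists_lipschitz := by
    obtain ⟨K, hK⟩ := χ.exists_lipschitz
    refine ⟨K, LipschitzWith.max_const ?_ 0⟩
    exact LipschitzWith.of_dist_le_mul fun x y => by
      simpa using hK.dist_le_mul x y
  nonneg x := le_max_right _ _
  le_one x := max_le (by have := χ.le_one x; linarith) zero_le_one

variable (χ : Cutoff) {ε : ℝ} (hε : 0 ≤ ε)

theorem trunc_apply (x : Plane) : χ.trunc ε hε x = max (χ x - ε) 0 := rfl

theorem abs_trunc_sub_le (x : Plane) : |χ.trunc ε hε x - χ x| ≤ ε := by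
  rw [trunc_apply]
  have := χ.nonneg x
  rcases le_total (χ x - ε) 0 with h | h
  · rw [max_eq_right h, zero_sub, abs_neg, abs_of_nonneg this]
    linarith
  · rw [max_eq_left h, sub_sub_cancel_left, abs_neg, abs_of_nonneg hε]

/-- The formula holds at every point, kinks included: where `χ x ≤ ε` the truncation attains its
minimum 0, and the derivative at a local minimum is 0, also by convention if it does not exist. -/
theorem gradient_trunc (x : Plane) :
    gradient (χ.trunc ε hε) x = if ε < χ x then gradient χ x else 0 := by
  split_ifs with h
  · have h1 : (χ.trunc ε hε : Plane → ℝ) =ᶠ[𝓝 x] fun y => χ y - ε := by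
      filter_upwards [χ.continuous.continuousAt.eventually (lt_mem_nhds h)] with y hy
      rw [trunc_apply, max_eq_left (by linarith)]
    rw [h1.gradient_eq, gradient, gradient, fderiv_sub_const]
  · have h1 : IsLocalMin (χ.trunc ε hε : Plane → ℝ) x := by
      refine .of_forall fun y => ?_
      rw [trunc_apply χ hε x, max_eq_right (by linarith)]
      exact (χ.trunc ε hε).nonneg y
    rw [gradient, h1.fderiv_eq_zero, map_zero]

theorem deriv_trunc (F : Fractures m) (l : Fin m) (s : ℝ) :
    deriv ((χ.trunc ε hε).onLine F l) s =
      if ε < χ.onLine F l s then deriv (χ.onLine F l) s else 0 := by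
  split_ifs with h
  · have h1 : (χ.trunc ε hε).onLine F l =ᶠ[𝓝 s] fun y => χ.onLine F l y - ε := by
      filter_upwards [(χ.continuous_onLine F l).continuousAt.eventually (lt_mem_nhds h)] with y hy
      rw [onLine, trunc_apply, max_eq_left (by rw [onLine] at hy; linarith), onLine]
    rw [h1.deriv_eq, deriv_sub_const]
  · have h1 : IsLocalMin ((χ.trunc ε hε).onLine F l) s := by
      refine .of_forall fun y => ?_
      rw [onLine, trunc_apply χ hε, max_eq_right (by rw [onLine] at h; linarith)]
      exact (χ.trunc ε hε).nonneg _
    rw [h1.deriv_eq_zero]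

end Cutoff

/-! ### Convergence of products with truncated cutoffs as `ε → 0`. -/

section TruncBounds

variable (F) (χ : Cutoff) (u : Tuple m)

theorem norm_val_mul_trunc_sub_le {ε : ℝ} (hε : 0 ≤ ε) (v : Tuple m) :
    ‖(mul F (χ.trunc ε hε) v - mul F χ v).1‖ ≤ ε * ‖v.1‖ := by
  refine Lp.norm_le_mul_norm_of_ae_le_mul ?_
  filter_upwards [val_mul F χ v, val_mul F (χ.trunc ε hε) v,
    Lp.coeFn_sub (mul F (χ.trunc ε hε) v).1 (mul F χ v).1] with x h1 h2 h3
  rw [Prod.fst_sub, h3, Pi.sub_apply, h1, h2, ← sub_mul, norm_mul]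
  gcongr
  exact χ.abs_trunc_sub_le hε x

theorem norm_tr_mul_trunc_sub_le {ε : ℝ} (hε : 0 ≤ ε) (v : Tuple m) (l : Fin m) :
    ‖(mul F (χ.trunc ε hε) v - mul F χ v).2.2.1 l‖ ≤ ε * ‖v.2.2.1 l‖ := by
  refine Lp.norm_le_mul_norm_of_ae_le_mul ?_
  filter_upwards [tr_mul F χ v l, tr_mul F (χ.trunc ε hε) v l,
    Lp.coeFn_sub ((mul F (χ.trunc ε hε) v).2.2.1 l) ((mul F χ v).2.2.1 l)] with x h1 h2 h3
  rw [Prod.snd_sub, Prod.snd_sub, Prod.fst_sub, Pi.sub_apply, h3, Pi.sub_apply, h1, h2, ← sub_mul,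
    norm_mul]
  gcongr
  exact χ.abs_trunc_sub_le hε _

/-- The gradient of the truncation does not approach `∇χ` uniformly: on `{χ ≤ ε}` the error is all
of `∇χ`. The truncation is therefore applied to `χu` and not to `u`, since on that set `|χu| ≤
ε|u|`. This is why the squared cutoff appears. -/
theorem exists_norm_grad_mul_trunc_sub_le : ∃ C : ℝ, 0 ≤ C ∧ ∀ ε, ∀ hε : 0 ≤ ε,
    ‖(mul F (χ.trunc ε hε) (mul F χ u) - mul F χ (mul F χ u)).2.1‖ ≤ ε * C := by
  obtain ⟨K, hK⟩ := χ.exists_norm_gradient_le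
  have hK0 : 0 ≤ K := (norm_nonneg _).trans (hK 0)
  have hG : MemLp (fun x => ‖(mul F χ u).2.1 x‖ + K * ‖u.1 x‖) 2 volume :=
    (Lp.memLp (mul F χ u).2.1).norm.add ((Lp.memLp u.1).norm.const_mul K)
  refine ⟨‖hG.toLp‖, norm_nonneg _, fun ε hε => Lp.norm_le_mul_norm_of_ae_le_mul ?_⟩
  filter_upwards [grad_mul F χ (mul F χ u), grad_mul F (χ.trunc ε hε) (mul F χ u),
    val_mul F χ u, hG.coeFn_toLp,
    Lp.coeFn_sub (mul F (χ.trunc ε hε) (mul F χ u)).2.1 (mul F χ (mul F χ u)).2.1]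
    with x h1 h2 h4 h5 h3
  rw [Prod.snd_sub, Prod.fst_sub, h3, Pi.sub_apply, h1, h2, add_sub_add_comm, ← sub_smul,
    ← smul_sub, h5,
    Real.norm_of_nonneg (by positivity : 0 ≤ ‖(mul F χ u).2.1 x‖ + K * ‖u.1 x‖), mul_add]
  refine (norm_add_le _ _).trans (add_le_add ?_ ?_)
  · rw [norm_smul]
    gcongr
    exact χ.abs_trunc_sub_le hε x
  · rw [χ.gradient_trunc, norm_smul, h4, norm_mul, Real.norm_of_nonneg (χ.nonneg x)]
    split_ifs with h
    · rw [sub_self, norm_zero, mul_zero]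
      positivity
    · rw [zero_sub, norm_neg, mul_right_comm, ← mul_assoc]
      have := χ.nonneg x
      gcongr
      · linarith
      · exact hK x

theorem exists_norm_dtr_mul_trunc_sub_le (l : Fin m) : ∃ C : ℝ, 0 ≤ C ∧ ∀ ε, ∀ hε : 0 ≤ ε,
    ‖(mul F (χ.trunc ε hε) (mul F χ u) - mul F χ (mul F χ u)).2.2.2 l‖ ≤ ε * C := by
  obtain ⟨K, hK⟩ := χ.exists_norm_deriv_le F l
  have hK0 : 0 ≤ K := (norm_nonneg _).trans (hK 0)
  have hG : MemLp (fun x => ‖(mul F χ u).2.2.2 l x‖ + K * ‖u.2.2.1 l x‖) 2 volume :=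
    (Lp.memLp ((mul F χ u).2.2.2 l)).norm.add ((Lp.memLp (u.2.2.1 l)).norm.const_mul K)
  refine ⟨‖hG.toLp‖, norm_nonneg _, fun ε hε => Lp.norm_le_mul_norm_of_ae_le_mul ?_⟩
  filter_upwards [dtr_mul F χ (mul F χ u) l, dtr_mul F (χ.trunc ε hε) (mul F χ u) l,
    tr_mul F χ u l, hG.coeFn_toLp,
    Lp.coeFn_sub ((mul F (χ.trunc ε hε) (mul F χ u)).2.2.2 l)
      ((mul F χ (mul F χ u)).2.2.2 l)] with x h1 h2 h4 h5 h3
  rw [Prod.snd_sub, Prod.snd_sub, Prod.snd_sub, Pi.sub_apply, h3, Pi.sub_apply, h1, h2,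
    add_sub_add_comm, ← sub_mul, ← mul_sub, h5,
    Real.norm_of_nonneg (by positivity : 0 ≤ ‖(mul F χ u).2.2.2 l x‖ + K * ‖u.2.2.1 l x‖),
    mul_add]
  refine (norm_add_le _ _).trans (add_le_add ?_ ?_)
  · rw [norm_mul]
    gcongr
    exact χ.abs_trunc_sub_le hε _
  · have hχ : 0 ≤ χ.onLine F l x := χ.nonneg _
    rw [χ.deriv_trunc, norm_mul, h4, norm_mul, Real.norm_of_nonneg hχ]
    split_ifs with h
    · rw [sub_self, norm_zero, mul_zero]
      positivity
    · rw [zero_sub, norm_neg, mul_right_comm, ← mul_assoc]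
      gcongr
      · linarith
      · exact hK x

theorem exists_norm_mul_trunc_sub_le : ∃ C : ℝ, ∀ ε, ∀ hε : 0 ≤ ε,
    ‖mul F (χ.trunc ε hε) (mul F χ u) - mul F χ (mul F χ u)‖ ≤ ε * C := by
  obtain ⟨C1, hC1, h1⟩ := exists_norm_grad_mul_trunc_sub_le F χ u
  choose C2 hC2 h2 using exists_norm_dtr_mul_trunc_sub_le F χ u
  generalize mul F χ u = v at *
  have hs1 : 0 ≤ ∑ l, ‖v.2.2.1 l‖ := Finset.sum_nonneg fun _ _ => norm_nonneg _
  have hs2 : 0 ≤ ∑ l, C2 l := Finset.sum_nonneg fun l _ => hC2 l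
  have hn1 := norm_nonneg v.1
  have hl1 l : ‖v.2.2.1 l‖ ≤ ∑ l, ‖v.2.2.1 l‖ :=
    Finset.single_le_sum (f := fun l => ‖v.2.2.1 l‖) (fun _ _ => norm_nonneg _) (Finset.mem_univ l)
  have hl2 l : C2 l ≤ ∑ l, C2 l := Finset.single_le_sum (fun l _ => hC2 l) (Finset.mem_univ l)
  refine ⟨‖v.1‖ + C1 + ∑ l, ‖v.2.2.1 l‖ + ∑ l, C2 l, fun ε hε => ?_⟩
  refine norm_prod_le_iff.2 ⟨(norm_val_mul_trunc_sub_le F χ hε v).trans ?_,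
    norm_prod_le_iff.2 ⟨(h1 ε hε).trans ?_, norm_prod_le_iff.2
    ⟨(pi_norm_le_iff_of_nonneg (by positivity)).2 fun l =>
      (norm_tr_mul_trunc_sub_le F χ hε v l).trans ?_,
    (pi_norm_le_iff_of_nonneg (by positivity)).2 fun l => (h2 l ε hε).trans ?_⟩⟩⟩
  · gcongr; linarith
  · gcongr; linarith
  · gcongr; linarith [hl1 l]
  · gcongr; linarith [hl2 l]

end TruncBounds

/-! ### Products with squared cutoffs have zero boundary values -/

/-- The product vanishes near every boundary point: near points of `Γ` because `f` does, near the
others because `χ < ε` there by continuity. Its extension by zero thus has compact support in `ω`.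
-/
theorem mul_trunc_mul_mem_compactlySupported {Γ : Set Plane} {ω : TopologicalSpace.Opens Plane}
    (hω : Bornology.IsBounded (ω : Set Plane)) {χ : Cutoff}
    (hχ : ∀ y ∈ frontier (ω : Set Plane), y ∉ Γ → χ y = 0) {f : Plane → ℝ}
    (hf : LocallyLipschitzOn ω f) (hΓ : ∀ᶠ x in 𝓝ˢ Γ, x ∈ ω → f x = 0) {u : Tuple m}
    (hu : Represents F ω f u) {ε : ℝ} (hε : 0 < ε) :
    mul F (χ.trunc ε hε.le) (mul F χ u) ∈ compactlySupported F ω := by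
  set g : Plane → ℝ := fun x => χ.trunc ε hε.le x * (χ x * f x) with hg
  have hlip (χ : Cutoff) : LocallyLipschitzOn (ω : Set Plane) χ := by
    obtain ⟨K, hK⟩ := χ.exists_lipschitz
    exact hK.locallyLipschitz.locallyLipschitzOn
  have hχf := LocallyLipschitzOn.mul_real (hlip χ) hf
  have hgl : LocallyLipschitzOn (ω : Set Plane) g := LocallyLipschitzOn.mul_real (hlip _) hχf
  have hsupp : tsupport ((ω : Set Plane).indicator g) ⊆ ω := by
    intro y hy
    by_contra hyω
    have hsub : Function.support ((ω : Set Plane).indicator g) ⊆ ω := by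
      intro z hz
      by_contra h
      exact hz (indicator_of_notMem h _)
    have hfr : y ∈ frontier (ω : Set Plane) := by
      rw [ω.isOpen.frontier_eq]
      exact ⟨closure_mono hsub hy, hyω⟩
    have hev : ∀ᶠ z in 𝓝 y, (ω : Set Plane).indicator g z = 0 := by
      by_cases hyΓ : y ∈ Γ
      · have := hΓ.filter_mono (nhds_le_nhdsSet hyΓ)
        filter_upwards [this] with z hz
        by_cases hzω : z ∈ ω
        · rw [indicator_of_mem (by exact hzω), hg]
          simp only [hz hzω, mul_zero]
        · exact indicator_of_notMem hzω _
      · have h0 : χ y < ε := by rw [hχ y hfr hyΓ]; exact hε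
        filter_upwards [χ.continuous.continuousAt.eventually (gt_mem_nhds h0)] with z hz
        have : g z = 0 := by
          rw [hg]
          simp only [Cutoff.trunc_apply, max_eq_right (by linarith : χ z - ε ≤ 0), zero_mul]
        by_cases hzω : z ∈ (ω : Set Plane)
        · rw [indicator_of_mem hzω, this]
        · exact indicator_of_notMem hzω _
    exact (notMem_tsupport_iff_eventuallyEq.2 hev) hy
  have hc : HasCompactSupport ((ω : Set Plane).indicator g) :=
    Metric.isCompact_of_isClosed_isBounded (isClosed_tsupport _) (hω.subset hsupp)
  exact ⟨(ω : Set Plane).indicator g, exists_lipschitzWith_of_hasCompactSupport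
    (locallyLipschitz_indicator ω.isOpen hgl hsupp) hc, hc, hsupp,
    ((hu.mul ω.isOpen hf χ).mul ω.isOpen hχf (χ.trunc ε hε.le)).congr ω.isOpen
      fun x hx => (indicator_of_mem hx g).symm⟩

/-- By density it suffices to treat locally Lipschitz functions that vanish near `Γ`, for which the
truncated products have compact support and converge as `ε → 0`. -/
theorem mul_mul_mem_h10 {Γ : Set Plane} {ω : TopologicalSpace.Opens Plane}
    (hω : Bornology.IsBounded (ω : Set Plane)) {χ : Cutoff}
    (hχ : ∀ y ∈ frontier (ω : Set Plane), y ∉ Γ → χ y = 0) {u : Tuple m} (hu : u ∈ H1 F Γ ω) :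
    mul F χ (mul F χ u) ∈ h10 F ω := by
  obtain ⟨M, hM⟩ := exists_clm_mul F χ
  have hcont : Continuous fun u => mul F χ (mul F χ u) := by
    simp only [← hM]
    fun_prop
  have hcl : IsClosed {u : Tuple m | mul F χ (mul F χ u) ∈ h10 F ω} :=
    (isClosed_h10 ω).preimage hcont
  refine closure_minimal ?_ hcl hu
  rintro v ⟨f, hf, hΓ, hv⟩
  obtain ⟨C, hC⟩ := exists_norm_mul_trunc_sub_le F χ v
  have hpos (n : ℕ) : (0 : ℝ) < 1 / ((n : ℝ) + 1) := Nat.one_div_pos_of_nat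
  refine mem_closure_of_tendsto
    (f := fun n : ℕ => mul F (χ.trunc (1 / ((n : ℝ) + 1)) (hpos n).le) (mul F χ v))
    (b := Filter.atTop) ?_
    (.of_forall fun n => mul_trunc_mul_mem_compactlySupported hω hχ hf hΓ hv (hpos n))
  rw [tendsto_iff_norm_sub_tendsto_zero]
  refine squeeze_zero (fun _ => norm_nonneg _) (fun n => hC _ (hpos n).le) ?_
  simpa using (tendsto_one_div_add_atTop_nhds_zero_nat (𝕜 := ℝ)).mul_const C

end ZeroBoundary

/-! ### Poincaré and trace inequalities -/

section Slices

/-- Rotated coordinates along and across a fracture, in which Fubini's theorem splits plane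
integrals into integrals over normal lines. -/
theorem exists_unit_normal {d : Plane} (hd : ‖d‖ = 1) : ∃ n : Plane, ‖n‖ = 1 ∧ inner ℝ d n = 0 ∧
    ∀ p : Plane, MeasurePreserving (fun z : ℝ × ℝ => p + z.1 • d + z.2 • n) volume volume := by
  have hd2 : d 0 ^ 2 + d 1 ^ 2 = 1 := by
    have := EuclideanSpace.real_norm_sq_eq d
    rw [hd, Fin.sum_univ_two] at this
    linarith
  set n : Plane := !₂[-d 1, d 0] with hn
  have hn1 : ‖n‖ = 1 := by
    have := EuclideanSpace.real_norm_sq_eq n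
    rw [Fin.sum_univ_two] at this
    simp only [hn, PiLp.toLp_apply, Matrix.cons_val_zero, Matrix.cons_val_one] at this
    have h1 : ‖n‖ ^ 2 = 1 := by rw [hn, this]; linarith
    exact (pow_eq_one_iff_of_nonneg (norm_nonneg _) two_ne_zero).1 h1
  have hdn : inner ℝ d n = 0 := by
    simp [hn, PiLp.inner_apply, Fin.sum_univ_two]
    ring
  refine ⟨n, hn1, hdn, fun p => ?_⟩
  have hon : Orthonormal ℝ ![d, n] := by
    rw [orthonormal_iff_ite]
    simp [Fin.forall_fin_two, hd, hn1, hdn, real_inner_comm d n]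
  have hcard : Fintype.card (Fin 2) = Module.finrank ℝ Plane := by simp
  have hsp : ⊤ ≤ Submodule.span ℝ (range ![d, n]) :=
    (hon.linearIndependent.span_eq_top_of_card_eq_finrank hcard).ge
  let b := OrthonormalBasis.mk hon hsp
  have h1 := (volume_preserving_finTwoArrow ℝ).symm
  have h2 := PiLp.volume_preserving_toLp (Fin 2)
  have h3 := b.repr.symm.measurePreserving
  have h4 := measurePreserving_add_left (volume : Measure Plane) p
  convert! h4.comp (h3.comp (h2.comp h1)) using 1
  funext z
  simp only [Function.comp_apply]
  rw [add_assoc, ← b.sum_repr_symm]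
  simp [Fin.sum_univ_two, b]

/-- The fundamental theorem of calculus from `-L` to `r`, then Cauchy–Schwarz on an interval of
length `2L`. -/
theorem enorm_sq_le_lintegral_deriv {g : ℝ → ℝ} {K : ℝ≥0} (hg : LipschitzWith K g) {L r : ℝ}
    (h0 : g (-L) = 0) (hr : r ∈ Icc (-L) L) :
    ‖g r‖ₑ ^ 2 ≤ ENNReal.ofReal (2 * L) * ∫⁻ x, ‖deriv g x‖ₑ ^ 2 := by
  have hint : ∫ x in (-L)..r, deriv g x = g r := by
    rw [(hg.lipschitzOnWith (s := uIcc (-L) r)).absolutelyContinuousOnInterval.integral_deriv_eq_sub,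
      h0, sub_zero]
  have h1 : ‖g r‖ₑ ≤ ∫⁻ x in Ioc (-L) L, ‖deriv g x‖ₑ := by
    rw [← hint, intervalIntegral.integral_of_le hr.1]
    exact (enorm_integral_le_lintegral_enorm _).trans
      (lintegral_mono_set (Ioc_subset_Ioc_right hr.2))
  have hm : Measurable (deriv g) := measurable_deriv g
  have h2 := ENNReal.lintegral_mul_le_Lp_mul_Lq (volume.restrict (Ioc (-L) L))
    Real.HolderConjugate.two_two (f := fun _ => 1) (g := fun x => ‖deriv g x‖ₑ)
    aemeasurable_const hm.enorm.aemeasurable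
  simp only [Pi.mul_apply, one_mul, ENNReal.one_rpow, lintegral_const, Measure.restrict_apply_univ,
    Real.volume_Ioc, sub_neg_eq_add] at h2
  have hsq (a : ℝ≥0∞) : (a ^ (1 / 2 : ℝ)) ^ 2 = a := by
    rw [← ENNReal.rpow_natCast, ← ENNReal.rpow_mul]
    simp
  calc ‖g r‖ₑ ^ 2 ≤ (ENNReal.ofReal (L + L) ^ (1 / 2 : ℝ) *
        (∫⁻ x in Ioc (-L) L, ‖deriv g x‖ₑ ^ (2 : ℝ)) ^ (1 / 2 : ℝ)) ^ 2 := by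
        gcongr
        exact h1.trans h2
    _ = ENNReal.ofReal (2 * L) * ∫⁻ x in Ioc (-L) L, ‖deriv g x‖ₑ ^ 2 := by
        rw [mul_pow, hsq, hsq, two_mul]
        simp only [ENNReal.rpow_two]
    _ ≤ _ := by
        gcongr
        exact Measure.restrict_le_self

variable {f : Plane → ℝ} {K : ℝ≥0} {R : ℝ} {d n : Plane}

theorem measurable_enorm_gradient_sq (f : Plane → ℝ) : Measurable fun x => ‖gradient f x‖ₑ ^ 2 :=
  (((InnerProductSpace.toDual ℝ Plane).symm.continuous.measurable).comp
    (measurable_fderiv ℝ f)).enorm.pow_const 2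

/-- The normal component of the point is `⟪p, n⟫ + r`, so its norm is at least `|r| - ‖p‖ ≥ R + 1`.
-/
theorem eq_zero_of_le_abs_normal (hR : ∀ x, R < ‖x‖ → f x = 0) (hn : ‖n‖ = 1)
    (hdn : inner ℝ d n = 0) (p : Plane) {s r : ℝ} (hr : R + ‖p‖ + 1 ≤ |r|) :
    f (p + s • d + r • n) = 0 := by
  refine hR _ ?_
  have h1 : inner ℝ (p + s • d + r • n) n = inner ℝ p n + r := by
    rw [inner_add_left, inner_add_left, real_inner_smul_left, real_inner_smul_left, hdn,
      real_inner_self_eq_norm_sq, hn]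
    ring
  have h2 : |inner ℝ p n + r| ≤ ‖p + s • d + r • n‖ := by
    have := abs_real_inner_le_norm (p + s • d + r • n) n
    rwa [h1, hn, mul_one] at this
  have h3 : |inner ℝ p n| ≤ ‖p‖ := by
    have := abs_real_inner_le_norm p n
    rwa [hn, mul_one] at this
  have h4 : |r| ≤ |inner ℝ p n + r| + |inner ℝ p n| := by
    have := abs_sub (inner ℝ p n + r) (inner ℝ p n)
    rwa [add_sub_cancel_left] at this
  linarith

/-- The `L²` norm on a line is controlled by the Dirichlet integral. -/
theorem lintegral_line_le (hf : LipschitzWith K f) (hR : ∀ x, R < ‖x‖ → f x = 0)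
    (hn : ‖n‖ = 1) (hdn : inner ℝ d n = 0) (p : Plane)
    (hΨ : MeasurePreserving (fun z : ℝ × ℝ => p + z.1 • d + z.2 • n) volume volume)
    {r : ℝ} (hr : r ∈ Icc (-(R + ‖p‖ + 1)) (R + ‖p‖ + 1)) :
    ∫⁻ s : ℝ, ‖f (p + s • d + r • n)‖ₑ ^ 2 ≤
      ENNReal.ofReal (2 * (R + ‖p‖ + 1)) * ∫⁻ x, ‖gradient f x‖ₑ ^ 2 := by
  set L := R + ‖p‖ + 1 with hL
  have hL0 : 0 ≤ L := by linarith [hr.1, hr.2]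
  -- By Rademacher and Fubini, on almost every normal line `f` is differentiable at almost every
  -- point, so its derivative along that line is there a component of the gradient.
  have hae : ∀ᵐ z : ℝ × ℝ, DifferentiableAt ℝ f (p + z.1 • d + z.2 • n) :=
    hΨ.quasiMeasurePreserving.ae hf.ae_differentiableAt
  have hae' := Measure.ae_ae_of_ae_prod hae
  have hm := measurable_enorm_gradient_sq f
  calc ∫⁻ s : ℝ, ‖f (p + s • d + r • n)‖ₑ ^ 2
      ≤ ∫⁻ s : ℝ, ENNReal.ofReal (2 * L) * ∫⁻ r : ℝ, ‖gradient f (p + s • d + r • n)‖ₑ ^ 2 := by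
        refine lintegral_mono_ae ?_
        filter_upwards [hae'] with s hs
        have hlip : LipschitzWith (K * 1) fun r : ℝ => f (p + s • d + r • n) := by
          refine hf.comp (LipschitzWith.of_dist_le_mul fun a b => ?_)
          simp [dist_eq_norm, ← sub_smul, norm_smul, hn]
        refine (enorm_sq_le_lintegral_deriv hlip (L := L) ?_ hr).trans ?_
        · refine eq_zero_of_le_abs_normal hR hn hdn p ?_
          rw [abs_neg, abs_of_nonneg hL0]
        · gcongr ENNReal.ofReal (2 * L) * ?_
          refine lintegral_mono_ae ?_
          filter_upwards [hs] with r hr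
          gcongr ?_ ^ 2
          have h1 : HasDerivAt (fun r : ℝ => p + s • d + r • n) n r := by
            simpa using ((hasDerivAt_id r).smul_const n).const_add (p + s • d)
          have h2 := hr.hasFDerivAt.comp_hasDerivAt r h1
          rw [show (fun r : ℝ => f (p + s • d + r • n)) = f ∘ fun r => p + s • d + r • n from rfl,
            h2.deriv]
          rw [← ofReal_norm, ← ofReal_norm, gradient, LinearIsometryEquiv.norm_map]
          refine ENNReal.ofReal_le_ofReal ?_
          simpa [hn] using (fderiv ℝ f (p + s • d + r • n)).le_opNorm n
    _ = ENNReal.ofReal (2 * L) * ∫⁻ s : ℝ, ∫⁻ r : ℝ, ‖gradient f (p + s • d + r • n)‖ₑ ^ 2 := by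
        rw [lintegral_const_mul' _ _ ENNReal.ofReal_ne_top]
    _ = ENNReal.ofReal (2 * L) * ∫⁻ x, ‖gradient f x‖ₑ ^ 2 := by
        rw [← hΨ.lintegral_comp hm, Measure.volume_eq_prod,
          lintegral_prod (fun z : ℝ × ℝ => ‖gradient f (p + z.1 • d + z.2 • n)‖ₑ ^ 2)
            (hm.comp hΨ.measurable).aemeasurable]

/-- The estimate on a line is integrated over the offsets `r` with `|r| ≤ R + 1`; their total length
supplies the second factor `2(R + 1)`. -/
theorem lintegral_le_lintegral_gradient (hf : LipschitzWith K f) (hR0 : 0 ≤ R)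
    (hR : ∀ x, R < ‖x‖ → f x = 0) :
    ∫⁻ x, ‖f x‖ₑ ^ 2 ≤ ENNReal.ofReal ((2 * (R + 1)) ^ 2) * ∫⁻ x, ‖gradient f x‖ₑ ^ 2 := by
  obtain ⟨n, hn, hdn, hΨ⟩ := exists_unit_normal (d := !₂[1, 0]) (by simp [EuclideanSpace.norm_eq])
  have hm : Measurable fun x => ‖f x‖ₑ ^ 2 := hf.continuous.measurable.enorm.pow_const 2
  rw [← (hΨ 0).lintegral_comp hm, Measure.volume_eq_prod,
    lintegral_prod_symm (fun z : ℝ × ℝ => ‖f (0 + z.1 • !₂[(1 : ℝ), 0] + z.2 • n)‖ₑ ^ 2)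
      (hm.comp (hΨ 0).measurable).aemeasurable]
  calc ∫⁻ r : ℝ, ∫⁻ s : ℝ, ‖f ((0 : Plane) + s • !₂[(1 : ℝ), 0] + r • n)‖ₑ ^ 2
      ≤ ∫⁻ r : ℝ, (Icc (-(R + 1)) (R + 1)).indicator
          (fun _ => ENNReal.ofReal (2 * (R + 1)) * ∫⁻ x, ‖gradient f x‖ₑ ^ 2) r := by
        refine lintegral_mono fun r => ?_
        by_cases hr : r ∈ Icc (-(R + 1)) (R + 1)
        · rw [indicator_of_mem hr]
          have := lintegral_line_le hf hR hn hdn 0 (hΨ 0) (r := r) (by simpa using hr)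
          simpa using this
        · rw [indicator_of_notMem hr]
          have hr' : R + 1 ≤ |r| := by
            rw [mem_Icc, ← abs_le] at hr
            exact (not_le.1 hr).le
          refine le_of_eq ((lintegral_congr fun s => ?_).trans lintegral_zero)
          rw [eq_zero_of_le_abs_normal hR hn hdn 0 (by simpa)]
          simp
    _ = _ := by
        rw [lintegral_indicator_const measurableSet_Icc, Real.volume_Icc, mul_right_comm,
          ← ENNReal.ofReal_mul (by positivity)]
        congr 2
        ring

end Slices

/-! ### Coercivity -/

theorem ofReal_norm_sq {α V : Type*} [MeasurableSpace α] {μ : Measure α} [NormedAddCommGroup V]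
    (u : Lp V 2 μ) : ENNReal.ofReal (‖u‖ ^ 2) = ∫⁻ x, ‖u x‖ₑ ^ 2 ∂μ := by
  have h := eLpNorm_nnreal_pow_eq_lintegral (f := u) (μ := μ) (p := 2) two_ne_zero
  rw [ENNReal.ofReal_pow (norm_nonneg _), Lp.norm_def, ENNReal.ofReal_toReal (Lp.eLpNorm_ne_top u)]
  simpa using h

theorem norm_sq_le_of_lintegral_le {α β V W : Type*} [MeasurableSpace α] {μ : Measure α}
    [MeasurableSpace β] {ν : Measure β} [NormedAddCommGroup V] [NormedAddCommGroup W]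
    {u : Lp V 2 μ} {v : Lp W 2 ν} {C : ℝ} (hC : 0 ≤ C)
    (h : ∫⁻ x, ‖u x‖ₑ ^ 2 ∂μ ≤ ENNReal.ofReal C * ∫⁻ x, ‖v x‖ₑ ^ 2 ∂ν) :
    ‖u‖ ^ 2 ≤ C * ‖v‖ ^ 2 := by
  rw [← ofReal_norm_sq, ← ofReal_norm_sq, ← ENNReal.ofReal_mul hC] at h
  exact (ENNReal.ofReal_le_ofReal_iff (by positivity)).1 h

section Coercive

variable {N m : ℕ} {F : Fractures m} {ω : TopologicalSpace.Opens Plane}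

/-- Poincaré and trace inequalities. They are closed conditions, so Lipschitz functions with compact
support suffice; `C` is the Poincaré constant plus the trace constants of all fractures. -/
theorem exists_norm_sq_le_of_mem_h10 (F : Fractures m)
    (hω : Bornology.IsBounded (ω : Set Plane)) :
    ∃ C : ℝ, 0 ≤ C ∧ ∀ u ∈ h10 F ω, ‖u.1‖ ^ 2 ≤ C * ‖u.2.1‖ ^ 2 ∧
      ∀ l, ‖u.2.2.1 l‖ ^ 2 ≤ C * ‖u.2.1‖ ^ 2 := by
  obtain ⟨R, hR0, hR⟩ : ∃ R : ℝ, 0 ≤ R ∧ (ω : Set Plane) ⊆ Metric.closedBall 0 R := by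
    obtain ⟨R, hR⟩ := hω.subset_closedBall 0
    exact ⟨max R 0, le_max_right _ _, hR.trans (Metric.closedBall_subset_closedBall (le_max_left _ _))⟩
  have hs : 0 ≤ ∑ l, 2 * (R + ‖F.base l‖ + 1) := Finset.sum_nonneg fun l _ => by positivity
  set C := (2 * (R + 1)) ^ 2 + ∑ l, 2 * (R + ‖F.base l‖ + 1) with hC
  have hC0 : 0 ≤ C := by positivity
  have hCl l : 2 * (R + ‖F.base l‖ + 1) ≤ C := by
    have := Finset.single_le_sum (f := fun l => 2 * (R + ‖F.base l‖ + 1))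
      (fun l _ => by positivity) (Finset.mem_univ l)
    have h2 := sq_nonneg (2 * (R + 1))
    linarith
  refine ⟨C, hC0, fun u hu => ?_⟩
  have hcl : IsClosed {u : Tuple m | ‖u.1‖ ^ 2 ≤ C * ‖u.2.1‖ ^ 2 ∧
      ∀ l, ‖u.2.2.1 l‖ ^ 2 ≤ C * ‖u.2.1‖ ^ 2} := by
    have h2 : Continuous fun u : Tuple m => C * ‖u.2.1‖ ^ 2 :=
      ((gradL m).continuous.norm.pow 2).const_mul C
    rw [ofPred_and, ofPred_forall]
    refine (isClosed_le ((valL m).continuous.norm.pow 2) h2).inter ?_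
    exact isClosed_iInter fun l => isClosed_le ((trL l).continuous.norm.pow 2) h2
  refine closure_minimal ?_ hcl hu
  rintro v ⟨f, ⟨K, hK⟩, -, hfω, hv⟩
  have hfR : ∀ x, R < ‖x‖ → f x = 0 := fun x hx =>
    image_eq_zero_of_notMem_tsupport fun h => by
      have : ‖x‖ ≤ R := by simpa using hR (hfω h)
      linarith
  have hg : ∫⁻ x, ‖v.2.1 x‖ₑ ^ 2 = ∫⁻ x, ‖gradient f x‖ₑ ^ 2 := by
    refine lintegral_congr_ae ?_
    filter_upwards [hv.2.1] with x hx
    rw [grad] at hx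
    rw [hx]
    by_cases h : x ∈ (ω : Set Plane)
    · rw [indicator_of_mem h]
    · have : f =ᶠ[𝓝 x] fun _ => 0 := notMem_tsupport_iff_eventuallyEq.1 fun h' => h (hfω h')
      rw [indicator_of_notMem h, this.gradient_eq, gradient_fun_const]
  refine ⟨norm_sq_le_of_lintegral_le hC0 ?_, fun l => norm_sq_le_of_lintegral_le hC0 ?_⟩
  · have h1 : ∫⁻ x, ‖v.1 x‖ₑ ^ 2 = ∫⁻ x, ‖f x‖ₑ ^ 2 := by
      refine lintegral_congr_ae ?_
      filter_upwards [hv.1] with x hx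
      rw [val] at hx
      rw [hx]
      by_cases h : x ∈ (ω : Set Plane)
      · rw [indicator_of_mem h]
      · rw [indicator_of_notMem h, image_eq_zero_of_notMem_tsupport fun h' => h (hfω h')]
    rw [h1, hg]
    refine (lintegral_le_lintegral_gradient hK hR0 hfR).trans ?_
    gcongr
    linarith
  · obtain ⟨n, hn, hdn, hΨ⟩ := exists_unit_normal (F.norm_dir l)
    have h1 : ∫⁻ s, ‖v.2.2.1 l s‖ₑ ^ 2 ≤ ∫⁻ s : ℝ, ‖f (F.base l + s • F.dir l + (0 : ℝ) • n)‖ₑ ^ 2 := by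
      refine lintegral_mono_ae ?_
      filter_upwards [hv.2.2.1 l] with s hs
      rw [tr] at hs
      rw [hs, zero_smul, add_zero]
      gcongr ?_ ^ 2
      exact enorm_indicator_le_enorm_self _ _
    refine h1.trans ?_
    rw [hg]
    -- The fracture lies on the line with normal offset `r = 0`.
    refine (lintegral_line_le hK hfR hn hdn (F.base l) (hΨ _) ⟨?_, ?_⟩).trans ?_
    · have := norm_nonneg (F.base l); linarith
    · have := norm_nonneg (F.base l); linarith
    · gcongr
      exact hCl l

/-- Ellipticity bounds the squared norms of the two derivatives by `X / b`, with `X` the energy, and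
Poincaré and trace bound those of the values by `C X / b`. Because `Vec N m` carries a maximum norm,
it suffices to bound each component. -/
theorem exists_norm_sq_le_aQForm (A : Coeffs N m) (hω : Bornology.IsBounded (ω : Set Plane)) :
    ∃ C : ℝ, 0 < C ∧ ∀ v : Vec N m, (∀ i, v i ∈ h10 F ω) → ‖v‖ ^ 2 ≤ C * aQForm F A ω v v := by
  obtain ⟨C, hC0, hC⟩ := exists_norm_sq_le_of_mem_h10 F hω
  obtain ⟨b, hb, hκ, hκf⟩ := A.elliptic
  refine ⟨(C + 1) / b, by positivity, fun v hv => ?_⟩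
  have hm := ω.isOpen.measurableSet
  have key {α V : Type} [MeasurableSpace α] {μ : Measure α} [NormedAddCommGroup V]
      [InnerProductSpace ℝ V] {W : Set α} (hW : MeasurableSet W) {g : α → ℝ} (hg : IsWeight g)
      (hbg : ∀ x, b ≤ g x) (w : Lp V 2 μ) (hw : w =ᵐ[μ] W.indicator w) :
      b * ‖w‖ ^ 2 ≤ wInt μ W g w w := by
    rw [norm_sq_eq_wInt hW w hw, wInt_self, wInt_self, ← integral_const_mul]
    have h1 : IsWeight fun _ : α => (1 : ℝ) := ⟨measurable_const, _, fun _ => le_rfl⟩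
    refine integral_mono (((h1.integrable_sq w).integrableOn).const_mul b)
      (hg.integrable_sq w).integrableOn fun x => ?_
    simp only [one_mul]
    exact mul_le_mul_of_nonneg_right (hbg x) (sq_nonneg _)
  have hs i := restr_eq_self_iff.1 (restr_eq_of_mem_h10 (hv i))
  have k1 i := key hm (A.isWeight_κ i) (hκ i) _ (hs i).2.1
  have k2 i l := key (F.measurableSet_part l ω.isOpen) (A.isWeight_κf l i) (hκf l i) _
    ((hs i).2.2.2 l)
  have hn1 i : 0 ≤ ∑ l, wInt volume (F.part l ω) (A.κf l i) ((v i).2.2.2 l) ((v i).2.2.2 l) :=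
    Finset.sum_nonneg fun l _ => wInt_self_nonneg (A.κf_nonneg l i) _
  have hn2 i := wInt_self_nonneg (μ := volume) (W := ω) (A.κ_nonneg i) (v i).2.1
  have h1 i : wInt volume (ω : Set Plane) (A.κ i) (v i).2.1 (v i).2.1 +
      ∑ l, wInt volume (F.part l ω) (A.κf l i) ((v i).2.2.2 l) ((v i).2.2.2 l) ≤
      aQForm F A ω v v := by
    rw [aQForm_eq F A _ _ hm]
    refine le_add_of_le_of_nonneg (Finset.single_le_sum (f := fun i =>
      wInt volume (ω : Set Plane) (A.κ i) (v i).2.1 (v i).2.1 +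
      ∑ l, wInt volume (F.part l ω) (A.κf l i) ((v i).2.2.2 l) ((v i).2.2.2 l))
      (fun i _ => add_nonneg (hn2 i) (hn1 i)) (Finset.mem_univ i)) ?_
    exact mul_nonneg (by norm_num) (Finset.sum_nonneg fun j _ => Finset.sum_nonneg fun i _ =>
      wInt_self_nonneg (A.Q_nonneg i j) _)
  have hX : 0 ≤ aQForm F A ω v v := aQForm_self_nonneg F A hm
  generalize aQForm F A ω v v = X at *
  have g1 i : ‖(v i).2.1‖ ^ 2 ≤ X / b := by
    rw [le_div_iff₀ hb]; linarith [k1 i, h1 i, hn1 i]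
  have g2 i l : ‖(v i).2.2.2 l‖ ^ 2 ≤ X / b := by
    have := Finset.single_le_sum (f := fun l =>
      wInt volume (F.part l ω) (A.κf l i) ((v i).2.2.2 l) ((v i).2.2.2 l))
      (fun l _ => wInt_self_nonneg (A.κf_nonneg l i) _) (Finset.mem_univ l)
    rw [le_div_iff₀ hb]; linarith [k2 i l, h1 i, hn2 i]
  have hXb : 0 ≤ X / b := by positivity
  have e : (C + 1) / b * X = C * (X / b) + X / b := by ring
  have hCX : 0 ≤ C * (X / b) := by positivity
  have fin {a : ℝ} (h : a ^ 2 ≤ C * (X / b) + X / b) : a ≤ √((C + 1) / b * X) :=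
    Real.le_sqrt_of_sq_le (e ▸ h)
  have hle : ‖v‖ ≤ √((C + 1) / b * X) := by
    have h0 := Real.sqrt_nonneg ((C + 1) / b * X)
    refine (pi_norm_le_iff_of_nonneg h0).2 fun i => norm_prod_le_iff.2 ⟨fin ?_,
      norm_prod_le_iff.2 ⟨fin ?_, norm_prod_le_iff.2
      ⟨(pi_norm_le_iff_of_nonneg h0).2 fun l => fin ?_,
        (pi_norm_le_iff_of_nonneg h0).2 fun l => fin ?_⟩⟩⟩
    · have := (hC _ (hv i)).1
      have := mul_le_mul_of_nonneg_left (g1 i) hC0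
      linarith
    · linarith [g1 i]
    · have := (hC _ (hv i)).2 l
      have := mul_le_mul_of_nonneg_left (g1 i) hC0
      linarith
    · linarith [g2 i l]
  calc ‖v‖ ^ 2 ≤ √((C + 1) / b * X) ^ 2 := by gcongr
    _ = _ := Real.sq_sqrt (by positivity)

end Coercive

/-! ### Projection with respect to a coercive form -/

section Abstract

variable {X : Type*} [NormedAddCommGroup X] [NormedSpace ℝ X]

/-- The norm of `X` need not come from an inner product, and `B` is coercive only on `H`. The direct
method applies: the solution is the minimiser of `B v v - 2 ℓ v` on `H`. -/
theorem exists_riesz_of_coercive [CompleteSpace X] (B : X →L[ℝ] X →L[ℝ] ℝ)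
    (hsymm : ∀ u v, B u v = B v u) (H : Submodule ℝ X) (hH : IsClosed (H : Set X)) {C : ℝ}
    (hC0 : 0 < C) (hC : ∀ v ∈ H, ‖v‖ ^ 2 ≤ C * B v v) (ℓ : X →L[ℝ] ℝ) :
    ∃ v ∈ H, ∀ w ∈ H, B v w = ℓ w := by
  set I : X → ℝ := fun v => B v v - 2 * ℓ v with hI
  have hIc : Continuous I := by
    have : Continuous fun v => B v v := B.continuous.clm_apply continuous_id
    fun_prop
  have hbdd : BddBelow (I '' H) := by
    -- This is the minimum over `x = ‖v‖` of `x² / C - 2‖ℓ‖x`, which bounds the functional from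
    -- below.
    refine ⟨-(C * ‖ℓ‖ ^ 2), ?_⟩
    rintro _ ⟨v, hv, rfl⟩
    have h1 := hC v hv
    have h2 : ℓ v ≤ ‖ℓ‖ * ‖v‖ := (le_abs_self _).trans (ℓ.le_opNorm v)
    have h3 : 0 ≤ (‖v‖ - C * ‖ℓ‖) ^ 2 := sq_nonneg _
    have h4 : C * -(C * ‖ℓ‖ ^ 2) ≤ C * I v := by
      simp only [hI]
      nlinarith
    exact le_of_mul_le_mul_left h4 hC0
  set μ := sInf (I '' H) with hμ
  have hle : ∀ v ∈ H, μ ≤ I v := fun v hv => csInf_le hbdd (mem_image_of_mem I hv)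
  have hex (n : ℕ) : ∃ v ∈ H, I v < μ + 1 / ((n : ℝ) + 1) := by
    obtain ⟨_, ⟨v, hv, rfl⟩, h⟩ := exists_lt_of_csInf_lt (s := I '' H)
      (b := μ + 1 / ((n : ℝ) + 1)) ⟨I 0, 0, H.zero_mem, rfl⟩
      (lt_add_of_pos_right _ Nat.one_div_pos_of_nat)
    exact ⟨v, hv, h⟩
  choose v hv hvI using hex
  -- Parallelogram identity, in which the linear terms cancel. As the midpoint has value at least
  -- `μ`, it makes minimising sequences Cauchy.
  have hpar (a b : X) : B (a - b) (a - b) = 2 * I a + 2 * I b - 4 * I ((1 / 2 : ℝ) • (a + b)) := by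
    simp only [hI, map_sub, map_add, map_smul, sub_apply, add_apply, smul_apply, smul_eq_mul,
      hsymm b a]
    ring
  have hcauchy : CauchySeq v := by
    refine cauchySeq_of_le_tendsto_0 (fun n : ℕ => √(C * (4 * (1 / ((n : ℝ) + 1))))) ?_ ?_
    · intro n k N hn hk
      rw [dist_eq_norm]
      refine Real.le_sqrt_of_sq_le ((hC _ (H.sub_mem (hv n) (hv k))).trans ?_)
      gcongr
      rw [hpar]
      have h1 := hvI n
      have h2 := hvI k
      have h3 := hle _ (H.smul_mem (1 / 2 : ℝ) (H.add_mem (hv n) (hv k)))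
      have h4 : 1 / ((n : ℝ) + 1) ≤ 1 / ((N : ℝ) + 1) := by gcongr
      have h5 : 1 / ((k : ℝ) + 1) ≤ 1 / ((N : ℝ) + 1) := by gcongr
      linarith
    · have h := (((tendsto_one_div_add_atTop_nhds_zero_nat (𝕜 := ℝ)).const_mul 4).const_mul C).sqrt
      simpa using h
  obtain ⟨x, hx⟩ := cauchySeq_tendsto_of_complete hcauchy
  have hxH : x ∈ H := hH.mem_of_tendsto hx (.of_forall hv)
  have hIx : I x ≤ μ := by
    refine le_of_tendsto_of_tendsto' ((hIc.tendsto x).comp hx)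
      (b := Filter.atTop) (f := I ∘ v) (g := fun n : ℕ => μ + 1 / ((n : ℝ) + 1)) ?_
      fun n => (hvI n).le
    simpa using (tendsto_one_div_add_atTop_nhds_zero_nat (𝕜 := ℝ)).const_add μ
  refine ⟨x, hxH, fun w hw => ?_⟩
  -- A quadratic in `t` that is nonnegative and has zero constant term has zero linear term, as its
  -- discriminant shows.
  have hvar (t : ℝ) : 0 ≤ B w w * (t * t) + 2 * (B x w - ℓ w) * t + 0 := by
    have h := hle _ (H.add_mem hxH (H.smul_mem t hw))
    have h2 : I (x + t • w) = I x + (B w w * (t * t) + 2 * (B x w - ℓ w) * t) := by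
      simp only [hI, map_add, map_smul, add_apply, smul_apply, smul_eq_mul, hsymm w x]
      ring
    linarith
  have hd := discrim_le_zero hvar
  rw [discrim] at hd
  have : B x w - ℓ w = 0 := by nlinarith
  linarith

/-- The projection onto a closed subspace on which a symmetric form is coercive. -/
theorem exists_coercive_projection [CompleteSpace X] (B : X →L[ℝ] X →L[ℝ] ℝ)
    (hsymm : ∀ u v, B u v = B v u) (H : Submodule ℝ X) (hH : IsClosed (H : Set X)) {C : ℝ}
    (hC0 : 0 < C) (hC : ∀ v ∈ H, ‖v‖ ^ 2 ≤ C * B v v) :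
    ∃ Q : X →L[ℝ] X, ∀ u, Q u ∈ H ∧ (∀ v ∈ H, B (Q u) v = B u v) ∧
      ∀ w ∈ H, (∀ v ∈ H, B w v = B u v) → Q u = w := by
  choose q hqH hq using fun u => exists_riesz_of_coercive B hsymm H hH hC0 hC (B u)
  have huniq (u w : X) (hw : w ∈ H) (h : ∀ v ∈ H, B w v = B u v) : q u = w := by
    have hm := H.sub_mem (hqH u) hw
    have h1 := hC _ hm
    have h0 : B (q u - w) (q u - w) = B (q u) (q u - w) - B w (q u - w) := by
      rw [map_sub B, sub_apply]
    rw [h0, hq u _ hm, h _ hm, sub_self, mul_zero] at h1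
    have h2 : ‖q u - w‖ = 0 := pow_eq_zero_iff two_ne_zero |>.1 (le_antisymm h1 (sq_nonneg _))
    exact sub_eq_zero.1 (norm_eq_zero.1 h2)
  have hbound (u : X) : ‖q u‖ ≤ C * ‖B‖ * ‖u‖ := by
    have h1 := hC _ (hqH u)
    rw [hq u _ (hqH u)] at h1
    have h2 : B u (q u) ≤ ‖B‖ * ‖u‖ * ‖q u‖ := (le_abs_self _).trans (B.le_opNorm₂ u (q u))
    rcases (norm_nonneg (q u)).eq_or_lt with h0 | h0
    · rw [← h0]
      positivity
    · refine le_of_mul_le_mul_right ?_ h0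
      nlinarith
  refine ⟨LinearMap.mkContinuous ⟨⟨q, fun u v => ?_⟩, fun r u => ?_⟩ (C * ‖B‖) hbound,
    fun u => ⟨hqH u, hq u, huniq u⟩⟩
  · refine huniq _ _ (H.add_mem (hqH u) (hqH v)) fun w hw => ?_
    simp only [map_add, add_apply, hq _ _ hw]
  · refine huniq _ _ (H.smul_mem r (hqH u)) fun w hw => ?_
    simp only [map_smul, smul_apply, RingHom.id_apply, hq _ _ hw]

/-- The component of `R u` that is orthogonal to a subspace on which the form is coercive. -/
theorem exists_orthogonal_component [CompleteSpace X] (B : X →L[ℝ] X →L[ℝ] ℝ)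
    (hsymm : ∀ u v, B u v = B v u) (hnonneg : ∀ u, 0 ≤ B u u) (H : Submodule ℝ X)
    (hH : IsClosed (H : Set X)) {C : ℝ} (hC0 : 0 < C) (hC : ∀ v ∈ H, ‖v‖ ^ 2 ≤ C * B v v)
    (R : X →L[ℝ] X) :
    ∃ P : X →L[ℝ] X, (∀ u ψ, R u - ψ ∈ H → (∀ v ∈ H, B ψ v = 0) → P u = ψ) ∧
      ∀ u, B (P u) (P u) ≤ B (R u) (R u) := by
  obtain ⟨Q, hQ⟩ := exists_coercive_projection B hsymm H hH hC0 hC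
  refine ⟨R - Q.comp R, fun u ψ h1 hψ => ?_, fun u => ?_⟩
  · have h2 : Q (R u) = R u - ψ := by
      refine (hQ (R u)).2.2 _ h1 fun v hv => ?_
      rw [map_sub, sub_apply, hψ v hv, sub_zero]
    rw [sub_apply, ContinuousLinearMap.comp_apply, h2, sub_sub_cancel]
  · rw [sub_apply, ContinuousLinearMap.comp_apply]
    obtain ⟨hq, hq2, -⟩ := hQ (R u)
    have h3 := hq2 _ hq
    have h4 := hnonneg (Q (R u))
    -- Pythagoras: subtracting the projection lowers the energy by the energy of the projection.
    have h5 : B (R u - Q (R u)) (R u - Q (R u)) =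
        B (R u) (R u) - B (R u) (Q (R u)) - (B (Q (R u)) (R u) - B (Q (R u)) (Q (R u))) := by
      simp only [map_sub, sub_apply]
      ring
    rw [h5, hsymm (Q (R u)) (R u)]
    linarith

/-- If all integrals of `g` over initial segments lie in a closed subspace, so does `g`. -/
theorem ae_mem_of_integral_mem [CompleteSpace X] (S : Submodule ℝ X) (hS : IsClosed (S : Set X))
    {g : ℝ → X} {T : ℝ} (hT : 0 ≤ T) (hg : IntervalIntegrable g volume 0 T)
    (h : ∀ t ∈ Icc 0 T, ∫ s in (0 : ℝ)..t, g s ∈ S) :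
    ∀ᵐ t ∂volume.restrict (Ioc 0 T), g t ∈ S := by
  filter_upwards [ae_restrict_mem measurableSet_Ioc,
    ae_restrict_of_ae (IntervalIntegrable.ae_hasDerivAt_integral hg)] with t ht hd
  have hd' := hd (by rw [uIcc_of_le hT]; exact Ioc_subset_Icc_self ht) 0 left_mem_uIcc
  -- At a Lebesgue point `g t` is a limit of difference quotients of the primitive, which lie in
  -- `S`. Quotients from the left stay in `[0, T]` also when `t = T`.
  refine hS.mem_of_tendsto ((hasDerivWithinAt_iff_tendsto_slope' self_notMem_Iio).1
    (hd'.hasDerivWithinAt (s := Iio t))) ?_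
  filter_upwards [Ioo_mem_nhdsLT ht.1] with s hs
  rw [slope_def_module]
  exact S.smul_mem _ (S.sub_mem (h s ⟨hs.1.le, hs.2.le.trans ht.2⟩) (h t ⟨ht.1.le, ht.2⟩))

/-! ### Spectral truncation -/

/-- The error of the truncation of an eigenfunction expansion after `L` terms. -/
theorem exists_truncation (Bs : X →L[ℝ] X →L[ℝ] ℝ) (φ : ℕ → X) (L : ℕ) :
    ∃ Z : X →L[ℝ] X, ∀ ψ, Z ψ = ∑ k ∈ Finset.range L, Bs ψ (φ k) • φ k - ψ :=
  ⟨∑ k ∈ Finset.range L, (Bs.flip (φ k)).smulRight (φ k) - .id ℝ X, fun ψ => by simp⟩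

/-- The coefficients of a convergent expansion are forced by orthonormality, hence are continuous
linear in `ψ`; this makes truncation a bounded operator. -/
theorem coeff_eq_of_hasSum {Bs : X →L[ℝ] X →L[ℝ] ℝ} {φ : ℕ → X}
    (horth : ∀ k l, Bs (φ k) (φ l) = if k = l then 1 else 0) {a : ℕ → ℝ} {ψ : X}
    (h : HasSum (fun k => a k • φ k) ψ) (l : ℕ) : Bs ψ (φ l) = a l := by
  have h1 := h.mapL (Bs.flip (φ l))
  simp only [ContinuousLinearMap.flip_apply, map_smul, smul_eq_mul, horth, mul_ite,
    mul_one, mul_zero] at h1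
  have h2 := h1.unique (hasSum_single l fun k hk => if_neg hk)
  rwa [if_pos rfl] at h2

/-- Both sides are continuous in `ψ`, so finite combinations suffice. There both forms are diagonal,
and on the tail `k ≥ L` each eigenvalue is at least `lam L`. -/
theorem spectral_truncation_le {Bs Ba : X →L[ℝ] X →L[ℝ] ℝ} {φ : ℕ → X} {lam : ℕ → ℝ}
    (horth : ∀ k l, Bs (φ k) (φ l) = if k = l then 1 else 0)
    (heig : ∀ k l, Ba (φ k) (φ l) = if k = l then lam k else 0)
    (hmono : Monotone lam) (hnonneg : ∀ u, 0 ≤ Ba u u) (L : ℕ) {ψ : X}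
    (hψ : ψ ∈ closure (Submodule.span ℝ (range φ) : Set X)) :
    lam L * Bs (∑ k ∈ Finset.range L, Bs ψ (φ k) • φ k - ψ)
      (∑ k ∈ Finset.range L, Bs ψ (φ k) • φ k - ψ) ≤ Ba ψ ψ := by
  obtain ⟨Z, hZ⟩ := exists_truncation Bs φ L
  simp only [← hZ]
  have hcl : IsClosed {ψ : X | lam L * Bs (Z ψ) (Z ψ) ≤ Ba ψ ψ} := by
    refine isClosed_le (continuous_const.mul ?_) (Ba.continuous.clm_apply continuous_id)
    exact (Bs.continuous.comp Z.continuous).clm_apply Z.continuous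
  refine closure_minimal ?_ hcl hψ
  intro ψ hψ
  obtain ⟨a, rfl⟩ := (Finsupp.mem_span_range_iff_exists_finsupp).1 hψ
  rw [mem_ofPred_eq, hZ]
  have hlam k : 0 ≤ lam k := by
    have := hnonneg (φ k)
    rwa [heig, if_pos rfl] at this
  have hcoef l : Bs (a.sum fun k r => r • φ k) (φ l) = a l := by
    simp only [Finsupp.sum, map_sum, sum_apply, map_smul, smul_apply, smul_eq_mul, horth, mul_ite,
      mul_one, mul_zero, Finset.sum_ite_eq', Finsupp.mem_support_iff]
    by_cases h : a l = 0 <;> simp [h]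
  simp only [hcoef]
  obtain ⟨n, hLn, hn⟩ : ∃ n, L ≤ n ∧ a.support ⊆ Finset.range n := by
    refine ⟨max L (a.support.sup id + 1), le_max_left _ _, fun k hk => ?_⟩
    rw [Finset.mem_range]
    exact lt_max_of_lt_right (Nat.lt_succ_of_le (Finset.le_sup (f := id) hk))
  have hsum : (a.sum fun k r => r • φ k) = ∑ k ∈ Finset.range n, a k • φ k :=
    Finsupp.sum_of_support_subset _ hn _ fun _ _ => zero_smul _ _
  have herr : ∑ k ∈ Finset.range L, a k • φ k - ∑ k ∈ Finset.range n, a k • φ k =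
      -∑ k ∈ Finset.Ico L n, a k • φ k := by
    rw [← Finset.sum_range_add_sum_Ico _ hLn, sub_add_cancel_left]
  have hdiag (B : X →L[ℝ] X →L[ℝ] ℝ) (d : ℕ → ℝ)
      (hB : ∀ k l, B (φ k) (φ l) = if k = l then d k else 0) (s : Finset ℕ) :
      B (∑ k ∈ s, a k • φ k) (∑ k ∈ s, a k • φ k) = ∑ k ∈ s, d k * a k ^ 2 := by
    simp only [map_sum, sum_apply, map_smul, smul_apply, smul_eq_mul, hB, mul_ite, mul_zero]
    refine Finset.sum_congr rfl fun k hk => ?_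
    simp only [Finset.sum_ite_eq', hk, if_true]
    ring
  rw [hsum, herr, map_neg Bs, neg_apply, map_neg, neg_neg, hdiag Bs (fun _ => 1) horth,
    hdiag Ba lam heig, Finset.mul_sum, ← Finset.sum_range_add_sum_Ico _ hLn]
  -- The first `L` terms of the energy are nonnegative and are dropped.
  refine le_add_of_nonneg_of_le (Finset.sum_nonneg fun k _ => mul_nonneg (hlam k) (sq_nonneg _))
    (Finset.sum_le_sum fun k hk => ?_)
  rw [one_mul]
  exact mul_le_mul_of_nonneg_right (hmono (Finset.mem_Ico.1 hk).1) (sq_nonneg _)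

theorem map_mem_of_mem_topologicalClosure_span {Y ι : Type*} [NormedAddCommGroup Y]
    [NormedSpace ℝ Y] {φ : ι → X} (f : X →L[ℝ] Y) (H : Submodule ℝ Y) (hH : IsClosed (H : Set Y))
    (h : ∀ k, f (φ k) ∈ H) {e : X} (he : e ∈ (Submodule.span ℝ (range φ)).topologicalClosure) :
    f e ∈ H := by
  have hle : (Submodule.span ℝ (range φ)).topologicalClosure ≤ H.comap f.toLinearMap := by
    refine Submodule.topologicalClosure_minimal _ (Submodule.span_le.2 ?_)
      (hH.preimage f.continuous)
    rintro _ ⟨k, rfl⟩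
    exact h k
  exact hle he

theorem map_eq_of_mem_topologicalClosure_span {Y ι : Type*} [NormedAddCommGroup Y]
    [NormedSpace ℝ Y] {φ : ι → X} (f g : X →L[ℝ] Y) (h : ∀ k, f (φ k) = g (φ k)) {e : X}
    (he : e ∈ (Submodule.span ℝ (range φ)).topologicalClosure) : f e = g e :=
  sub_eq_zero.1 <| (Submodule.mem_bot ℝ).1 <| map_mem_of_mem_topologicalClosure_span (f - g) ⊥
    (by simp) (fun k => by simp [h]) he

theorem exists_truncation_operator {Bs Ba : X →L[ℝ] X →L[ℝ] ℝ} {φ : ℕ → X} {lam : ℕ → ℝ}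
    (horth : ∀ k l, Bs (φ k) (φ l) = if k = l then 1 else 0)
    (heig : ∀ k l, Ba (φ k) (φ l) = if k = l then lam k else 0)
    (hmono : Monotone lam) (hnonneg : ∀ u, 0 ≤ Ba u u) (L : ℕ) (M : X →L[ℝ] X) :
    ∃ Z : X →L[ℝ] X,
      (∀ (a : ℕ → ℝ) (ψ : X), HasSum (fun k => a k • φ k) ψ →
        M (Z ψ) = ∑ k ∈ Finset.range L, a k • M (φ k) - M ψ) ∧
      ∀ ψ ∈ (Submodule.span ℝ (range φ)).topologicalClosure,
        Z ψ ∈ (Submodule.span ℝ (range φ)).topologicalClosure ∧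
        lam L * Bs (Z ψ) (Z ψ) ≤ Ba ψ ψ := by
  obtain ⟨Z, hZ⟩ := exists_truncation Bs φ L
  refine ⟨Z, fun a ψ ha => ?_, fun ψ hψ => ⟨?_, ?_⟩⟩
  · rw [hZ, map_sub, map_sum]
    simp only [map_smul, coeff_eq_of_hasSum horth ha]
  · have hspan k : φ k ∈ (Submodule.span ℝ (range φ)).topologicalClosure :=
      Submodule.le_topologicalClosure _ (Submodule.subset_span (mem_range_self k))
    rw [hZ]
    exact Submodule.sub_mem _ (Submodule.sum_mem _ fun k _ => Submodule.smul_mem _ _ (hspan k)) hψ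
  · rw [hZ]
    exact spectral_truncation_le horth heig hmono hnonneg L hψ

end Abstract

/-! ### The local error operator -/

section Local

variable {N m : ℕ} {F : Fractures m} {A : Coeffs N m} {Γ : Set Plane}
  {ω : TopologicalSpace.Opens Plane} {χ : Cutoff} {φ : ℕ → Vec N m} {lam : ℕ → ℝ}

/-- The functions with `N` components and zero boundary values. -/
def vh10 (N : ℕ) (F : Fractures m) (ω : TopologicalSpace.Opens Plane) : Submodule ℝ (Vec N m) :=
  Submodule.pi univ fun _ => h10 F ω

theorem mem_vh10 {v : Vec N m} : v ∈ vh10 N F ω ↔ ∀ i, v i ∈ h10 F ω := by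
  simp [vh10, Submodule.mem_pi]

theorem isClosed_vh10 : IsClosed (vh10 N F ω : Set (Vec N m)) := by
  have : (vh10 N F ω : Set (Vec N m)) = univ.pi fun _ => (h10 F ω : Set (Tuple m)) := rfl
  rw [this]
  exact isClosed_set_pi fun _ _ => isClosed_h10 ω

/-- The restriction minus the component with zero boundary values: the snapshot with the boundary
values of a given function. -/
theorem exists_snapshot_projection (F : Fractures m) (A : Coeffs N m) (Γ : Set Plane)
    (hω : Bornology.IsBounded (ω : Set Plane)) :
    ∃ P : Vec N m →L[ℝ] Vec N m, (∀ u ψ, IsLocalProjection F A Γ ω u ψ → P u = ψ) ∧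
      ∀ u, aQForm F A ω (P u) (P u) ≤ aQForm F A ω u u := by
  have hm := ω.isOpen.measurableSet
  obtain ⟨B, hB⟩ := isBilin_aQForm F A ω.isOpen
  obtain ⟨R, hR⟩ := exists_clm_vrestr (N := N) F ω
  obtain ⟨C, hC0, hC⟩ := exists_norm_sq_le_aQForm (F := F) A hω
  have hsymm u v : B u v = B v u := by rw [hB, hB, aQForm_symm F A hm]
  obtain ⟨P, hP, hP'⟩ := exists_orthogonal_component B hsymm
    (fun u => by rw [hB]; exact aQForm_self_nonneg F A hm) (vh10 N F ω) isClosed_vh10 hC0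
    (fun v hv => hB v v ▸ hC v (mem_vh10.1 hv)) R
  refine ⟨P, fun u ψ hψ => hP u ψ ?_ fun v hv => ?_, fun u => ?_⟩
  · exact mem_vh10.2 fun i => by rw [hR]; exact hψ.2 i
  · rw [hB]
    exact hψ.1.2 v (mem_vh10.1 hv)
  · have h1 := hP' u
    rw [hB, hB, hR, aQForm_vrestr_left] at h1
    -- The restriction is removed from both arguments, from the second one by symmetry.
    rwa [aQForm_symm F A (u := u) (v := vrestr F ω u) hm, aQForm_vrestr_left] at h1

variable (hφ : IsEigenSystem F A Γ ω χ φ lam) (hω : Bornology.IsBounded (ω : Set Plane))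
  (hχ : ∀ y ∈ frontier (ω : Set Plane), y ∉ Γ → χ y = 0)
include hφ

theorem IsEigenSystem.vrestr_eq {e : Vec N m}
    (he : e ∈ (Submodule.span ℝ (range φ)).topologicalClosure) : vrestr F ω e = e := by
  obtain ⟨R, hR⟩ := exists_clm_vrestr (N := N) F ω
  have h := map_eq_of_mem_topologicalClosure_span R (.id ℝ _) (fun k => ?_) he
  · rwa [hR] at h
  · rw [hR]
    exact funext fun i => restr_eq_of_mem_H1 ((hφ.mem k).1 i)

include hω hχ

/-- The Caccioppoli identity for snapshots. -/
theorem IsEigenSystem.aQForm_vmul_eq {e : Vec N m}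
    (he : e ∈ (Submodule.span ℝ (range φ)).topologicalClosure) :
    aQForm F A ω (vmul F χ e) (vmul F χ e) = sForm F A ω χ e e := by
  obtain ⟨M, hM⟩ := exists_clm_vmul (N := N) F χ
  obtain ⟨B, hB⟩ := isBilin_aQForm F A ω.isOpen
  have h3 : M.comp M e ∈ vh10 N F ω := by
    refine map_mem_of_mem_topologicalClosure_span (M.comp M) _ isClosed_vh10 (fun k => ?_) he
    rw [ContinuousLinearMap.comp_apply, hM, hM, mem_vh10]
    exact fun i => mul_mul_mem_h10 hω hχ ((hφ.mem k).1 i)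
  -- With the test function `χ²e` held fixed, the functional `a_Q(·, χ²e)` vanishes at every
  -- eigenfunction, hence on their closed span, in particular at `e`.
  have h4 : B.flip (M.comp M e) e = 0 := by
    refine map_eq_of_mem_topologicalClosure_span (B.flip (M.comp M e)) 0 (fun k => ?_) he
    rw [ContinuousLinearMap.flip_apply, hB]
    exact (hφ.mem k).2 _ (mem_vh10.1 h3)
  rw [ContinuousLinearMap.flip_apply, ContinuousLinearMap.comp_apply] at h4
  rw [hB, hM, hM] at h4
  rw [aQForm_vmul_self F A ω.isOpen, h4, zero_add]

/-- The weight `s` controls `χe` in both norms: with equality in energy by Caccioppoli, and with the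
factor `E` in the `c`-norm. As no sign of `E` is assumed, `|E|` takes its place. -/
theorem IsEigenSystem.vmul_estimates {E Λ X : ℝ} {L : ℕ} (hΛ0 : 0 ≤ Λ) (hΛ : Λ ≤ lam L)
    (h1 : ∀ i, ∀ᵐ x ∂volume.restrict (ω : Set Plane),
      A.c i x * χ x ^ 2 ≤ E * (A.κ i x * ‖gradient χ x‖ ^ 2))
    (h2 : ∀ i l, ∀ᵐ s ∂volume.restrict (F.part l ω),
      A.cf l i s * χ.onLine F l s ^ 2 ≤ E * (A.κf l i s * deriv (χ.onLine F l) s ^ 2))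
    {e : Vec N m} (he : e ∈ (Submodule.span ℝ (range φ)).topologicalClosure)
    (hs : lam L * sForm F A ω χ e e ≤ X) :
    vrestr F ω (vmul F χ e) = vmul F χ e ∧
      Λ * aQForm F A ω (vmul F χ e) (vmul F χ e) ≤ X ∧
      Λ * cForm F A ω (vmul F χ e) (vmul F χ e) ≤ |E| * X := by
  have hs0 := sForm_self_nonneg F A ω χ e
  have hs1 : Λ * sForm F A ω χ e e ≤ X := (mul_le_mul_of_nonneg_right hΛ hs0).trans hs
  refine ⟨?_, ?_, ?_⟩
  · have h := hφ.vrestr_eq he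
    exact funext fun i => restr_mul_of_restr χ (congrFun h i)
  · rwa [hφ.aQForm_vmul_eq hω hχ he]
  · have hc := cForm_vmul_self_le F A χ e h1 h2
    calc Λ * cForm F A ω (vmul F χ e) (vmul F χ e)
        ≤ Λ * (|E| * sForm F A ω χ e e) := by
          refine mul_le_mul_of_nonneg_left (hc.trans ?_) hΛ0
          exact mul_le_mul_of_nonneg_right (le_abs_self E) hs0
      _ = |E| * (Λ * sForm F A ω χ e e) := by ring
      _ ≤ _ := mul_le_mul_of_nonneg_left hs1 (abs_nonneg E)

set_option maxHeartbeats 1000000 in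
/-- The local contribution to the error as a continuous linear function of the local snapshot
projection, with its energy estimates. -/
theorem IsEigenSystem.exists_error_operator {E Λ : ℝ} {L : ℕ} (hΛ0 : 0 ≤ Λ) (hΛ : Λ ≤ lam L)
    (h1 : ∀ i, ∀ᵐ x ∂volume.restrict (ω : Set Plane),
      A.c i x * χ x ^ 2 ≤ E * (A.κ i x * ‖gradient χ x‖ ^ 2))
    (h2 : ∀ i l, ∀ᵐ s ∂volume.restrict (F.part l ω),
      A.cf l i s * χ.onLine F l s ^ 2 ≤ E * (A.κf l i s * deriv (χ.onLine F l) s ^ 2)) :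
    ∃ Z : Vec N m →L[ℝ] Vec N m,
      (∀ (a : ℕ → ℝ) (ψ : Vec N m), HasSum (fun k => a k • φ k) ψ →
        Z ψ = ∑ k ∈ Finset.range L, a k • vmul F χ (φ k) - vmul F χ ψ) ∧
      ∀ ψ ∈ (Submodule.span ℝ (range φ)).topologicalClosure,
        vrestr F ω (Z ψ) = Z ψ ∧ Λ * aQForm F A ω (Z ψ) (Z ψ) ≤ aQForm F A ω ψ ψ ∧
        Λ * cForm F A ω (Z ψ) (Z ψ) ≤ |E| * aQForm F A ω ψ ψ := by
  have hm := ω.isOpen.measurableSet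
  obtain ⟨M, hM⟩ := exists_clm_vmul (N := N) F χ
  obtain ⟨B, hB⟩ := isBilin_aQForm F A ω.isOpen
  obtain ⟨Bs, hBs⟩ := isBilin_sForm F A ω.isOpen χ
  have horth k l : Bs (φ k) (φ l) = if k = l then 1 else 0 := by
    rw [hBs]
    exact hφ.orthonormal k l
  -- Testing the eigenvalue equation with another eigenfunction shows that `a_Q` is diagonal as
  -- well.
  have heig k l : B (φ k) (φ l) = if k = l then lam k else 0 := by
    rw [hB, hφ.eigen k _ (hφ.mem l), hφ.orthonormal]
    simp
  have hnonneg u : 0 ≤ B u u := by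
    rw [hB]
    exact aQForm_self_nonneg F A hm
  obtain ⟨Z, hZ, hZ'⟩ := exists_truncation_operator horth heig hφ.mono hnonneg L M
  refine ⟨M.comp Z, fun a ψ ha => ?_, fun ψ hψ => ?_⟩
  · have h := hZ a ψ ha
    simp only [hM] at h
    rw [ContinuousLinearMap.comp_apply, hM, h]
  · obtain ⟨he, hs⟩ := hZ' ψ hψ
    rw [hBs, hB] at hs
    have hMZ : (M.comp Z) ψ = vmul F χ (Z ψ) := by rw [ContinuousLinearMap.comp_apply, hM]
    rw [hMZ]
    exact hφ.vmul_estimates hω hχ hΛ0 hΛ h1 h2 he hs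

end Local

/-! ### The coarse grid -/

namespace CoarseGrid

variable (G : CoarseGrid)

theorem isCompact_iUnion_elem : IsCompact (⋃ k, G.elem k) :=
  isCompact_iUnion fun k => (G.verts k).finite_toSet.isCompact_convexHull (𝕜 := ℝ)

/-- The domain as an open set. -/
def domOpens : TopologicalSpace.Opens Plane := ⟨G.dom, isOpen_interior⟩

theorem nbhd_le_dom (x : Plane) : G.nbhd x ≤ G.domOpens :=
  interior_mono (iUnion₂_subset fun k _ => subset_iUnion G.elem k)

theorem isBounded_nbhd (x : Plane) : Bornology.IsBounded (G.nbhd x : Set Plane) :=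
  G.isCompact_iUnion_elem.isBounded.subset
    (Subset.trans (SetLike.coe_subset_coe.2 (G.nbhd_le_dom x)) interior_subset)

/-- A point of the domain lies in some closed element `k`, and every neighbourhood that contains the
point intersects this element. -/
theorem overlapLE {D : ℕ} (hD : ∀ k, G.overlap k ≤ D) {J : Finset Plane} (hJ : J ⊆ G.nodes) :
    OverlapLE J G.domOpens G.nbhd D := by
  classical
  refine ⟨fun j _ => G.nbhd_le_dom j, fun x hx => ?_⟩
  obtain ⟨k, hk⟩ := mem_iUnion.1 (interior_subset hx)
  refine le_trans ?_ (hD k)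
  rw [overlap]
  refine (Finset.card_le_card fun j hj => ?_).trans_eq (by congr)
  rw [Finset.mem_filter] at hj ⊢
  exact ⟨hJ hj.1, x, hj.2, hk⟩

/-- A boundary point of `ω_j` is either inside the domain, where the support condition applies, or
on the boundary of the domain, where the assumption on `Γ` does. -/
theorem eq_zero_of_mem_frontier {χ : Plane → Cutoff} (hχ : IsPartitionOfUnity G χ) {j : Plane}
    (hj : j ∈ G.nodes) {Γ : Set Plane} (hΓ : ∀ y ∈ frontier G.dom, y ∉ Γ → χ j y = 0) :
    ∀ y ∈ frontier (G.nbhd j : Set Plane), y ∉ Γ → χ j y = 0 := by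
  intro y hy hyΓ
  rw [(G.nbhd j).isOpen.frontier_eq] at hy
  by_cases hyd : y ∈ G.dom
  · exact hχ.support j hj y hyd hy.2
  · refine hΓ y ?_ hyΓ
    rw [G.domOpens.isOpen.frontier_eq (s := G.dom)]
    exact ⟨closure_mono (G.nbhd_le_dom j) hy.1, hyd⟩

end CoarseGrid

/-! ### Time dependence -/

section Time

variable {V : Type*} [NormedAddCommGroup V] [NormedSpace ℝ V] {T : ℝ} {u u' : ℝ → V}

theorem IsTimeDeriv.intervalIntegrable (h : IsTimeDeriv T u u') (hT : 0 ≤ T) :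
    IntervalIntegrable u' volume 0 T := by
  rw [intervalIntegrable_iff_integrableOn_Ioc_of_le hT]
  exact h.memLp.integrable one_le_two

theorem IsTimeDeriv.continuousOn (h : IsTimeDeriv T u u') (hT : 0 ≤ T) :
    ContinuousOn u (Icc 0 T) := by
  refine ContinuousOn.congr ?_ h.eq_integral
  have := intervalIntegral.continuousOn_primitive_interval' (h.intervalIntegrable hT) left_mem_uIcc
  rw [uIcc_of_le hT] at this
  exact continuousOn_const.add this

theorem IsTimeDeriv.clm_comp [CompleteSpace V] (h : IsTimeDeriv T u u') (hT : 0 ≤ T)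
    (M : V →L[ℝ] V) {z : ℝ → V} (hz : ∀ t ∈ Icc 0 T, z t = M (u t)) :
    IsTimeDeriv T z fun t => M (u' t) where
  memLp := M.comp_memLp' h.memLp
  eq_integral t ht := by
    have hi : IntervalIntegrable u' volume 0 t := by
      refine (h.intervalIntegrable hT).mono_set ?_
      rw [uIcc_of_le hT, uIcc_of_le ht.1]
      exact Icc_subset_Icc_right ht.2
    rw [hz t ht, hz 0 ⟨le_rfl, hT⟩, h.eq_integral t ht, map_add, M.intervalIntegral_comp_comm hi]

/-- The integral of `P u'` over `[0, t]` is `P (u t) - P (u 0)`, which lies in `S`; differentiation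
then gives the claim for `P u'`. -/
theorem IsTimeDeriv.ae_mem [CompleteSpace V] (h : IsTimeDeriv T u u') (hT : 0 ≤ T)
    (P : V →L[ℝ] V) (S : Submodule ℝ V) (hS : IsClosed (S : Set V))
    (hu : ∀ t ∈ Icc 0 T, P (u t) ∈ S) :
    ∀ᵐ t ∂volume.restrict (Ioc 0 T), P (u' t) ∈ S := by
  have hP := h.clm_comp hT P (z := fun t => P (u t)) fun _ _ => rfl
  refine ae_mem_of_integral_mem S hS hT (hP.intervalIntegrable hT) fun t ht => ?_
  have := hP.eq_integral t ht
  rw [← sub_eq_iff_eq_add'] at this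
  rw [← this]
  exact S.sub_mem (hu t ht) (hu 0 ⟨le_rfl, hT⟩)

variable (B : V →L[ℝ] V →L[ℝ] ℝ)

theorem intervalIntegrable_bilin_of_memLp (hT : 0 ≤ T)
    (h : MemLp u 2 (volume.restrict (Ioc 0 T))) :
    IntervalIntegrable (fun t => B (u t) (u t)) volume 0 T := by
  rw [intervalIntegrable_iff_integrableOn_Ioc_of_le hT]
  have h1 := (h.norm.integrable_sq).const_mul ‖B‖
  refine h1.mono' ?_ (.of_forall fun t => ?_)
  · have hc : Continuous fun v : V => B v v := B.continuous.clm_apply continuous_id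
    exact hc.comp_aestronglyMeasurable h.1
  · refine (B.le_opNorm₂ (u t) (u t)).trans_eq ?_
    ring

theorem intervalIntegrable_bilin_of_continuousOn (hT : 0 ≤ T) (h : ContinuousOn u (Icc 0 T)) :
    IntervalIntegrable (fun t => B (u t) (u t)) volume 0 T := by
  refine ContinuousOn.intervalIntegrable ?_
  rw [uIcc_of_le hT]
  have hc : Continuous fun v : V => B v v := B.continuous.clm_apply continuous_id
  exact hc.comp_continuousOn h

/-- Integrated form of an estimate for a time dependent linear image. -/
theorem energy_integral_le [CompleteSpace V] (h : IsTimeDeriv T u u') (hT : 0 ≤ T)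
    {Bc Ba Bw : V →L[ℝ] V →L[ℝ] ℝ} {M : V →L[ℝ] V} {S : Set V}
    (hS : ∀ t ∈ Icc 0 T, u t ∈ S) (hS' : ∀ᵐ t ∂volume.restrict (Ioc 0 T), u' t ∈ S)
    {K₁ K₂ K : ℝ} (h1 : ∀ v ∈ S, Bc (M v) (M v) ≤ K₁ * Ba v v)
    (h2 : ∀ v ∈ S, Bw (M v) (M v) ≤ K₂ * Ba v v) (hK₁ : K₁ ≤ K) (hK₂ : K₂ ≤ K)
    (hnonneg : ∀ v, 0 ≤ Ba v v) :
    (∫ t in (0 : ℝ)..T, Bc (M (u' t)) (M (u' t))) + (∫ t in (0 : ℝ)..T, Bw (M (u t)) (M (u t))) +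
      Bc (M (u 0)) (M (u 0)) ≤
    K * ((∫ t in (0 : ℝ)..T, Ba (u' t) (u' t)) + (∫ t in (0 : ℝ)..T, Ba (u t) (u t)) +
      Ba (u 0) (u 0)) := by
  have hu := h.continuousOn hT
  have h1' v (hv : v ∈ S) := (h1 v hv).trans (mul_le_mul_of_nonneg_right hK₁ (hnonneg v))
  have h2' v (hv : v ∈ S) := (h2 v hv).trans (mul_le_mul_of_nonneg_right hK₂ (hnonneg v))
  rw [mul_add, mul_add, ← intervalIntegral.integral_const_mul,
    ← intervalIntegral.integral_const_mul]
  refine add_le_add (add_le_add ?_ ?_) (h1' _ (hS 0 ⟨le_rfl, hT⟩))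
  · have i1 := intervalIntegrable_bilin_of_memLp Bc hT (M.comp_memLp' h.memLp)
    have i2 := (intervalIntegrable_bilin_of_memLp Ba hT h.memLp).const_mul K
    rw [intervalIntegral.integral_of_le hT, intervalIntegral.integral_of_le hT]
    refine integral_mono_ae i1.1 i2.1 ?_
    filter_upwards [hS'] with t ht
    exact h1' _ ht
  · have i1 := intervalIntegrable_bilin_of_continuousOn Bw hT (M.continuous.comp_continuousOn hu)
    have i2 := (intervalIntegrable_bilin_of_continuousOn Ba hT hu).const_mul K
    exact intervalIntegral.integral_mono_on hT i1 i2 fun t ht => h2' _ (hS t ht)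

end Time

/-! ### The global error operator -/

section Global

variable {N m : ℕ} {F : Fractures m} {A : Coeffs N m} {ι : Type*} {J : Finset ι}
  {W : TopologicalSpace.Opens Plane} {Wj : ι → TopologicalSpace.Opens Plane} {D : ℕ}

/-- The overlap bound enters twice, for the sum of local errors and for the sum of local energies of
`u`, whence `D ^ 2`. -/
theorem OverlapLE.aQForm_sum_le_of_le (h : OverlapLE J W Wj D) {Λ : ℝ} (hΛ : 0 < Λ)
    (e : ι → Vec N m) (u : Vec N m) (he : ∀ j ∈ J, vrestr F (Wj j) (e j) = e j)
    (hle : ∀ j ∈ J, Λ * aQForm F A (Wj j) (e j) (e j) ≤ aQForm F A (Wj j) u u) :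
    aQForm F A W (∑ j ∈ J, e j) (∑ j ∈ J, e j) ≤ D ^ 2 / Λ * aQForm F A W u u := by
  have h1 := h.aQForm_sum_le F A e he
  have h2 : Λ * ∑ j ∈ J, aQForm F A (Wj j) (e j) (e j) ≤ D * aQForm F A W u u := by
    rw [Finset.mul_sum]
    exact (Finset.sum_le_sum hle).trans (h.sum_aQForm_le F A u)
  rw [← le_div_iff₀' hΛ] at h2
  calc _ ≤ (D : ℝ) * (D * aQForm F A W u u / Λ) := h1.trans (by gcongr)
    _ = _ := by ring

theorem OverlapLE.cForm_sum_le_of_le (h : OverlapLE J W Wj D) {Λ E : ℝ} (hΛ : 0 < Λ) (hE : 0 ≤ E)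
    (e : ι → Vec N m) (u : Vec N m) (he : ∀ j ∈ J, vrestr F (Wj j) (e j) = e j)
    (hle : ∀ j ∈ J, Λ * cForm F A (Wj j) (e j) (e j) ≤ E * aQForm F A (Wj j) u u) :
    cForm F A W (∑ j ∈ J, e j) (∑ j ∈ J, e j) ≤ D ^ 2 * E / Λ * aQForm F A W u u := by
  have h1 := h.cForm_sum_le F A e he
  have h2 : Λ * ∑ j ∈ J, cForm F A (Wj j) (e j) (e j) ≤ E * (D * aQForm F A W u u) := by
    rw [Finset.mul_sum]
    refine (Finset.sum_le_sum hle).trans ?_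
    rw [← Finset.mul_sum]
    exact mul_le_mul_of_nonneg_left (h.sum_aQForm_le F A u) hE
  rw [← le_div_iff₀' hΛ] at h2
  calc _ ≤ (D : ℝ) * (E * (D * aQForm F A W u u) / Λ) := h1.trans (by gcongr)
    _ = _ := by ring

end Global

end GMsFEM

end

/-! ### The error operator and the global estimate. -/

set_option maxHeartbeats 2000000 in
theorem theorem2 (D : ℕ) (E : ℝ) :
    ∃ C : ℝ, 0 < C ∧
    ∀ (N m : ℕ) (F : Fractures m) (A : Coeffs N m) (G : CoarseGrid) (χ : Plane → Cutoff)
      (Γ : Set Plane) (J : Finset Plane) (hJ : J.Nonempty),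
    -- the coarse grid, its partition of unity, and the boundary condition
    (∀ k, G.overlap k ≤ D) →
    IsPartitionOfUnity G χ →
    J ⊆ G.nodes →
    IsClosed Γ → Γ ⊆ frontier G.dom →
    (∀ j ∈ J, ∀ y ∈ frontier G.dom, y ∉ Γ → χ j y = 0) →
    -- the quotients `c χ² / (κ |∇χ|²)` are at most `E`, in the neighbourhoods and on the fractures
    (∀ j ∈ J, ∀ i, ∀ᵐ x ∂volume.restrict (G.nbhd j : Set Plane),
      A.c i x * χ j x ^ 2 ≤ E * (A.κ i x * ‖gradient (χ j) x‖ ^ 2)) →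
    (∀ j ∈ J, ∀ i l, ∀ᵐ s ∂volume.restrict (F.part l (G.nbhd j)),
      A.cf l i s * (χ j).onLine F l s ^ 2 ≤
        E * (A.κf l i s * deriv ((χ j).onLine F l) s ^ 2)) →
    -- the reference solution
    ∀ (T : ℝ) (f : ℝ → Fin N → Lp ℝ 2 (volume : Measure Plane)) (u u' : ℝ → Vec N m),
    0 < T →
    MemLp f 2 (volume.restrict (Ioc 0 T)) →
    IsReferenceSolution F A G.dom Γ T f u u' →
    -- the local eigenpairs (numbered from 0) and the numbers `L j` of selected eigenfunctions
    ∀ (φ : Plane → ℕ → Vec N m) (lam : Plane → ℕ → ℝ) (L : Plane → ℕ),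
    (∀ j ∈ J, IsEigenSystem F A Γ (G.nbhd j) (χ j) (φ j) (lam j)) →
    -- the snapshot projection, its coefficients, and its projection `w` to the offline space
    ∀ (uloc : Plane → ℝ → Vec N m) (coef : Plane → ℕ → ℝ → ℝ) (usnap w : ℝ → Vec N m),
    (∀ j ∈ J, ∀ t ∈ Icc 0 T, IsLocalProjection F A Γ (G.nbhd j) (u t) (uloc j t)) →
    (∀ t ∈ Icc 0 T, usnap t = ∑ j ∈ J, vmul F (χ j) (uloc j t)) →
    (∀ j ∈ J, ∀ t ∈ Icc 0 T, HasSum (fun k => coef j k t • φ j k) (uloc j t)) →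
    (∀ t ∈ Icc 0 T,
      w t = ∑ j ∈ J, ∑ k ∈ Finset.range (L j), coef j k t • vmul F (χ j) (φ j k)) →
    -- the smallest eigenvalue that is not selected
    ∀ Λ₂ : ℝ, Λ₂ = J.inf' hJ (fun j => lam j (L j)) → 0 < Λ₂ →
    ∃ z' : ℝ → Vec N m, IsTimeDeriv T (fun t => w t - usnap t) z' ∧
      (∫ t in (0 : ℝ)..T, cForm F A G.dom (z' t) (z' t)) +
        (∫ t in (0 : ℝ)..T, aQForm F A G.dom (w t - usnap t) (w t - usnap t)) +
        cForm F A G.dom (w 0 - usnap 0) (w 0 - usnap 0) ≤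
      C ^ 2 / Λ₂ *
        ((∫ t in (0 : ℝ)..T, aQForm F A G.dom (u' t) (u' t)) +
          (∫ t in (0 : ℝ)..T, aQForm F A G.dom (u t) (u t)) +
          aQForm F A G.dom (u 0) (u 0)) := by
  -- The square of this constant dominates both `D²` and `D²|E|`; the final `+ 1` keeps it positive
  -- when `D = 0`.
  refine ⟨D * (|E| + 1) + 1, by positivity, ?_⟩
  intro N m F A G χ Γ J hJ hD hpu hJn _ _ hΓχ hE1 hE2 T f u u' hT _ hu φ lam L hφ uloc coef usnap w
    huloc husnap hcoef hw Λ hΛ hΛ0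
  have hT0 := hT.le
  have hover := G.overlapLE hD hJn
  have hb j := G.isBounded_nbhd j
  have hΛj : ∀ j ∈ J, Λ ≤ lam j (L j) := fun j hj => by
    rw [hΛ]
    exact Finset.inf'_le _ hj
  choose P hP hP' using fun j => exists_snapshot_projection F A Γ (hb j)
  -- Nodes outside `J` receive the operator 0, so that `Z` can be chosen for all `j` at once.
  have hZex : ∀ j, ∃ Z : Vec N m →L[ℝ] Vec N m, j ∈ J →
      (∀ (a : ℕ → ℝ) (ψ : Vec N m), HasSum (fun k => a k • φ j k) ψ →
        Z ψ = ∑ k ∈ Finset.range (L j), a k • vmul F (χ j) (φ j k) - vmul F (χ j) ψ) ∧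
      ∀ ψ ∈ (Submodule.span ℝ (range (φ j))).topologicalClosure,
        vrestr F (G.nbhd j) (Z ψ) = Z ψ ∧
        Λ * aQForm F A (G.nbhd j) (Z ψ) (Z ψ) ≤ aQForm F A (G.nbhd j) ψ ψ ∧
        Λ * cForm F A (G.nbhd j) (Z ψ) (Z ψ) ≤ |E| * aQForm F A (G.nbhd j) ψ ψ := fun j => by
    by_cases hj : j ∈ J
    · obtain ⟨Z, hZ⟩ := (hφ j hj).exists_error_operator (hb j)
        (G.eq_zero_of_mem_frontier hpu (hJn hj) (hΓχ j hj)) hΛ0.le (hΛj j hj) (hE1 j hj) (hE2 j hj)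
      exact ⟨Z, fun _ => hZ⟩
    · exact ⟨0, fun h => absurd h hj⟩
  choose Z hZ using hZex
  have hPu : ∀ j ∈ J, ∀ t ∈ Icc 0 T, P j (u t) = uloc j t := fun j hj t ht =>
    hP j _ _ (huloc j hj t ht)
  obtain ⟨M, hM⟩ : ∃ M : Vec N m →L[ℝ] Vec N m, ∀ v, M v = ∑ j ∈ J, Z j (P j v) :=
    ⟨∑ j ∈ J, (Z j).comp (P j), fun v => by
      rw [sum_apply]
      exact Finset.sum_congr rfl fun j _ => ContinuousLinearMap.comp_apply _ _ _⟩
  have hz : ∀ t ∈ Icc 0 T, w t - usnap t = M (u t) := fun t ht => by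
    rw [hw t ht, husnap t ht, hM, ← Finset.sum_sub_distrib]
    refine Finset.sum_congr rfl fun j hj => ?_
    rw [hPu j hj t ht, (hZ j hj).1 _ _ (hcoef j hj t ht)]
  refine ⟨fun t => M (u' t), hu.timeDeriv.clm_comp hT0 M hz, ?_⟩
  -- The functions whose local snapshot projections lie in the closed spans of the eigenfunctions;
  -- the fixed-time estimates hold on this set.
  set S : Set (Vec N m) :=
    {v | ∀ j ∈ J, P j v ∈ (Submodule.span ℝ (range (φ j))).topologicalClosure}
  have hSu : ∀ t ∈ Icc 0 T, u t ∈ S := fun t ht j hj => by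
    rw [hPu j hj t ht]
    exact (hφ j hj).complete (huloc j hj t ht).1
  -- Local projections are given only for `u`; membership passes to `u'` because the closed spans
  -- are closed subspaces. Finiteness of `J` gives one null set for all `j`.
  have hSu' : ∀ᵐ t ∂volume.restrict (Ioc 0 T), u' t ∈ S :=
    (ae_ball_iff J.countable_toSet).2 fun j hj => hu.timeDeriv.ae_mem hT0 (P j) _
      (Submodule.isClosed_topologicalClosure _) fun t ht => hSu t ht j hj
  obtain ⟨Ba, hBa⟩ := isBilin_aQForm F A G.domOpens.isOpen
  obtain ⟨Bc, hBc⟩ := isBilin_cForm F A G.domOpens.isOpen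
  have hest1 : ∀ v ∈ S, Bc (M v) (M v) ≤ (D ^ 2 * |E| / Λ) * Ba v v := fun v hv => by
    rw [hBc, hBa, hM]
    refine hover.cForm_sum_le_of_le hΛ0 (abs_nonneg E) _ v
      (fun j hj => ((hZ j hj).2 _ (hv j hj)).1) fun j hj => ?_
    exact ((hZ j hj).2 _ (hv j hj)).2.2.trans
      (mul_le_mul_of_nonneg_left (hP' j v) (abs_nonneg E))
  have hest2 : ∀ v ∈ S, Ba (M v) (M v) ≤ (D ^ 2 / Λ) * Ba v v := fun v hv => by
    rw [hBa, hBa, hM]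
    refine hover.aQForm_sum_le_of_le hΛ0 _ v
      (fun j hj => ((hZ j hj).2 _ (hv j hj)).1) fun j hj => ?_
    exact ((hZ j hj).2 _ (hv j hj)).2.1.trans (hP' j v)
  have hE0 := abs_nonneg E
  have hDn : (0 : ℝ) ≤ D := Nat.cast_nonneg D
  have hC : (D : ℝ) ^ 2 * (|E| + 1) ≤ (D * (|E| + 1) + 1) ^ 2 := by
    have h1 : (0 : ℝ) ≤ D ^ 2 * (|E| + 1) * |E| := by positivity
    have h2 : 0 ≤ (D : ℝ) * (|E| + 1) := by positivity
    nlinarith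
  have hD2 : (0 : ℝ) ≤ D ^ 2 := by positivity
  have hDE : (0 : ℝ) ≤ D ^ 2 * |E| := by positivity
  have hmain := energy_integral_le hu.timeDeriv hT0 hSu hSu' hest1 hest2
    (K := (D * (|E| + 1) + 1) ^ 2 / Λ)
    (div_le_div_of_nonneg_right (by linarith) hΛ0.le)
    (div_le_div_of_nonneg_right (by linarith) hΛ0.le)
    fun v => by rw [hBa]; exact aQForm_self_nonneg F A G.domOpens.isOpen.measurableSet
  simp only [hBa, hBc] at hmain
  have hcongr : ∫ t in (0 : ℝ)..T, aQForm F A G.dom (w t - usnap t) (w t - usnap t) =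
      ∫ t in (0 : ℝ)..T, aQForm F A G.dom (M (u t)) (M (u t)) := by
    refine intervalIntegral.integral_congr fun t ht => ?_
    rw [uIcc_of_le hT0] at ht
    simp only [hz t ht]
  rw [hcongr, hz 0 ⟨le_rfl, hT0⟩]
  exact hmain
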